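/- **PF-LS oracle inequality.** There are universal constants $C, c>0$ such that the following holds. Let $m,\overline L\ge 0$ and $p,T\ge 1$ be integers, let $N_1,N$ be integers with $T\le N_1\le N/10$ and $$N\ \ge\ c\,Tp\,\log^2(2Tp)\,\log^2(2Np),$$ let $\mu>0$ and $\delta\in(0,1)$. Let $(\mathcal F_t)_{t\ge 0}$ be a filtration on a probability space and $G_\star\in\mathbb R^{m\times Tp}$. For $1\le t\le N$ let $\mathbf u_t\in\mathbb R^p$ be $\mathcal F_t$-measurable with $\mathbf u_t\mid\mathcal F_{t-1}\sim\mathcal N(0,I_p)$, and put $\overline{\mathbf u}_t=[\mathbf u_t\,|\,\mathbf u_{t-1}\,|\dots|\,\mathbf u_{t-T+1}]\in\mathbb R^{Tp}$. For $N_1\le t\le N$ let the errors $\boldsymbol\delta_t\in\mathbb R^m$ and the features $\mathbf k_t\in\mathbb R^{\overline L}$ be $\mathcal F_{t-T}$-measurable, and let $\mathbf y_t=G_\star\overline{\mathbf u}_t+\boldsymbol\delta_t$. Let $\boldsymbol\Delta$ and $\mathbf K$ be the matrices with rows $\boldsymbol\delta_t^\top$ and $\mathbf k_t^\top$, $N_1\le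 t\le N$. The prefiltered least squares estimator is $$\hat\phi\in\arg\min_{\phi\in\mathbb R^{m\times\overline L}}\sum_{t=N_1}^N\|\mathbf y_t-\phi\mathbf k_t\|_2^2+\mu^2\|\phi\|_F^2,\qquad \widehat G_{\mathrm{PF}}\in\arg\min_{G\in\mathbb R^{m\times Tp}}\sum_{t=N_1}^N\|(\mathbf y_t-\hat\phi\,\mathbf k_t)-G\overline{\mathbf u}_t\|_2^2 .$$ Write $\log_+(x)=\max\{1,\log x\}$ (so $\log_+(0)=1$), $\ell\ell(x)=\log_+(\log_+(x))$, $\tilde p=p\min\{T,\log^2(eTp)\log^2(Tp)\}$, and $$\mathsf{Opt}_\mu=\min_{\phi\in\mathbb R^{m\times\overline L}}\|\boldsymbol\Delta-\mathbf K\phi^\top\|_{\mathrm{op}}+\mu\|\phi\|_{\mathrm{op}},$$ $$\mathsf{Ovfit}_\mu(\delta)=\|G_\star\|_{\mathrm{op}}\min\Big\{N^{1/2},\,T^{1/2}\sqrt{\log\tfrac1\delta+\tilde p+\log\det(I+\mu^{-2}\mathbf K\mathbf K^\top)^{1/2}}\Big\},$$ $$\mathbf d_{\mathrm{eff}}(o,\overline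 L,\mu)=\tilde p+m+\ell\ell\big(\tfrac{o}{\mu}\big)+\overline L\,\log_+\Big(o+\tfrac{\sqrt N\,\|\mathbf K\|_{\mathrm{op}}}{\mu^2}\Big),\qquad \delta_{\overline{\mathbf U}}=(2Np)^{-\log^2(2Tp)\,\log(2Np)} .$$ Then, with probability at least $1-\delta-\delta_{\overline{\mathbf U}}$, every such $\widehat G_{\mathrm{PF}}$ satisfies $$\|\widehat G_{\mathrm{PF}}-G_\star\|_{\mathrm{op}}\le C\,\frac{N^{-1/2}\big(\mathsf{Opt}_\mu+\mathsf{Ovfit}_\mu(\delta)+\mu\big)}{\sqrt N}\sqrt{T\Big(\log\tfrac1\delta+\mathbf d_{\mathrm{eff}}\big(\mathsf{Opt}_\mu+\mathsf{Ovfit}_\mu(\delta),\overline L,\mu\big)\Big)} .$$ -/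

import Mathlib

open MeasureTheory ProbabilityTheory
open scoped Matrix Matrix.Norms.L2Operator

universe u

/-! Throughout, the norm `‖A‖` of a real matrix `A` is its operator norm between Euclidean
spaces (scope `Matrix.Norms.L2Operator`). -/

namespace PFLS

noncomputable section

/-- `log₊ x = max {1, log x}`. -/
def logPlus (x : ℝ) : ℝ := max 1 (Real.log x)

/-- `ℓℓ(x) = log₊ (log₊ x)`. -/
def lil (x : ℝ) : ℝ := logPlus (logPlus x)

/-- The conditional law of `X` given the sub-σ-algebra `𝓖` is the fixed measure `γ`:
`P(X ∈ s | 𝓖) = γ(s)` almost surely, for every measurable set `s`. -/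
def HasCondLaw {Ω E : Type*} [MeasurableSpace Ω] [MeasurableSpace E] (P : Measure Ω)
    (𝓖 : MeasurableSpace Ω) (X : Ω → E) (γ : Measure E) : Prop :=
  ∀ s : Set E, MeasurableSet s → P⟦X ⁻¹' s | 𝓖⟧ =ᵐ[P] fun _ => γ.real s

/-- The standard Gaussian measure `N(0, I_p)` on `ℝᵖ`. -/
def stdNormal (p : ℕ) : Measure (Fin p → ℝ) := Measure.pi fun _ => gaussianReal 0 1

/-- The concatenated input `ū_t = [u_t | u_{t-1} | … | u_{t-T+1}] ∈ ℝ^{Tp}`; the block with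
index `j` is `u_{t-j}`. It is only used for `t ≥ T`. -/
def concatInput {p : ℕ} (T : ℕ) (x : ℕ → Fin p → ℝ) (t : ℕ) : Fin T × Fin p → ℝ :=
  fun q => x (t - q.1) q.2

/-- The matrix whose rows are `a_{N₁}, …, a_N`. -/
def rowsMatrix {d : ℕ} (N₁ N : ℕ) (a : ℕ → Fin d → ℝ) :
    Matrix (Finset.Icc N₁ N) (Fin d) ℝ :=
  Matrix.of fun t => a t

/-- The semi-parametric model on the time horizon `1, …, N` with recorded times `N₁, …, N`:
inputs `x_t ∈ ℝᵖ`, errors `e_t ∈ ℝᵐ`, features `k_t ∈ ℝᴸ`, observations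
`y_t = G ū_t + e_t ∈ ℝᵐ`. -/
structure IsSemiParametricModel {Ω : Type*} [mΩ : MeasurableSpace Ω] (P : Measure Ω)
    (𝓕 : Filtration ℕ mΩ) {m p L : ℕ} (T N₁ N : ℕ) (G : Matrix (Fin m) (Fin T × Fin p) ℝ)
    (x : ℕ → Ω → Fin p → ℝ) (e : ℕ → Ω → Fin m → ℝ) (k : ℕ → Ω → Fin L → ℝ)
    (y : ℕ → Ω → Fin m → ℝ) : Prop where
  input_measurable : ∀ t ∈ Finset.Icc 1 N, Measurable[𝓕 t] (x t)
  input_law : ∀ t ∈ Finset.Icc 1 N, HasCondLaw P (𝓕 (t - 1)) (x t) (stdNormal p)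
  error_measurable : ∀ t ∈ Finset.Icc N₁ N, Measurable[𝓕 (t - T)] (e t)
  feature_measurable : ∀ t ∈ Finset.Icc N₁ N, Measurable[𝓕 (t - T)] (k t)
  observation_eq : ∀ t ∈ Finset.Icc N₁ N, ∀ ω,
    y t ω = G *ᵥ concatInput T (fun s => x s ω) t + e t ω

/-- `φ` is a ridge prefilter: it minimizes
`∑_{t=N₁}^N ‖y_t - φ k_t‖₂² + μ² ‖φ‖_F²` over all `m × L` matrices. -/
def IsRidgeFilter {m L : ℕ} (N₁ N : ℕ) (μ : ℝ) (k : ℕ → Fin L → ℝ) (y : ℕ → Fin m → ℝ)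
    (φ : Matrix (Fin m) (Fin L) ℝ) : Prop :=
  IsMinOn (fun ψ : Matrix (Fin m) (Fin L) ℝ =>
    (∑ t ∈ Finset.Icc N₁ N, ∑ i, (y t i - (ψ *ᵥ k t) i) ^ 2) + μ ^ 2 * ∑ i, ∑ j, ψ i j ^ 2)
    Set.univ φ

/-- `H` is an ordinary least squares estimate for regressing the filtered observations
`y_t - φ k_t` on `ū_t`: it minimizes `∑_{t=N₁}^N ‖(y_t - φ k_t) - H ū_t‖₂²`. -/
def IsFilteredOLS {m p L : ℕ} (T N₁ N : ℕ) (φ : Matrix (Fin m) (Fin L) ℝ)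
    (x : ℕ → Fin p → ℝ) (k : ℕ → Fin L → ℝ) (y : ℕ → Fin m → ℝ)
    (H : Matrix (Fin m) (Fin T × Fin p) ℝ) : Prop :=
  IsMinOn (fun H' : Matrix (Fin m) (Fin T × Fin p) ℝ =>
    ∑ t ∈ Finset.Icc N₁ N, ∑ i, ((y t i - (φ *ᵥ k t) i) - (H' *ᵥ concatInput T x t) i) ^ 2)
    Set.univ H

/-- `H` is a prefiltered least squares estimate: ridge prefilter first, then ordinary least
squares on the filtered observations. -/
def IsPFLS {m p L : ℕ} (T N₁ N : ℕ) (μ : ℝ) (x : ℕ → Fin p → ℝ) (k : ℕ → Fin L → ℝ)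
    (y : ℕ → Fin m → ℝ) (H : Matrix (Fin m) (Fin T × Fin p) ℝ) : Prop :=
  ∃ φ : Matrix (Fin m) (Fin L) ℝ,
    IsRidgeFilter N₁ N μ k y φ ∧ IsFilteredOLS T N₁ N φ x k y H

/-- `Opt_μ = min_φ ‖Δ - K φᵀ‖_op + μ ‖φ‖_op`, where `Δ` and `K` have rows `e_t` and `k_t`. -/
def Opt {m L : ℕ} (N₁ N : ℕ) (μ : ℝ) (e : ℕ → Fin m → ℝ) (k : ℕ → Fin L → ℝ) : ℝ :=
  ⨅ φ : Matrix (Fin m) (Fin L) ℝ, ‖rowsMatrix N₁ N e - rowsMatrix N₁ N k * φᵀ‖ + μ * ‖φ‖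

/-- `p̃ = p · min {T, log²(eTp) log²(Tp)}`. -/
def pTilde (T p : ℕ) : ℝ :=
  p * min (T : ℝ) (Real.log (Real.exp 1 * T * p) ^ 2 * Real.log (T * p) ^ 2)

/-- `Ovfit_μ(δ) = ‖G‖_op · min {N^{1/2},
  T^{1/2} (log(1/δ) + p̃ + log det(I + μ⁻² K Kᵀ)^{1/2})^{1/2}}`. -/
def Ovfit {m p L : ℕ} (T N₁ N : ℕ) (μ δ : ℝ) (G : Matrix (Fin m) (Fin T × Fin p) ℝ)
    (k : ℕ → Fin L → ℝ) : ℝ :=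
  ‖G‖ * min (√(N : ℝ)) (√(T : ℝ) * √(Real.log (1 / δ) + pTilde T p +
    Real.log (√(Matrix.det (1 + (μ ^ 2)⁻¹ • (rowsMatrix N₁ N k * (rowsMatrix N₁ N k)ᵀ))))))

/-- `d_eff(o, L, μ) = p̃ + m + ℓℓ(o/μ) + L · log₊(o + √N ‖K‖_op / μ²)`. -/
def dEff {L : ℕ} (m p T N₁ N : ℕ) (μ : ℝ) (k : ℕ → Fin L → ℝ) (o : ℝ) : ℝ :=
  pTilde T p + m + lil (o / μ) + L * logPlus (o + √(N : ℝ) * ‖rowsMatrix N₁ N k‖ / μ ^ 2)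

/-- `δ_Ū = (2Np)^{-log²(2Tp) log(2Np)}`. -/
def deltaU (T N p : ℕ) : ℝ :=
  (2 * N * p : ℝ) ^ (-(Real.log (2 * T * p) ^ 2 * Real.log (2 * N * p)))

/-- The right-hand side of the oracle inequality, without the universal constant, for one
realization of the errors and features. -/
def oracleBound {m p L : ℕ} (T N₁ N : ℕ) (μ δ : ℝ) (G : Matrix (Fin m) (Fin T × Fin p) ℝ)
    (e : ℕ → Fin m → ℝ) (k : ℕ → Fin L → ℝ) : ℝ :=
  (√(N : ℝ))⁻¹ * (Opt N₁ N μ e k + Ovfit T N₁ N μ δ G k + μ) / √(N : ℝ) *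
    √(T * (Real.log (1 / δ) +
      dEff m p T N₁ N μ k (Opt N₁ N μ e k + Ovfit T N₁ N μ δ G k)))

end

end PFLS

/-! Fix a unit vector `w` of ℝᵐ, later taken in a 1/2-net of the sphere. The normal equations of the
final regression, tested at `h = (H - G)ᵀ w`, say `∑ ⟨ū_t, h⟩² = ∑ ⟨ū_t, h⟩ r_t`, where `r_t = ⟨w,
e_t⟩ - ⟨φ'ᵀ w, k_t⟩` is the error left by the ridge filter `φ'` (`eucl_transpose_mulVec_le`). So two
facts suffice: `∑ ⟨ū_t, h⟩² ≥ (N/2) ‖h‖²`, and a bound on the correlation of the inputs with `r`.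

Isometry. Up to boundary terms, `∑ ⟨ū_t, v⟩²` is the energy of the convolution of `u` with the
filter `v`. By Parseval it is an average over `3T` frequencies of differences of windowed energies
of the modulated input (`convolution_energy_eq`). Each of these is a quadratic form in only `p`
complex variables, so the union bound costs a factor exponential in `p` and polynomial in `T`, not
exponential in `Tp`. For fixed frequency and direction, windows starting in one residue class are
disjoint, and a Chernoff bound for sums of independent squares applies (`measure_window_energy`).

Correlation. For one lag `j < T`, `u_{t-j}` is independent of the past that determines `e_t` and
`k_t`, so its correlation with a predictable sequence is a Gaussian martingale transform. The
mixture supermartingale `det(V)^{-1/2} exp(Sᵀ V⁻¹ S / 2)` has constant mean, which gives a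
self-normalized bound (`IsGaussianTransform.self_normalized`). The lags are recombined by
Cauchy–Schwarz, at the price `√T`. For the features the bound is uniform in the direction. It shows
that the ridge filter is within `O(Opt + Ovfit)` of any near-optimal filter (`ridge_comparison`),
which controls both the residual `r` and the size of `φ'ᵀ w`. Since `φ'` depends on all the data,
`r` is not predictable; the bound for `r` is obtained on nets of deterministic filters at every
resolution `2⁻ᵃ`, and for every dyadic ridge parameter `μ² 4ⁱ`, with failure probabilities summing
to `δ` (`IsGood.abs_sum_residual_le`). The scale `i` is about `log (o/μ)` and carries a polynomial
weight, whence the iterated logarithm.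

Degenerate regime. Numerical constants in the feature bound are absorbed by `D = log(1/δ) + p̃ + log
det(·)^{1/2}` when `D ≥ 1/2`. Otherwise `T = p = 1`, `p̃ = 0` and `Ovfit` may be arbitrarily small.
There smaller ridge parameters `μ² / 4ⁱ` show that the correlation with the features has relative
size `W^{1/4}`, with `W` the log-determinant term. This factor enters twice, once in the distance of
the ridge filter from the near-optimal one and once in the correlation with that difference, and
yields `√W ≤ √D` (`IsGood.abs_sum_error_le_of_lt_half`). -/

namespace PFLS

/-! ### Nets -/

section Nets

variable {E : Type*} [NormedAddCommGroup E] [NormedSpace ℝ E] [FiniteDimensional ℝ E]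

open Metric Module in
/-- An `r`-separated set inside the ball of radius `R` has at most `(1 + 2R/r)^d` elements. -/
theorem card_le_of_separated_ball {R r : ℝ} (hR : 0 ≤ R) (hr : 0 < r) (s : Finset E)
    (hs : ∀ c ∈ s, ‖c‖ ≤ R) (h : ∀ c ∈ s, ∀ d ∈ s, c ≠ d → r ≤ dist c d) :
    (s.card : ℝ) ≤ (1 + 2 * R / r) ^ finrank ℝ E := by
  borelize E
  let μ : Measure E := Measure.addHaar
  have hδ : 0 < r / 2 := by positivity
  have hρ : 0 < R + r / 2 := by positivity
  set A := ⋃ c ∈ s, ball (c : E) (r / 2) with hA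
  have D : Set.Pairwise (s : Set E) (Function.onFun Disjoint fun c => ball (c : E) (r / 2)) := by
    rintro c hc d hd hcd
    apply ball_disjoint_ball
    linarith [h c hc d hd hcd]
  have A_subset : A ⊆ ball (0 : E) (R + r / 2) := by
    refine Set.iUnion₂_subset fun x hx => ?_
    apply ball_subset_ball'
    rw [dist_zero_right]
    linarith [hs x hx]
  have I : (s.card : ENNReal) * ENNReal.ofReal ((r / 2) ^ finrank ℝ E) * μ (ball 0 1) ≤
      ENNReal.ofReal ((R + r / 2) ^ finrank ℝ E) * μ (ball 0 1) :=
    calc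
      (s.card : ENNReal) * ENNReal.ofReal ((r / 2) ^ finrank ℝ E) * μ (ball 0 1) = μ A := by
        rw [hA, measure_biUnion_finset D fun c _ => measurableSet_ball]
        simp only [μ.addHaar_ball_of_pos _ hδ]
        simp only [Finset.sum_const, nsmul_eq_mul, mul_assoc]
      _ ≤ μ (ball (0 : E) (R + r / 2)) := measure_mono A_subset
      _ = ENNReal.ofReal ((R + r / 2) ^ finrank ℝ E) * μ (ball 0 1) := by
        simp only [μ.addHaar_ball_of_pos _ hρ]
  have J : (s.card : ENNReal) * ENNReal.ofReal ((r / 2) ^ finrank ℝ E) ≤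
      ENNReal.ofReal ((R + r / 2) ^ finrank ℝ E) :=
    (ENNReal.mul_le_mul_iff_left (measure_ball_pos _ _ zero_lt_one).ne' measure_ball_lt_top.ne).1 I
  have K : (s.card : ℝ) * (r / 2) ^ finrank ℝ E ≤ (R + r / 2) ^ finrank ℝ E := by
    have := ENNReal.toReal_le_of_le_ofReal (pow_nonneg hρ.le _) J
    rwa [ENNReal.toReal_mul, ENNReal.toReal_natCast, ENNReal.toReal_ofReal (by positivity)] at this
  have e : 1 + 2 * R / r = (R + r / 2) / (r / 2) := by field_simp; ring
  rw [e, div_pow, le_div_iff₀ (by positivity)]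
  exact K

/-- A bounded set in a finite-dimensional space has a net of cardinality `(1 + 2R/r)^d`. -/
theorem exists_net {R r : ℝ} (hR : 0 ≤ R) (hr : 0 < r) (S : Set E) (hS : ∀ x ∈ S, ‖x‖ ≤ R) :
    ∃ s : Finset E, ↑s ⊆ S ∧ (s.card : ℝ) ≤ (1 + 2 * R / r) ^ Module.finrank ℝ E ∧
      ∀ x ∈ S, ∃ y ∈ s, ‖x - y‖ ≤ r := by
  classical
  let Q : ℕ → Prop := fun n => ∃ s : Finset E, ↑s ⊆ S ∧
    (∀ c ∈ s, ∀ d ∈ s, c ≠ d → r ≤ dist c d) ∧ s.card = n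
  have hQ0 : Q 0 := ⟨∅, by simp, by simp, rfl⟩
  have hb : ∀ n, Q n → n ≤ ⌊(1 + 2 * R / r) ^ Module.finrank ℝ E⌋₊ := by
    rintro n ⟨s, h1, h2, rfl⟩
    exact Nat.le_floor (card_le_of_separated_ball hR hr s (fun c hc => hS c (h1 hc)) h2)
  -- A separated subset of maximal cardinality is a net: a point farther than `r` from all of it
  -- could be added.
  obtain ⟨s, h1, h2, h3⟩ := Nat.findGreatest_spec (P := Q) (Nat.zero_le _) hQ0
  refine ⟨s, h1, card_le_of_separated_ball hR hr s (fun c hc => hS c (h1 hc)) h2, ?_⟩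
  intro x hx
  by_contra! hcon
  have hxs : x ∉ s := fun hxs => by
    have := hcon x hxs
    simp at this
    linarith
  have : Q (s.card + 1) := by
    refine ⟨insert x s, ?_, ?_, Finset.card_insert_of_notMem hxs⟩
    · intro y hy
      rcases Finset.mem_insert.1 (Finset.mem_coe.1 hy) with rfl | hy
      · exact hx
      · exact h1 hy
    · intro c hc d hd hcd
      rcases Finset.mem_insert.1 hc with hc | hc <;> rcases Finset.mem_insert.1 hd with hd | hd
      · exact absurd (hc.trans hd.symm) hcd
      · rw [hc, dist_eq_norm]; exact (hcon d hd).le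
      · rw [hd, dist_comm, dist_eq_norm]; exact (hcon c hc).le
      · exact h2 c hc d hd hcd
  have h4 := Nat.le_findGreatest (hb _ this) this
  rw [← h3] at h4
  exact absurd h4 (Nat.not_succ_le_self _)

end Nets

/-- A `1/2`-net of the Euclidean unit sphere, in a form that bounds norms by linear functionals. -/
theorem exists_sphere_net (d : ℕ) : ∃ s : Finset (EuclideanSpace ℝ (Fin d)),
    (s.card : ℝ) ≤ 5 ^ d ∧ (∀ z ∈ s, ‖z‖ = 1) ∧
    ∀ (F : Type) [SeminormedAddCommGroup F] [NormedSpace ℝ F]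
      (A : EuclideanSpace ℝ (Fin d) →ₗ[ℝ] F) (c : ℝ), 0 ≤ c → (∀ z ∈ s, ‖A z‖ ≤ c) →
      ∀ x, ‖A x‖ ≤ 2 * c * ‖x‖ := by
  obtain ⟨s, h1, h2, h3⟩ := exists_net (E := EuclideanSpace ℝ (Fin d)) (R := 1) (r := 1 / 2)
    zero_le_one (by norm_num) {x | ‖x‖ = 1} (fun x hx => le_of_eq hx)
  refine ⟨s, ?_, fun z hz => h1 hz, ?_⟩
  · norm_num at h2; simpa using h2
  intro F _ _ A c hc hA
  let A' := A.toContinuousLinearMap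
  have hb : ∀ x, ‖A x‖ ≤ ‖A'‖ * ‖x‖ := fun x => A'.le_opNorm x
  -- Approximating a unit vector by the net bounds the operator norm by `c` plus half of itself; the
  -- half is absorbed.
  have h4 : ‖A'‖ ≤ c + ‖A'‖ * (1 / 2) := by
    refine A'.opNorm_le_of_unit_norm (by positivity) fun x hx => ?_
    obtain ⟨y, hy, hxy⟩ := h3 x hx
    calc ‖A x‖ = ‖A y + A (x - y)‖ := by rw [← map_add]; congr 2; abel
      _ ≤ ‖A y‖ + ‖A (x - y)‖ := norm_add_le _ _
      _ ≤ c + ‖A'‖ * (1 / 2) := by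
        refine add_le_add (hA y hy) ((hb _).trans ?_)
        gcongr
  intro x
  refine (hb x).trans ?_
  gcongr
  linarith


/-! ### Gaussian integrals and conditional laws -/

/-- Completing the square turns the weighted standard density into a constant times the density of a
Gaussian with variance `v = (1 - 2c)⁻¹` and mean `b v`. -/
theorem lintegral_exp_quadratic_gaussian (b : ℝ) {c : ℝ} (hc : c < 1 / 2) :
    ∫⁻ g, ENNReal.ofReal (Real.exp (b * g + c * g ^ 2)) ∂(gaussianReal 0 1) =
      ENNReal.ofReal ((√(1 - 2 * c))⁻¹ * Real.exp (b ^ 2 / (2 * (1 - 2 * c)))) := by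
  have h0 : 0 < 1 - 2 * c := by linarith
  obtain ⟨v, hv⟩ : ∃ v : NNReal, (v : ℝ) = (1 - 2 * c)⁻¹ := ⟨⟨(1 - 2 * c)⁻¹, by positivity⟩, rfl⟩
  have hv0 : v ≠ 0 := by
    intro h
    rw [h] at hv
    have : 0 < (1 - 2 * c)⁻¹ := by positivity
    simp at hv
    linarith
  rw [gaussianReal_of_var_ne_zero _ one_ne_zero,
    lintegral_withDensity_eq_lintegral_mul _ (measurable_gaussianPDF 0 1) (by fun_prop)]
  have key : ∀ g : ℝ, (gaussianPDF 0 1 * fun g => ENNReal.ofReal (Real.exp (b * g + c * g ^ 2))) g =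
      ENNReal.ofReal ((√(1 - 2 * c))⁻¹ * Real.exp (b ^ 2 / (2 * (1 - 2 * c)))) *
        gaussianPDF (b * v) v g := by
    intro g
    simp only [Pi.mul_apply, gaussianPDF]
    rw [← ENNReal.ofReal_mul (gaussianPDFReal_nonneg _ _ _), ← ENNReal.ofReal_mul (by positivity)]
    congr 1
    simp only [gaussianPDFReal, hv, NNReal.coe_one]
    have e1 : √(2 * Real.pi * (1 - 2 * c)⁻¹) = √(2 * Real.pi * 1) * (√(1 - 2 * c))⁻¹ := by
      rw [Real.sqrt_mul (by positivity), Real.sqrt_inv, mul_one]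
    rw [e1, mul_inv, inv_inv, mul_assoc, ← Real.exp_add]
    have h1 : √(1 - 2 * c) ≠ 0 := (Real.sqrt_pos.2 h0).ne'
    have e2 : -(g - 0) ^ 2 / (2 * 1) + (b * g + c * g ^ 2) =
        b ^ 2 / (2 * (1 - 2 * c)) + -(g - b * (1 - 2 * c)⁻¹) ^ 2 / (2 * (1 - 2 * c)⁻¹) := by
      field_simp
      ring
    rw [e2, Real.exp_add]
    field_simp
  simp_rw [key]
  rw [lintegral_const_mul _ (measurable_gaussianPDF _ _), lintegral_gaussianPDF_eq_one _ hv0, mul_one]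

section

variable {Ω : Type*} {𝓖 : MeasurableSpace Ω} [mΩ : MeasurableSpace Ω] {P : Measure Ω}
  [IsProbabilityMeasure P]

theorem HasCondLaw.real_inter_preimage {E : Type*} [MeasurableSpace E]
    (h𝓖 : 𝓖 ≤ mΩ) {X : Ω → E} {γ : Measure E} (hX : Measurable X) (h : HasCondLaw P 𝓖 X γ)
    {A : Set Ω} (hA : MeasurableSet[𝓖] A) {s : Set E} (hs : MeasurableSet s) :
    P.real (A ∩ X ⁻¹' s) = P.real A * γ.real s := by
  have hint : Integrable ((X ⁻¹' s).indicator (fun _ => (1 : ℝ))) P :=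
    (integrable_const 1).indicator (hX hs)
  have h1 := setIntegral_condExp h𝓖 hint hA
  have h2 : ∫ ω in A, (P[(X ⁻¹' s).indicator (fun _ => (1 : ℝ))|𝓖]) ω ∂P = ∫ ω in A, γ.real s ∂P :=
    integral_congr_ae ((h s hs).filter_mono (ae_mono Measure.restrict_le_self))
  rw [h2, setIntegral_const, setIntegral_indicator (hX hs), setIntegral_const] at h1
  simpa using h1.symm

theorem HasCondLaw.map_eq {E : Type*} [MeasurableSpace E]
    (h𝓖 : 𝓖 ≤ mΩ) {X : Ω → E} {γ : Measure E} [IsProbabilityMeasure γ] (hX : Measurable X)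
    (h : HasCondLaw P 𝓖 X γ) : P.map X = γ := by
  ext s hs
  have := h.real_inter_preimage h𝓖 hX MeasurableSet.univ hs
  simp only [Set.univ_inter, probReal_univ, one_mul] at this
  rw [Measure.map_apply hX hs]
  exact (measureReal_eq_measureReal_iff).1 this

/-- Integrating the conditional probability over an event of `𝓖` factorizes the joint probability,
because the conditional law is a fixed measure. From here on only independence and the marginal law
are used. -/
theorem HasCondLaw.indep {E : Type*} [mE : MeasurableSpace E]
    (h𝓖 : 𝓖 ≤ mΩ) {X : Ω → E} {γ : Measure E} (hX : Measurable X)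
    (h : HasCondLaw P 𝓖 X γ) : Indep 𝓖 (mE.comap X) P := by
  rw [Indep_iff]
  rintro A _ hA ⟨s, hs, rfl⟩
  have h1 := h.real_inter_preimage h𝓖 hX hA hs
  have h2 := h.real_inter_preimage h𝓖 hX MeasurableSet.univ hs
  simp only [Set.univ_inter, probReal_univ, one_mul] at h2
  rw [← h2] at h1
  simp only [measureReal_def, ← ENNReal.toReal_mul] at h1
  exact (ENNReal.toReal_eq_toReal_iff' (by finiteness) (by finiteness)).1 h1

theorem lintegral_comp_of_indepFun {E F : Type*} [MeasurableSpace E] [MeasurableSpace F]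
    {Z : Ω → E} {X : Ω → F} (hZ : Measurable Z) (hX : Measurable X) (h : IndepFun Z X P)
    {f : E × F → ENNReal} (hf : Measurable f) :
    ∫⁻ ω, f (Z ω, X ω) ∂P = ∫⁻ ω, ∫⁻ x, f (Z ω, x) ∂(P.map X) ∂P := by
  have : IsProbabilityMeasure (P.map X) := Measure.isProbabilityMeasure_map hX.aemeasurable
  have h1 := (indepFun_iff_map_prod_eq_prod_map_map hZ.aemeasurable hX.aemeasurable).1 h
  rw [← lintegral_map (f := f) hf (hZ.prodMk hX), h1, lintegral_prod _ hf.aemeasurable,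
    lintegral_map hf.lintegral_prod_right' hZ]

/-- Freezing the past: the coefficients are functions of `𝓖`, so by Fubini the Gaussian variable can
be integrated out with `A`, `B`, `C` held constant. Working with `lintegral` avoids integrability
conditions. -/
theorem lintegral_exp_quadratic_of_indep (h𝓖 : 𝓖 ≤ mΩ) {X : Ω → ℝ}
    (hX : Measurable X) (hind : Indep 𝓖 (MeasurableSpace.comap X inferInstance) P)
    (hlaw : P.map X = gaussianReal 0 1) {A B C : Ω → ℝ} (hA : Measurable[𝓖] A)
    (hB : Measurable[𝓖] B) (hC : Measurable[𝓖] C) (hA0 : ∀ ω, 0 ≤ A ω) (hC2 : ∀ ω, C ω < 1 / 2) :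
    ∫⁻ ω, ENNReal.ofReal (A ω * Real.exp (B ω * X ω + C ω * X ω ^ 2)) ∂P =
      ∫⁻ ω, ENNReal.ofReal (A ω * ((√(1 - 2 * C ω))⁻¹ *
        Real.exp (B ω ^ 2 / (2 * (1 - 2 * C ω))))) ∂P := by
  have hZ : Measurable[𝓖] (fun ω => (A ω, B ω, C ω)) := hA.prodMk (hB.prodMk hC)
  have hi : IndepFun (fun ω => (A ω, B ω, C ω)) X P :=
    indep_of_indep_of_le_left hind hZ.comap_le
  have := lintegral_comp_of_indepFun (hZ.mono h𝓖 le_rfl) hX hi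
    (f := fun q : (ℝ × ℝ × ℝ) × ℝ =>
      ENNReal.ofReal (q.1.1 * Real.exp (q.1.2.1 * q.2 + q.1.2.2 * q.2 ^ 2))) (by fun_prop)
  simp only at this
  rw [this, hlaw]
  refine lintegral_congr fun ω => ?_
  simp_rw [ENNReal.ofReal_mul (hA0 ω)]
  rw [lintegral_const_mul _ (by fun_prop), lintegral_exp_quadratic_gaussian _ (hC2 ω)]

end

/-! ### A self-normalized deviation bound -/

section LinearAlgebra

variable {d : ℕ}

theorem sherman_morrison {V : Matrix (Fin d) (Fin d) ℝ} (hV : V.PosDef) (k : Fin d → ℝ) :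
    (V + Matrix.vecMulVec k k)⁻¹ =
      V⁻¹ - (1 + k ⬝ᵥ (V⁻¹ *ᵥ k))⁻¹ • Matrix.vecMulVec (V⁻¹ *ᵥ k) (k ᵥ* V⁻¹) := by
  have hq : 0 ≤ k ⬝ᵥ (V⁻¹ *ᵥ k) := by
    simpa using hV.inv.posSemidef.dotProduct_mulVec_nonneg k
  have h1 : 1 + k ⬝ᵥ (V⁻¹ *ᵥ k) ≠ 0 := by positivity
  apply Matrix.inv_eq_right_inv
  have hVV : V * V⁻¹ = 1 := Matrix.mul_nonsing_inv _ hV.det_pos.ne'.isUnit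
  rw [add_mul, mul_sub, mul_sub, hVV, Matrix.mul_smul, Matrix.mul_smul, Matrix.mul_vecMulVec,
    Matrix.mulVec_mulVec, hVV, Matrix.one_mulVec, Matrix.vecMulVec_mul_vecMulVec,
    Matrix.vecMulVec_mul]
  set q := k ⬝ᵥ (V⁻¹ *ᵥ k)
  set w := k ᵥ* V⁻¹
  ext i j
  simp only [Matrix.add_apply, Matrix.sub_apply, Matrix.smul_apply, Matrix.vecMulVec_apply,
    smul_eq_mul, Pi.smul_apply]
  field_simp
  ring

end LinearAlgebra

section LinearAlgebra

variable {d : ℕ}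

theorem det_add_vecMulVec {V : Matrix (Fin d) (Fin d) ℝ} (hV : V.PosDef) (k : Fin d → ℝ) :
    (V + Matrix.vecMulVec k k).det = V.det * (1 + k ⬝ᵥ (V⁻¹ *ᵥ k)) := by
  have h := Matrix.det_add_replicateCol_mul_replicateRow (ι := Unit) (A := V)
    (hV.det_pos.ne'.isUnit) k k
  rw [← Matrix.vecMulVec_eq] at h
  rw [h]
  congr 1
  rw [Matrix.mul_assoc, ← Matrix.replicateCol_mulVec]
  simp [Matrix.mul_apply, dotProduct]

/-- Expands the updated self-normalized quadratic form as a polynomial of degree two in the new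
Gaussian `g`, which is the shape that the Gaussian integral handles exactly. -/
theorem quadratic_inv_add_vecMulVec {V : Matrix (Fin d) (Fin d) ℝ} (hV : V.PosDef)
    (k S : Fin d → ℝ) (g : ℝ) :
    (S + g • k) ⬝ᵥ ((V + Matrix.vecMulVec k k)⁻¹ *ᵥ (S + g • k)) =
      (S ⬝ᵥ (V⁻¹ *ᵥ S) - (k ⬝ᵥ (V⁻¹ *ᵥ S)) ^ 2 / (1 + k ⬝ᵥ (V⁻¹ *ᵥ k))) +
      2 * (k ⬝ᵥ (V⁻¹ *ᵥ S) / (1 + k ⬝ᵥ (V⁻¹ *ᵥ k)) * g +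
        k ⬝ᵥ (V⁻¹ *ᵥ k) / (2 * (1 + k ⬝ᵥ (V⁻¹ *ᵥ k))) * g ^ 2) := by
  have hq : 0 ≤ k ⬝ᵥ (V⁻¹ *ᵥ k) := by
    simpa using hV.inv.posSemidef.dotProduct_mulVec_nonneg k
  have h1 : 1 + k ⬝ᵥ (V⁻¹ *ᵥ k) ≠ 0 := by positivity
  have hsymm : ∀ a b : Fin d → ℝ, a ⬝ᵥ (V⁻¹ *ᵥ b) = b ⬝ᵥ (V⁻¹ *ᵥ a) := by
    intro a b
    have : (V⁻¹)ᵀ = V⁻¹ := by simpa using hV.inv.isHermitian.eq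
    rw [Matrix.dotProduct_mulVec, ← Matrix.mulVec_transpose, this, dotProduct_comm]
  have hk : k ᵥ* V⁻¹ = V⁻¹ *ᵥ k := by
    have : (V⁻¹)ᵀ = V⁻¹ := by simpa using hV.inv.isHermitian.eq
    rw [← Matrix.mulVec_transpose, this]
  have hd : ∀ a : Fin d → ℝ, (V⁻¹ *ᵥ k) ⬝ᵥ a = k ⬝ᵥ (V⁻¹ *ᵥ a) := fun a => by
    rw [dotProduct_comm, hsymm]
  rw [sherman_morrison hV, hk]
  simp only [Matrix.sub_mulVec, Matrix.smul_mulVec, Matrix.vecMulVec_mulVec, Matrix.mulVec_add,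
    Matrix.mulVec_smul, dotProduct_sub, dotProduct_add, add_dotProduct, dotProduct_smul,
    smul_dotProduct, smul_eq_mul, hd, op_smul_eq_smul]
  rw [hsymm S k]
  field_simp
  ring

/-- Cauchy–Schwarz in the inner product of `V`, read off from the discriminant of `t ↦ (y - t x)ᵀ V
(y - t x)` with `y = V⁻¹ S`. -/
theorem sq_dotProduct_le_quadratic_inv {V : Matrix (Fin d) (Fin d) ℝ} (hV : V.PosDef)
    (S x : Fin d → ℝ) : (S ⬝ᵥ x) ^ 2 ≤ (S ⬝ᵥ (V⁻¹ *ᵥ S)) * (x ⬝ᵥ (V *ᵥ x)) := by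
  have hVV : V * V⁻¹ = 1 := Matrix.mul_nonsing_inv _ hV.det_pos.ne'.isUnit
  have hsymm : ∀ a b : Fin d → ℝ, a ⬝ᵥ (V *ᵥ b) = b ⬝ᵥ (V *ᵥ a) := by
    intro a b
    have : Vᵀ = V := by simpa using hV.isHermitian.eq
    rw [Matrix.dotProduct_mulVec, ← Matrix.mulVec_transpose, this, dotProduct_comm]
  set y := V⁻¹ *ᵥ S with hy
  have hVy : V *ᵥ y = S := by rw [hy, Matrix.mulVec_mulVec, hVV, Matrix.one_mulVec]
  have hp : ∀ t : ℝ, 0 ≤ (x ⬝ᵥ (V *ᵥ x)) * (t * t) + (-2 * (S ⬝ᵥ x)) * t + S ⬝ᵥ y := by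
    intro t
    have h := hV.posSemidef.dotProduct_mulVec_nonneg (y - t • x)
    simp only [star_trivial, Matrix.mulVec_sub, Matrix.mulVec_smul, dotProduct_sub, sub_dotProduct,
      smul_dotProduct, dotProduct_smul, smul_eq_mul, hVy] at h
    rw [hsymm y x, hVy, dotProduct_comm y S, dotProduct_comm x S] at h
    linarith
  have := discrim_le_zero hp
  rw [discrim] at this
  nlinarith

end LinearAlgebra

section SelfNormalized

variable {Ω : Type*} {d : ℕ}

/-- The regularized Gram matrix `ρ I + ∑_{i<n} k_i k_iᵀ`. -/
noncomputable def gram (ρ : ℝ) (k : ℕ → Ω → Fin d → ℝ) (n : ℕ) (ω : Ω) : Matrix (Fin d) (Fin d) ℝ :=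
  ρ • 1 + ∑ i ∈ Finset.range n, Matrix.vecMulVec (k i ω) (k i ω)

/-- The martingale transform `∑_{i<n} g_i k_i`. -/
noncomputable def mtrans (g : ℕ → Ω → ℝ) (k : ℕ → Ω → Fin d → ℝ) (n : ℕ) (ω : Ω) : Fin d → ℝ :=
  ∑ i ∈ Finset.range n, g i ω • k i ω

theorem posSemidef_vecMulVec (k : Fin d → ℝ) : (Matrix.vecMulVec k k).PosSemidef := by
  simpa using Matrix.posSemidef_vecMulVec_self_star k

theorem posDef_gram {ρ : ℝ} (hρ : 0 < ρ) (k : ℕ → Ω → Fin d → ℝ) (n : ℕ) (ω : Ω) :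
    (gram ρ k n ω).PosDef :=
  (Matrix.PosDef.one.smul hρ).add_posSemidef
    (Matrix.posSemidef_sum _ fun _ _ => posSemidef_vecMulVec _)

theorem gram_succ (ρ : ℝ) (k : ℕ → Ω → Fin d → ℝ) (n : ℕ) (ω : Ω) :
    gram ρ k (n + 1) ω = gram ρ k n ω + Matrix.vecMulVec (k n ω) (k n ω) := by
  rw [gram, gram, Finset.sum_range_succ, add_assoc]

theorem mtrans_succ (g : ℕ → Ω → ℝ) (k : ℕ → Ω → Fin d → ℝ) (n : ℕ) (ω : Ω) :
    mtrans g k (n + 1) ω = mtrans g k n ω + g n ω • k n ω := by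
  rw [mtrans, mtrans, Finset.sum_range_succ]

theorem measurable_matrix_det [MeasurableSpace Ω] {F : Ω → Matrix (Fin d) (Fin d) ℝ}
    (hF : ∀ i j, Measurable fun ω => F ω i j) : Measurable fun ω => (F ω).det := by
  simp only [Matrix.det_apply]
  fun_prop

theorem measurable_matrix_inv [MeasurableSpace Ω] {F : Ω → Matrix (Fin d) (Fin d) ℝ}
    (hF : ∀ i j, Measurable fun ω => F ω i j) (i j : Fin d) :
    Measurable fun ω => (F ω)⁻¹ i j := by
  simp only [Matrix.inv_def, Matrix.smul_apply, Ring.inverse_eq_inv', smul_eq_mul,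
    Matrix.adjugate_apply]
  refine (measurable_matrix_det hF).inv.mul (measurable_matrix_det fun a b => ?_)
  simp only [Matrix.updateRow_apply]
  split_ifs
  · exact measurable_const
  · exact hF a b

theorem measurable_bilin [MeasurableSpace Ω] {F : Ω → Matrix (Fin d) (Fin d) ℝ}
    {x y : Ω → Fin d → ℝ} (hF : ∀ i j, Measurable fun ω => F ω i j) (hx : Measurable x)
    (hy : Measurable y) : Measurable fun ω => x ω ⬝ᵥ (F ω *ᵥ y ω) := by
  simp only [dotProduct, Matrix.mulVec]
  have hx' : ∀ i, Measurable fun ω => x ω i := fun i => (measurable_pi_apply i).comp hx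
  have hy' : ∀ i, Measurable fun ω => y ω i := fun i => (measurable_pi_apply i).comp hy
  fun_prop

/-- `k` is predictable and `g` is a sequence of standard Gaussians independent of the past. -/
structure IsGaussianTransform [mΩ : MeasurableSpace Ω] (P : Measure Ω) (𝓖 : ℕ → MeasurableSpace Ω)
    (n : ℕ) (g : ℕ → Ω → ℝ) (k : ℕ → Ω → Fin d → ℝ) : Prop where
  le : ∀ i, 𝓖 i ≤ mΩ
  mono : Monotone 𝓖
  measurable : ∀ i < n, Measurable[𝓖 (i + 1)] (g i)
  indep : ∀ i < n, Indep (𝓖 i) (MeasurableSpace.comap (g i) inferInstance) P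
  law : ∀ i < n, P.map (g i) = gaussianReal 0 1
  predictable : ∀ i < n, Measurable[𝓖 i] (k i)

theorem measurable_gram {𝓖 : MeasurableSpace Ω} (ρ : ℝ) {k : ℕ → Ω → Fin d → ℝ} {n : ℕ}
    (hk : ∀ i < n, Measurable[𝓖] (k i)) (a b : Fin d) :
    Measurable[𝓖] fun ω => gram ρ k n ω a b := by
  simp only [gram, Matrix.add_apply, Matrix.sum_apply, Matrix.vecMulVec_apply]
  refine Measurable.add (@measurable_const _ _ _ 𝓖 _) (Finset.measurable_sum _ fun i hi => ?_)
  have := hk i (Finset.mem_range.1 hi)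
  exact ((measurable_pi_apply a).comp this).mul ((measurable_pi_apply b).comp this)

theorem measurable_mtrans {𝓖 : MeasurableSpace Ω} {g : ℕ → Ω → ℝ} {k : ℕ → Ω → Fin d → ℝ} {n : ℕ}
    (hg : ∀ i < n, Measurable[𝓖] (g i)) (hk : ∀ i < n, Measurable[𝓖] (k i)) :
    Measurable[𝓖] (mtrans g k n) := by
  have : mtrans g k n = fun ω => ∑ i ∈ Finset.range n, g i ω • k i ω := rfl
  rw [this]
  refine Finset.measurable_sum _ fun i hi => ?_
  exact (hg i (Finset.mem_range.1 hi)).smul (hk i (Finset.mem_range.1 hi))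

/-- One step of the mixture martingale: integrating out the new Gaussian produces a factor `√(1 +
q)` that cancels the growth of the determinant, and a term in `b²` that cancels the Sherman–Morrison
correction. Gaussianity makes the mean exactly constant. -/
theorem IsGaussianTransform.lintegral_exp_eq [mΩ : MeasurableSpace Ω] {P : Measure Ω}
    [IsProbabilityMeasure P] {𝓖 : ℕ → MeasurableSpace Ω}
    {n : ℕ} {g : ℕ → Ω → ℝ} {k : ℕ → Ω → Fin d → ℝ} (h : IsGaussianTransform P 𝓖 n g k)
    {ρ : ℝ} (hρ : 0 < ρ) : ∀ j ≤ n,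
    ∫⁻ ω, ENNReal.ofReal ((√(gram ρ k j ω).det)⁻¹ *
      Real.exp (mtrans g k j ω ⬝ᵥ ((gram ρ k j ω)⁻¹ *ᵥ mtrans g k j ω) / 2)) ∂P =
      ENNReal.ofReal (√(ρ ^ d))⁻¹ := by
  intro j
  induction j with
  | zero => intro _; simp [gram, mtrans]
  | succ j ih =>
    intro hj
    rw [← ih (by omega)]
    have hjn : j < n := by omega
    have hV := fun ω => posDef_gram hρ k j ω
    have hkm := h.predictable j hjn
    have hgm : ∀ a b, Measurable[𝓖 j] fun ω => gram ρ k j ω a b :=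
      measurable_gram ρ fun i hi => (h.predictable i (by omega)).mono (h.mono hi.le) le_rfl
    have hSm : Measurable[𝓖 j] (mtrans g k j) :=
      measurable_mtrans (fun i hi => (h.measurable i (by omega)).mono (h.mono hi) le_rfl)
        fun i hi => (h.predictable i (by omega)).mono (h.mono hi.le) le_rfl
    have him := @measurable_matrix_inv Ω d (𝓖 j) _ hgm
    set q : Ω → ℝ := fun ω => k j ω ⬝ᵥ ((gram ρ k j ω)⁻¹ *ᵥ k j ω) with hqdef
    set b : Ω → ℝ := fun ω => k j ω ⬝ᵥ ((gram ρ k j ω)⁻¹ *ᵥ mtrans g k j ω) with hbdef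
    set s : Ω → ℝ := fun ω => mtrans g k j ω ⬝ᵥ ((gram ρ k j ω)⁻¹ *ᵥ mtrans g k j ω) with hsdef
    have hqm : Measurable[𝓖 j] q := @measurable_bilin Ω d (𝓖 j) _ _ _ him hkm hkm
    have hbm : Measurable[𝓖 j] b := @measurable_bilin Ω d (𝓖 j) _ _ _ him hkm hSm
    have hsm : Measurable[𝓖 j] s := @measurable_bilin Ω d (𝓖 j) _ _ _ him hSm hSm
    have hdm : Measurable[𝓖 j] fun ω => (gram ρ k j ω).det := @measurable_matrix_det Ω d (𝓖 j) _ hgm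
    have hq : ∀ ω, 0 ≤ q ω := fun ω => by
      simpa using (hV ω).inv.posSemidef.dotProduct_mulVec_nonneg (k j ω)
    have key := lintegral_exp_quadratic_of_indep (P := P) (h.le j)
      ((h.measurable j hjn).mono (h.le _) le_rfl) (h.indep j hjn) (h.law j hjn)
      (A := fun ω => (√((gram ρ k j ω).det * (1 + q ω)))⁻¹ *
        Real.exp ((s ω - b ω ^ 2 / (1 + q ω)) / 2))
      (B := fun ω => b ω / (1 + q ω)) (C := fun ω => q ω / (2 * (1 + q ω)))
      (by fun_prop) (by fun_prop) (by fun_prop) (fun ω => by positivity) (fun ω => by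
        have := hq ω
        rw [div_lt_div_iff₀ (by positivity) (by norm_num)]; linarith)
    refine Eq.trans (lintegral_congr fun ω => ?_) (key.trans (lintegral_congr fun ω => ?_))
    · rw [gram_succ, mtrans_succ, quadratic_inv_add_vecMulVec (hV ω), det_add_vecMulVec (hV ω),
        mul_assoc, ← Real.exp_add]
      congr 3
      ring
    · have h1 : 0 < 1 + q ω := by linarith [hq ω]
      have e : 1 - 2 * (q ω / (2 * (1 + q ω))) = (1 + q ω)⁻¹ := by field_simp; ring
      simp only [e]
      rw [Real.sqrt_mul (hV ω).det_pos.le, Real.sqrt_inv, inv_inv, mul_inv,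
        mul_mul_mul_comm, ← Real.exp_add, mul_assoc (√(gram ρ k j ω).det)⁻¹,
        inv_mul_cancel₀ (Real.sqrt_pos.2 h1).ne', mul_one]
      congr 3
      field_simp
      ring

/-- The self-normalized deviation bound for Gaussian martingale transforms. -/
theorem IsGaussianTransform.self_normalized [mΩ : MeasurableSpace Ω] {P : Measure Ω}
    [IsProbabilityMeasure P] {𝓖 : ℕ → MeasurableSpace Ω}
    {n : ℕ} {g : ℕ → Ω → ℝ} {k : ℕ → Ω → Fin d → ℝ} (h : IsGaussianTransform P 𝓖 n g k)
    {ρ δ : ℝ} (hρ : 0 < ρ) (hδ : 0 < δ) :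
    P {ω | ¬ ∀ x : Fin d → ℝ, (mtrans g k n ω ⬝ᵥ x) ^ 2 ≤
      (2 * Real.log (1 / δ) + Real.log ((gram ρ k n ω).det / ρ ^ d)) *
        (x ⬝ᵥ (gram ρ k n ω *ᵥ x))} ≤ ENNReal.ofReal δ := by
  have hgm : ∀ a b, Measurable fun ω => gram ρ k n ω a b :=
    measurable_gram ρ fun i hi => (h.predictable i hi).mono (h.le _) le_rfl
  have hSm : Measurable (mtrans g k n) :=
    measurable_mtrans (fun i hi => (h.measurable i hi).mono (h.le _) le_rfl)
      fun i hi => (h.predictable i hi).mono (h.le _) le_rfl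
  set s : Ω → ℝ := fun ω => mtrans g k n ω ⬝ᵥ ((gram ρ k n ω)⁻¹ *ᵥ mtrans g k n ω) with hsdef
  have hsm : Measurable s := measurable_bilin (measurable_matrix_inv hgm) hSm hSm
  have hdm := measurable_matrix_det hgm
  have hV := fun ω => posDef_gram hρ k n ω
  set M : Ω → ENNReal := fun ω => ENNReal.ofReal ((√(gram ρ k n ω).det)⁻¹ * Real.exp (s ω / 2))
  have hM : ∫⁻ ω, M ω ∂P = ENNReal.ofReal (√(ρ ^ d))⁻¹ := h.lintegral_exp_eq hρ n le_rfl
  have hMm : Measurable M := by fun_prop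
  have hρd : 0 < √(ρ ^ d) := by positivity
  have hc0 : ENNReal.ofReal ((√(ρ ^ d))⁻¹ / δ) ≠ 0 := by
    rw [Ne, ENNReal.ofReal_eq_zero, not_le]; positivity
  -- Markov's inequality for `M`; the threshold is its mean divided by `δ`.
  have h1 := meas_ge_le_lintegral_div (μ := P) hMm.aemeasurable hc0 ENNReal.ofReal_ne_top
  rw [hM, ← ENNReal.ofReal_div_of_pos (by positivity)] at h1
  have e : (√(ρ ^ d))⁻¹ / ((√(ρ ^ d))⁻¹ / δ) = δ := by field_simp
  rw [e] at h1
  refine le_trans (measure_mono fun ω hω => ?_) h1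
  simp only [Set.mem_ofPred_eq] at hω ⊢
  contrapose! hω
  intro x
  refine (sq_dotProduct_le_quadratic_inv (hV ω) _ x).trans ?_
  have hx : 0 ≤ x ⬝ᵥ (gram ρ k n ω *ᵥ x) := by
    simpa using (hV ω).posSemidef.dotProduct_mulVec_nonneg x
  refine mul_le_mul_of_nonneg_right ?_ hx
  have hdet := (hV ω).det_pos
  have h2 := (ENNReal.ofReal_lt_ofReal_iff (by positivity)).1 hω
  have h3 : Real.exp (s ω / 2) < √(gram ρ k n ω).det / √(ρ ^ d) / δ := by
    have hp := Real.sqrt_pos.2 hdet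
    calc Real.exp (s ω / 2) = √(gram ρ k n ω).det *
          ((√(gram ρ k n ω).det)⁻¹ * Real.exp (s ω / 2)) := by field_simp
      _ < √(gram ρ k n ω).det * ((√(ρ ^ d))⁻¹ / δ) := by gcongr
      _ = _ := by field_simp
  rw [← Real.sqrt_div hdet.le, ← Real.lt_log_iff_exp_lt (by positivity),
    Real.log_div (by positivity) hδ.ne', Real.log_sqrt (by positivity)] at h3
  rw [one_div, Real.log_inv]
  linarith

end SelfNormalized

/-! ### Sums and squares of independent Gaussians -/

section IndependentGaussians

variable {Ω : Type*} [mΩ : MeasurableSpace Ω] {P : Measure Ω} [IsProbabilityMeasure P]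

theorem map_sum_gaussian {ι : Type*} {g : ι → Ω → ℝ} {v : ι → NNReal} (hi : iIndepFun g P)
    (hm : ∀ s, Measurable (g s)) (W : Finset ι) (hl : ∀ s ∈ W, P.map (g s) = gaussianReal 0 (v s)) :
    P.map (∑ s ∈ W, g s) = gaussianReal 0 (∑ s ∈ W, v s) := by
  classical
  induction W using Finset.induction_on with
  | empty =>
    simp only [Finset.sum_empty, gaussianReal_zero_var]
    have : (0 : Ω → ℝ) = fun _ => 0 := rfl
    rw [this, Measure.map_const, measure_univ, one_smul]
  | insert a W ha ih =>
    rw [Finset.sum_insert ha, Finset.sum_insert ha]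
    have := gaussianReal_add_gaussianReal_of_indepFun (hi.indepFun_finsetSum_of_notMem hm ha).symm
      (hl a (Finset.mem_insert_self _ _)) (ih fun s hs => hl s (Finset.mem_insert_of_mem hs))
    simpa using this

theorem map_dotProduct_stdNormal {p : ℕ} (z : Fin p → ℝ) :
    (stdNormal p).map (fun x => ∑ q, z q * x q) = gaussianReal 0 (∑ q, ‖z q‖₊ ^ 2) := by
  have hi : iIndepFun (fun (q : Fin p) (x : Fin p → ℝ) => z q * x q) (stdNormal p) :=
    iIndepFun_pi (μ := fun _ : Fin p => gaussianReal 0 1) (X := fun q y => z q * y)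
      fun q => by fun_prop
  have hp : IsProbabilityMeasure (stdNormal p) := by unfold stdNormal; infer_instance
  have h := map_sum_gaussian (v := fun q => ‖z q‖₊ ^ 2) hi (fun q => by fun_prop) Finset.univ ?_
  · rw [← h]
    congr 1
    ext x
    simp
  · intro q _
    have h1 : (fun x : Fin p → ℝ => z q * x q) = (fun y => z q * y) ∘ (Function.eval q) := rfl
    rw [h1, ← Measure.map_map (by fun_prop) (by fun_prop), stdNormal,
      (measurePreserving_eval (fun _ : Fin p => gaussianReal 0 1) q).map_eq,
      gaussianReal_map_const_mul]
    congr 1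
    · simp
    · ext
      simp

/-- With `t = l v` the integral is `e⁻ᵗ (1 - 2t)^{-1/2}`, and `log x ≥ 1 - 1/x` gives `log (1 - 2t)
≥ -2t - 8t²` for `t ≤ 1/4`. -/
theorem lintegral_exp_sq_gaussian_le {v : NNReal} {l : ℝ} (h : |l| * v ≤ 1 / 4) :
    ∫⁻ y, ENNReal.ofReal (Real.exp (l * (y ^ 2 - v))) ∂(gaussianReal 0 v) ≤
      ENNReal.ofReal (Real.exp (4 * l ^ 2 * v ^ 2)) := by
  have hlv : |l * v| ≤ 1 / 4 := by rwa [abs_mul, NNReal.abs_eq]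
  obtain ⟨h1, h2⟩ := abs_le.1 hlv
  have e : gaussianReal 0 v = (gaussianReal 0 1).map (√(v : ℝ) * ·) := by
    rw [gaussianReal_map_const_mul]
    congr 1
    · simp
    · ext
      simp
  rw [e, lintegral_map (by fun_prop) (by fun_prop)]
  have e2 : ∀ z : ℝ, ENNReal.ofReal (Real.exp (l * ((√(v : ℝ) * z) ^ 2 - v))) =
      ENNReal.ofReal (Real.exp (-(l * v))) *
        ENNReal.ofReal (Real.exp (0 * z + (l * v) * z ^ 2)) := by
    intro z
    rw [← ENNReal.ofReal_mul (by positivity), ← Real.exp_add, mul_pow, Real.sq_sqrt v.coe_nonneg]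
    congr 2
    ring
  simp_rw [e2]
  rw [lintegral_const_mul _ (by fun_prop),
    lintegral_exp_quadratic_gaussian _ (show l * v < 1 / 2 by linarith),
    ← ENNReal.ofReal_mul (by positivity)]
  apply ENNReal.ofReal_le_ofReal
  have hpos : 0 < 1 - 2 * (l * v) := by linarith
  set t := l * v with ht
  have e3 : (√(1 - 2 * t))⁻¹ = Real.exp (-(Real.log (1 - 2 * t) / 2)) := by
    rw [Real.exp_neg, ← Real.log_sqrt hpos.le, Real.exp_log (Real.sqrt_pos.2 hpos)]
  have e4 : Real.exp (4 * l ^ 2 * (v : ℝ) ^ 2) = Real.exp (4 * t ^ 2) := by rw [ht]; ring_nf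
  rw [e3, e4, ← Real.exp_add, ← Real.exp_add, Real.exp_le_exp]
  have hlog : -(2 * t) - 8 * t ^ 2 ≤ Real.log (1 - 2 * t) := by
    refine le_trans ?_ (Real.one_sub_inv_le_log_of_pos hpos)
    rw [le_sub_comm, inv_eq_one_div, div_le_iff₀ hpos]
    nlinarith [mul_nonneg (sq_nonneg t) (by linarith : (0 : ℝ) ≤ 1 / 4 - t)]
  simp
  linarith

/-- Sums of independent variables over disjoint blocks are independent. -/
theorem lintegral_prod_blocks {ι κ : Type*} {g : ι → Ω → ℝ} (hi : iIndepFun g P)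
    (hm : ∀ s, Measurable (g s)) (W : κ → Finset ι) (f : κ → ℝ → ENNReal)
    (hf : ∀ c, Measurable (f c)) (F : Finset κ)
    (hd : ∀ c ∈ F, ∀ c' ∈ F, c ≠ c' → Disjoint (W c) (W c')) :
    ∫⁻ ω, ∏ c ∈ F, f c (∑ s ∈ W c, g s ω) ∂P =
      ∏ c ∈ F, ∫⁻ ω, f c (∑ s ∈ W c, g s ω) ∂P := by
  classical
  induction F using Finset.induction_on with
  | empty => simp
  | insert a F ha ih =>
    simp only [Finset.prod_insert ha]
    have hdisj : Disjoint (W a) (F.biUnion W) := by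
      rw [Finset.disjoint_biUnion_right]
      intro c hc
      exact hd a (Finset.mem_insert_self _ _) c (Finset.mem_insert_of_mem hc)
        fun h => ha (h ▸ hc)
    have hind := (hi.indepFun_finset (W a) (F.biUnion W) hdisj hm).comp
      (φ := fun y => f a (∑ s, y s))
      (ψ := fun y => ∏ c ∈ F.attach, f c (∑ s : W c.1, y ⟨s.1, Finset.mem_biUnion.2 ⟨c.1, c.2, s.2⟩⟩))
      ((hf a).comp (by fun_prop))
      (Finset.measurable_prod _ fun c _ => (hf c).comp (by fun_prop))
    have e1 : ((fun y : W a → ℝ => f a (∑ s, y s)) ∘ fun ω (i : W a) => g i ω) =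
        fun ω => f a (∑ s ∈ W a, g s ω) := by
      ext ω
      simp only [Function.comp]
      rw [Finset.sum_coe_sort (W a) fun s => g s ω]
    have e2 : ((fun y : F.biUnion W → ℝ => ∏ c ∈ F.attach,
        f c (∑ s : W c.1, y ⟨s.1, Finset.mem_biUnion.2 ⟨c.1, c.2, s.2⟩⟩)) ∘
          fun ω (i : F.biUnion W) => g i ω) = fun ω => ∏ c ∈ F, f c (∑ s ∈ W c, g s ω) := by
      ext ω
      simp only [Function.comp]
      rw [← Finset.prod_attach F]
      refine Finset.prod_congr rfl fun c _ => ?_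
      rw [Finset.sum_coe_sort (W c) fun s => g s ω]
    rw [e1, e2] at hind
    have := lintegral_mul_eq_lintegral_mul_lintegral_of_indepFun
      ((hf a).comp (Finset.measurable_sum _ fun s _ => hm s))
      (Finset.measurable_prod _ fun c _ => (hf c).comp (Finset.measurable_sum _ fun s _ => hm s))
      hind
    simp only [Pi.mul_apply, Function.comp_apply] at this
    rw [this, ih fun c hc c' hc' => hd c (Finset.mem_insert_of_mem hc) c'
      (Finset.mem_insert_of_mem hc')]

/-- Chernoff bound for the sum of centred squares of Gaussian sums over disjoint blocks. -/
theorem measure_sum_sq_blocks_ge {ι κ : Type*} {g : ι → Ω → ℝ} {v : ι → NNReal}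
    (hi : iIndepFun g P) (hm : ∀ s, Measurable (g s)) (W : κ → Finset ι) (F : Finset κ)
    (hl : ∀ c ∈ F, ∀ s ∈ W c, P.map (g s) = gaussianReal 0 (v s))
    (hd : ∀ c ∈ F, ∀ c' ∈ F, c ≠ c' → Disjoint (W c) (W c')) {l a : ℝ}
    (hlv : ∀ c ∈ F, |l| * (∑ s ∈ W c, v s : NNReal) ≤ 1 / 4) :
    P {ω | a ≤ l * ∑ c ∈ F, ((∑ s ∈ W c, g s ω) ^ 2 - (∑ s ∈ W c, v s : NNReal))} ≤
      ENNReal.ofReal (Real.exp (4 * l ^ 2 * ∑ c ∈ F, ((∑ s ∈ W c, v s : NNReal) : ℝ) ^ 2 - a)) := by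
  set f : κ → ℝ → ENNReal := fun c y =>
    ENNReal.ofReal (Real.exp (l * (y ^ 2 - (∑ s ∈ W c, v s : NNReal)))) with hf
  have hfm : ∀ c, Measurable (f c) := fun c => by fun_prop
  have h1 : ∫⁻ ω, ∏ c ∈ F, f c (∑ s ∈ W c, g s ω) ∂P ≤
      ENNReal.ofReal (Real.exp (4 * l ^ 2 * ∑ c ∈ F, ((∑ s ∈ W c, v s : NNReal) : ℝ) ^ 2)) := by
    rw [lintegral_prod_blocks hi hm W f hfm F hd, Finset.mul_sum, Real.exp_sum,
      ENNReal.ofReal_prod_of_nonneg fun _ _ => (Real.exp_pos _).le]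
    refine Finset.prod_le_prod' fun c hc => ?_
    have hmap := map_sum_gaussian hi hm (W c) (hl c hc)
    have : ∫⁻ ω, f c (∑ s ∈ W c, g s ω) ∂P = ∫⁻ y, f c y ∂(P.map (∑ s ∈ W c, g s)) := by
      have hfun : ∑ s ∈ W c, g s = fun ω => ∑ s ∈ W c, g s ω := by ext; simp
      rw [hfun, lintegral_map (hfm c) (Finset.measurable_sum _ fun s _ => hm s)]
    rw [this, hmap]
    exact lintegral_exp_sq_gaussian_le (hlv c hc)
  have hprod : ∀ ω, ∏ c ∈ F, f c (∑ s ∈ W c, g s ω) = ENNReal.ofReal (Real.exp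
      (l * ∑ c ∈ F, ((∑ s ∈ W c, g s ω) ^ 2 - (∑ s ∈ W c, v s : NNReal)))) := by
    intro ω
    rw [Finset.mul_sum, Real.exp_sum, ENNReal.ofReal_prod_of_nonneg fun _ _ => (Real.exp_pos _).le]
  have hmeas : Measurable fun ω => ∏ c ∈ F, f c (∑ s ∈ W c, g s ω) :=
    Finset.measurable_prod _ fun c _ => (hfm c).comp (Finset.measurable_sum _ fun s _ => hm s)
  have h2 := meas_ge_le_lintegral_div (μ := P) hmeas.aemeasurable
    (ε := ENNReal.ofReal (Real.exp a)) (by simp [Real.exp_pos]) ENNReal.ofReal_ne_top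
  rw [Real.exp_sub, ENNReal.ofReal_div_of_pos (Real.exp_pos _)]
  refine le_trans (measure_mono fun ω hω => ?_) (h2.trans (by gcongr))
  simp only [Set.mem_ofPred_eq] at hω ⊢
  rw [hprod]
  exact ENNReal.ofReal_le_ofReal (Real.exp_le_exp.2 hω)

end IndependentGaussians

/-! ### Energy of sliding window sums -/

section Windows

/-- The elements `s` of `J` whose window `[s, s + n)` contains `t`. -/
def window (J : Finset ℕ) (n t : ℕ) : Finset ℕ := J.filter fun s => s ≤ t ∧ t < s + n

theorem mem_window {J : Finset ℕ} {n t s : ℕ} : s ∈ window J n t ↔ s ∈ J ∧ s ≤ t ∧ t < s + n := by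
  simp [window]

theorem card_window_le (J : Finset ℕ) (n t : ℕ) : (window J n t).card ≤ n := by
  have : window J n t ⊆ Finset.Ico (t + 1 - n) (t + 1) := by
    intro s hs
    rw [mem_window] at hs
    rw [Finset.mem_Ico]
    omega
  have := Finset.card_le_card this
  rw [Nat.card_Ico] at this
  omega

/-- A common element would put `t` and `t'` less than `n` apart, which for equal residues mod `n`
forces `t = t'`. Splitting times by residue therefore produces independent window sums. -/
theorem disjoint_window (J : Finset ℕ) {n t t' : ℕ} (h : t % n = t' % n) (hne : t ≠ t') :
    Disjoint (window J n t) (window J n t') := by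
  rw [Finset.disjoint_left]
  intro s hs hs'
  rw [mem_window] at hs hs'
  apply hne
  rcases le_total t t' with hle | hle
  · have h1 := Nat.sub_mod_eq_zero_of_mod_eq h.symm
    have h2 := Nat.eq_zero_of_dvd_of_lt (Nat.dvd_of_mod_eq_zero h1) (by omega)
    omega
  · have h1 := Nat.sub_mod_eq_zero_of_mod_eq h
    have h2 := Nat.eq_zero_of_dvd_of_lt (Nat.dvd_of_mod_eq_zero h1) (by omega)
    omega

theorem sum_window {R : Type*} [Semiring R] (J : Finset ℕ) {n B : ℕ} (hB : ∀ s ∈ J, s + n ≤ B)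
    (f : ℕ → R) : ∑ t ∈ Finset.range B, ∑ s ∈ window J n t, f s = n * ∑ s ∈ J, f s := by
  simp only [window, Finset.sum_filter]
  rw [Finset.sum_comm, Finset.mul_sum]
  refine Finset.sum_congr rfl fun s hs => ?_
  rw [← Finset.sum_filter, Finset.sum_const, nsmul_eq_mul]
  congr 2
  have : Finset.filter (fun t => s ≤ t ∧ t < s + n) (Finset.range B) = Finset.Ico s (s + n) := by
    ext t
    have := hB s hs
    simp only [Finset.mem_filter, Finset.mem_range, Finset.mem_Ico]
    omega
  rw [this, Nat.card_Ico]
  omega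

variable {Ω : Type*} [mΩ : MeasurableSpace Ω] {P : Measure Ω} [IsProbabilityMeasure P]

/-- Within one residue class the windows are disjoint subsets of `J`, so the variances are at most
`n` each and at most `M` in total. With `|l| = ε / (8n)` the exponent `4 l² n M` is half of the
threshold, leaving the other half as decay. Both signs of `l` are allowed, for the two tails. -/
theorem measure_residue_energy_ge {g : ℕ → Ω → ℝ} {v : ℕ → NNReal} (hi : iIndepFun g P)
    (hm : ∀ s, Measurable (g s)) {J : Finset ℕ} (hl : ∀ s ∈ J, P.map (g s) = gaussianReal 0 (v s))
    (hv : ∀ s ∈ J, v s ≤ 1) {n B : ℕ} (hn : 1 ≤ n) {M ε l : ℝ} (hM : (J.card : ℝ) ≤ M)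
    (hε : ε ≤ 1) (hl' : |l| = ε / (8 * n)) (r : ℕ) :
    P {ω | ε ^ 2 * M / (8 * n) ≤ l * ∑ t ∈ Finset.range B with t % n = r,
      ((∑ s ∈ window J n t, g s ω) ^ 2 - (∑ s ∈ window J n t, v s : NNReal))} ≤
      ENNReal.ofReal (Real.exp (-(ε ^ 2 * M / (16 * n)))) := by
  have hn' : (0 : ℝ) < n := by exact_mod_cast hn
  have hσ : ∀ t, ((∑ s ∈ window J n t, v s : NNReal) : ℝ) ≤ n := by
    intro t
    have : ∑ s ∈ window J n t, v s ≤ (window J n t).card • (1 : NNReal) :=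
      Finset.sum_le_card_nsmul _ _ _ fun s hs => hv s (mem_window.1 hs).1
    have h2 : ((window J n t).card • (1 : NNReal)) ≤ (n : NNReal) := by
      simpa using card_window_le J n t
    exact_mod_cast this.trans h2
  have hd : ∀ c ∈ (Finset.range B).filter (fun t => t % n = r),
      ∀ c' ∈ (Finset.range B).filter (fun t => t % n = r), c ≠ c' →
        Disjoint (window J n c) (window J n c') := by
    intro c hc c' hc' hne
    exact disjoint_window J ((Finset.mem_filter.1 hc).2.trans (Finset.mem_filter.1 hc').2.symm) hne
  refine (measure_sum_sq_blocks_ge hi hm (window J n) _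
    (fun c _ s hs => hl s (mem_window.1 hs).1) hd ?_).trans ?_
  · intro c _
    rw [hl', div_mul_eq_mul_div, div_le_div_iff₀ (by positivity) (by norm_num)]
    nlinarith [hσ c, mul_le_mul hε (hσ c) (NNReal.coe_nonneg _) zero_le_one]
  · apply ENNReal.ofReal_le_ofReal
    rw [Real.exp_le_exp]
    have h1 : ∑ t ∈ Finset.range B with t % n = r, ((∑ s ∈ window J n t, v s : NNReal) : ℝ) ≤ M := by
      rw [← NNReal.coe_sum, ← Finset.sum_biUnion hd]
      refine le_trans ?_ hM
      have h2 : (((Finset.range B).filter (fun t => t % n = r)).biUnion (window J n)) ⊆ J := by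
        intro s hs
        obtain ⟨t, _, ht⟩ := Finset.mem_biUnion.1 hs
        exact (mem_window.1 ht).1
      have h3 : ∑ s ∈ ((Finset.range B).filter (fun t => t % n = r)).biUnion (window J n), v s ≤
          J.card • (1 : NNReal) :=
        (Finset.sum_le_sum_of_subset h2).trans (Finset.sum_le_card_nsmul _ _ _ hv)
      have h4 : J.card • (1 : NNReal) = (J.card : NNReal) := by simp
      rw [h4] at h3
      exact_mod_cast h3
    have h2 : ∑ t ∈ Finset.range B with t % n = r, ((∑ s ∈ window J n t, v s : NNReal) : ℝ) ^ 2 ≤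
        n * M := by
      refine le_trans ?_ (mul_le_mul_of_nonneg_left h1 hn'.le)
      rw [Finset.mul_sum]
      refine Finset.sum_le_sum fun t _ => ?_
      rw [sq]
      exact mul_le_mul_of_nonneg_right (hσ t) (NNReal.coe_nonneg _)
    have h3 : l ^ 2 = (ε / (8 * n)) ^ 2 := by rw [← sq_abs, hl']
    rw [h3]
    calc 4 * (ε / (8 * n)) ^ 2 * _ - ε ^ 2 * M / (8 * n)
        ≤ 4 * (ε / (8 * n)) ^ 2 * (n * M) - ε ^ 2 * M / (8 * n) := by gcongr
      _ = -(ε ^ 2 * M / (16 * n)) := by field_simp; ring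

theorem measure_window_energy {g : ℕ → Ω → ℝ} {v : ℕ → NNReal} (hi : iIndepFun g P)
    (hm : ∀ s, Measurable (g s)) {J : Finset ℕ} (hl : ∀ s ∈ J, P.map (g s) = gaussianReal 0 (v s))
    (hv : ∀ s ∈ J, v s ≤ 1) {n B : ℕ} (hn : 1 ≤ n) (hB : ∀ s ∈ J, s + n ≤ B) {M ε : ℝ}
    (hM : (J.card : ℝ) ≤ M) (hε0 : 0 < ε) (hε : ε ≤ 1) :
    P {ω | ¬ |∑ t ∈ Finset.range B, (∑ s ∈ window J n t, g s ω) ^ 2 - n * ∑ s ∈ J, (v s : ℝ)| ≤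
      ε * n * M} ≤ ENNReal.ofReal (2 * n * Real.exp (-(ε ^ 2 * M / (16 * n)))) := by
  have hn' : (0 : ℝ) < n := by exact_mod_cast hn
  set Z : ℕ → Ω → ℝ := fun r ω => ∑ t ∈ Finset.range B with t % n = r,
      ((∑ s ∈ window J n t, g s ω) ^ 2 - (∑ s ∈ window J n t, v s : NNReal)) with hZ
  set A : ℝ → ℕ → Set Ω := fun l r => {ω | ε ^ 2 * M / (8 * n) ≤ l * Z r ω} with hA
  have hpos : 0 ≤ ε / (8 * n) := by positivity
  have h1 : ∀ r, P (A (ε / (8 * n)) r) ≤ ENNReal.ofReal (Real.exp (-(ε ^ 2 * M / (16 * n)))) :=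
    measure_residue_energy_ge hi hm hl hv hn hM hε (abs_of_nonneg hpos)
  have h2 : ∀ r, P (A (-(ε / (8 * n))) r) ≤ ENNReal.ofReal (Real.exp (-(ε ^ 2 * M / (16 * n)))) :=
    measure_residue_energy_ge hi hm hl hv hn hM hε (by rw [abs_neg, abs_of_nonneg hpos])
  have hsub : {ω | ¬ |∑ t ∈ Finset.range B, (∑ s ∈ window J n t, g s ω) ^ 2 -
      n * ∑ s ∈ J, (v s : ℝ)| ≤ ε * n * M} ⊆
      ⋃ r ∈ Finset.range n, (A (ε / (8 * n)) r ∪ A (-(ε / (8 * n))) r) := by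
    intro ω hω
    by_contra hcon
    simp only [Set.mem_iUnion, not_exists, Set.mem_union, not_or] at hcon
    apply hω
    have e : ∑ t ∈ Finset.range B, (∑ s ∈ window J n t, g s ω) ^ 2 - n * ∑ s ∈ J, (v s : ℝ) =
        ∑ r ∈ Finset.range n, Z r ω := by
      rw [Finset.sum_fiberwise_of_maps_to fun t _ => Finset.mem_range.2 (Nat.mod_lt t hn),
        Finset.sum_sub_distrib]
      congr 1
      rw [← sum_window J hB fun s => (v s : ℝ)]
      simp
    rw [e]
    refine (Finset.abs_sum_le_sum_abs _ _).trans ?_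
    -- Each of the `n` residue classes may deviate by `ε M`, for a total of `ε n M`.
    have h3 : ∀ r ∈ Finset.range n, |Z r ω| ≤ ε * M := by
      intro r hr
      obtain ⟨h4, h5⟩ := hcon r hr
      simp only [hA, Set.mem_ofPred_eq, not_le] at h4 h5
      have hc : 0 < ε / (8 * n) := by positivity
      have e1 : ε ^ 2 * M / (8 * n) = ε / (8 * n) * (ε * M) := by ring
      rw [e1] at h4 h5
      rw [abs_le]
      constructor
      · by_contra h6
        nlinarith
      · exact (lt_of_mul_lt_mul_left h4 hc.le).le
    refine (Finset.sum_le_card_nsmul _ _ _ h3).trans (le_of_eq ?_)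
    simp
    ring
  refine (measure_mono hsub).trans ((measure_biUnion_finset_le _ _).trans ?_)
  refine (Finset.sum_le_card_nsmul _ _ _ fun r _ =>
    (measure_union_le _ _).trans (add_le_add (h1 r) (h2 r))).trans (le_of_eq ?_)
  rw [Finset.card_range, nsmul_eq_mul, ← ENNReal.ofReal_add (by positivity) (by positivity),
    ← ENNReal.ofReal_natCast, ← ENNReal.ofReal_mul (by positivity)]
  congr 1
  ring

/-- Concentration of the windowed energy of a modulated complex combination of the inputs. -/
theorem measure_modulated_energy {p : ℕ} {x : ℕ → Ω → Fin p → ℝ} (hi : iIndepFun x P)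
    (hm : ∀ s, Measurable (x s)) {J : Finset ℕ} (hl : ∀ s ∈ J, P.map (x s) = stdNormal p)
    {n B : ℕ} (hn : 1 ≤ n) (hB : ∀ s ∈ J, s + n ≤ B) {M ε : ℝ}
    (hM : (J.card : ℝ) ≤ M) (hε0 : 0 < ε) (hε : ε ≤ 1) (θ : ℕ → ℂ) (hθ : ∀ s, ‖θ s‖ = 1)
    (a : EuclideanSpace ℂ (Fin p)) (ha : ‖a‖ = 1) :
    P {ω | ¬ |∑ t ∈ Finset.range B, ‖∑ s ∈ window J n t, θ s * ∑ q, a q * x s ω q‖ ^ 2 -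
      n * J.card| ≤ 2 * ε * n * M} ≤
      ENNReal.ofReal (4 * n * Real.exp (-(ε ^ 2 * M / (16 * n)))) := by
  set b : ℕ → Fin p → ℝ := fun s q => (θ s * a q).re with hb
  set c : ℕ → Fin p → ℝ := fun s q => (θ s * a q).im with hc
  have hbc : ∀ s, ∑ q, b s q ^ 2 + ∑ q, c s q ^ 2 = 1 := by
    intro s
    rw [← Finset.sum_add_distrib]
    have : ∀ q, b s q ^ 2 + c s q ^ 2 = ‖a q‖ ^ 2 := fun q => by
      have h := Complex.sq_norm (θ s * a q)
      rw [norm_mul, hθ, one_mul, Complex.normSq_apply] at h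
      rw [h, hb, hc]
      ring
    simp_rw [this]
    rw [← EuclideanSpace.norm_sq_eq, ha, one_pow]
  have key : ∀ w : ℕ → Fin p → ℝ, (∀ s, ∑ q, w s q ^ 2 ≤ 1) →
      P {ω | ¬ |∑ t ∈ Finset.range B, (∑ s ∈ window J n t, ∑ q, w s q * x s ω q) ^ 2 -
        n * ∑ s ∈ J, ∑ q, w s q ^ 2| ≤ ε * n * M} ≤
        ENNReal.ofReal (2 * n * Real.exp (-(ε ^ 2 * M / (16 * n)))) := by
    intro w hw
    have h := measure_window_energy (P := P) (g := fun s ω => ∑ q, w s q * x s ω q)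
      (v := fun s => ∑ q, ‖w s q‖₊ ^ 2) (J := J)
      (hi.comp (fun s y => ∑ q, w s q * y q) fun s => by fun_prop)
      (fun s => by have := hm s; fun_prop) ?_ ?_ hn hB hM hε0 hε
    · simpa using h
    · intro s hs
      have e : (fun ω => ∑ q, w s q * x s ω q) = (fun y => ∑ q, w s q * y q) ∘ x s := rfl
      rw [e, ← Measure.map_map (by fun_prop) (hm s), hl s hs, map_dotProduct_stdNormal]
    · intro s _
      have := hw s
      rw [← NNReal.coe_le_coe]
      simpa using this
  have h1 := key b fun s => by
    have := hbc s
    have : 0 ≤ ∑ q, c s q ^ 2 := Finset.sum_nonneg fun _ _ => sq_nonneg _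
    linarith
  have h2 := key c fun s => by
    have := hbc s
    have : 0 ≤ ∑ q, b s q ^ 2 := Finset.sum_nonneg fun _ _ => sq_nonneg _
    linarith
  have e4 : ENNReal.ofReal (4 * n * Real.exp (-(ε ^ 2 * M / (16 * n)))) =
      ENNReal.ofReal (2 * n * Real.exp (-(ε ^ 2 * M / (16 * n)))) +
      ENNReal.ofReal (2 * n * Real.exp (-(ε ^ 2 * M / (16 * n)))) := by
    rw [← ENNReal.ofReal_add (by positivity) (by positivity)]
    congr 1
    ring
  rw [e4]
  refine le_trans (measure_mono ?_) ((measure_union_le _ _).trans (add_le_add h1 h2))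
  intro ω hω
  by_contra hcon
  simp only [Set.mem_union, Set.mem_ofPred_eq, not_or, not_not] at hcon
  apply hω
  obtain ⟨h3, h4⟩ := hcon
  have e1 : ∀ t, ‖∑ s ∈ window J n t, θ s * ∑ q, a q * x s ω q‖ ^ 2 =
      (∑ s ∈ window J n t, ∑ q, b s q * x s ω q) ^ 2 +
      (∑ s ∈ window J n t, ∑ q, c s q * x s ω q) ^ 2 := by
    intro t
    rw [Complex.sq_norm, Complex.normSq_apply, Complex.re_sum, Complex.im_sum, ← sq, ← sq]
    have hre : ∀ s, (θ s * ∑ q, a q * x s ω q).re = ∑ q, b s q * x s ω q := fun s => by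
      rw [Finset.mul_sum, Complex.re_sum]
      refine Finset.sum_congr rfl fun q _ => ?_
      rw [← mul_assoc, Complex.re_mul_ofReal]
    have him : ∀ s, (θ s * ∑ q, a q * x s ω q).im = ∑ q, c s q * x s ω q := fun s => by
      rw [Finset.mul_sum, Complex.im_sum]
      refine Finset.sum_congr rfl fun q _ => ?_
      rw [← mul_assoc, Complex.im_mul_ofReal]
    simp_rw [hre, him]
  have e2 : (J.card : ℝ) = ∑ s ∈ J, ∑ q, b s q ^ 2 + ∑ s ∈ J, ∑ q, c s q ^ 2 := by
    rw [← Finset.sum_add_distrib]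
    simp_rw [hbc]
    simp
  simp_rw [e1]
  rw [Finset.sum_add_distrib, e2]
  rw [abs_le] at h3 h4 ⊢
  constructor <;> linarith [h3.1, h3.2, h4.1, h4.2]

end Windows

/-! ### Spectral decomposition of the convolution energy -/

section Spectral

/-- The standard primitive `M`-th root of unity. -/
noncomputable def unitRoot (M : ℕ) : ℂ := Complex.exp (2 * Real.pi * Complex.I / M)

theorem norm_unitRoot_pow (M k : ℕ) : ‖unitRoot M ^ k‖ = 1 := by
  rw [norm_pow, unitRoot]
  have : (2 * Real.pi * Complex.I / M : ℂ) = ((2 * Real.pi / M : ℝ) : ℂ) * Complex.I := by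
    push_cast; ring
  rw [this, Complex.norm_exp_ofReal_mul_I, one_pow]

theorem sum_unitRoot_pow_mul_conj {M : ℕ} (hM : M ≠ 0) (x y : ℕ) :
    ∑ m ∈ Finset.range M, unitRoot M ^ (m * x) * (starRingEnd ℂ) (unitRoot M ^ (m * y)) =
      if x ≡ y [MOD M] then (M : ℂ) else 0 := by
  have hprim : IsPrimitiveRoot (unitRoot M) M := Complex.isPrimitiveRoot_exp M hM
  have hne : ∀ k, unitRoot M ^ k ≠ 0 := fun k => pow_ne_zero _ (hprim.ne_zero hM)
  have hconj : ∀ k, (starRingEnd ℂ) (unitRoot M ^ k) = (unitRoot M ^ k)⁻¹ := fun k =>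
    (Complex.inv_eq_conj (norm_unitRoot_pow M k)).symm
  set w := unitRoot M ^ x * (unitRoot M ^ y)⁻¹ with hw
  have hterm : ∀ m, unitRoot M ^ (m * x) * (starRingEnd ℂ) (unitRoot M ^ (m * y)) = w ^ m := by
    intro m
    rw [hconj, hw, mul_pow, inv_pow, ← pow_mul, ← pow_mul, mul_comm m x, mul_comm m y]
  simp_rw [hterm]
  have hw1 : w = 1 ↔ x ≡ y [MOD M] := by
    have hfin : IsOfFinOrder (unitRoot M) :=
      isOfFinOrder_iff_pow_eq_one.2 ⟨M, Nat.pos_of_ne_zero hM, hprim.pow_eq_one⟩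
    have h := hfin.pow_eq_pow_iff_modEq (n := x) (m := y)
    rw [← hprim.eq_orderOf] at h
    rw [hw, mul_inv_eq_one₀ (hne y), h]
  split_ifs with h
  · rw [hw1.2 h]; simp
  · have h1 : w ≠ 1 := fun h' => h (hw1.1 h')
    have hwM : w ^ M = 1 := by
      rw [hw, mul_pow, inv_pow, ← pow_mul, ← pow_mul, mul_comm x, mul_comm y, pow_mul, pow_mul,
        hprim.pow_eq_one]
      simp
    rw [geom_sum_eq h1, hwM, sub_self, zero_div]

/-- Orthogonality of characters keeps exactly the pairs of equal position modulo `M`; several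
indices may share a position, hence the double sum. -/
theorem parseval_unitRoot {ι : Type*} {M : ℕ} (hM : M ≠ 0) (A : Finset ι) (f : ι → ℕ)
    (D : ι → ℝ) :
    ∑ m ∈ Finset.range M, ‖∑ α ∈ A, unitRoot M ^ (m * f α) * D α‖ ^ 2 =
      M * ∑ α ∈ A, ∑ β ∈ A, if f α ≡ f β [MOD M] then D α * D β else 0 := by
  apply Complex.ofReal_injective
  push_cast
  have h1 : ∀ m, ((‖∑ α ∈ A, unitRoot M ^ (m * f α) * (D α : ℂ)‖ : ℂ)) ^ 2 =
      ∑ α ∈ A, ∑ β ∈ A, D α * D β *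
        (unitRoot M ^ (m * f α) * (starRingEnd ℂ) (unitRoot M ^ (m * f β))) := by
    intro m
    rw [← Complex.mul_conj', map_sum, Finset.sum_mul_sum]
    refine Finset.sum_congr rfl fun α _ => Finset.sum_congr rfl fun β _ => ?_
    rw [map_mul, Complex.conj_ofReal]
    ring
  simp_rw [h1]
  rw [Finset.sum_comm, Finset.mul_sum]
  refine Finset.sum_congr rfl fun α _ => ?_
  rw [Finset.sum_comm, Finset.mul_sum]
  refine Finset.sum_congr rfl fun β _ => ?_
  rw [← Finset.mul_sum, sum_unitRoot_pow_mul_conj hM]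
  split_ifs <;> push_cast <;> ring

variable {p T : ℕ}

/-- The `x`-th value of the convolution of the filter `v` with the input `u` restricted to `J`. -/
noncomputable def conv (J : Finset ℕ) (u : ℕ → Fin p → ℝ) (v : Fin T × Fin p → ℝ) (x : ℕ) : ℝ :=
  ∑ s ∈ J, ∑ i : Fin T, if s + i = x then ∑ q, v (i, q) * u s q else 0

/-- The windowed energy of the input, modulated at frequency `m / M`, in the direction `a`. -/
noncomputable def modEnergy (J : Finset ℕ) (n B M m : ℕ) (u : ℕ → Fin p → ℝ)
    (a : EuclideanSpace ℂ (Fin p)) : ℝ :=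
  ∑ t ∈ Finset.range B, ‖∑ s ∈ window J n t, unitRoot M ^ (m * s) * ∑ q, a q * u s q‖ ^ 2

/-- The discrete Fourier transform of the filter `v`. -/
noncomputable def dft (M m : ℕ) (v : Fin T × Fin p → ℝ) : EuclideanSpace ℂ (Fin p) :=
  WithLp.toLp 2 fun q => ∑ i : Fin T, unitRoot M ^ (m * i) * v (i, q)

theorem sum_norm_sq_dft {M : ℕ} (hM : M ≠ 0) (hTM : T ≤ M) (v : Fin T × Fin p → ℝ) :
    ∑ m ∈ Finset.range M, ‖dft M m v‖ ^ 2 = M * ∑ q, v q ^ 2 := by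
  simp only [EuclideanSpace.norm_sq_eq, dft]
  rw [Finset.sum_comm, Fintype.sum_prod_type_right, Finset.mul_sum]
  refine Finset.sum_congr rfl fun q _ => ?_
  rw [parseval_unitRoot hM Finset.univ (fun i : Fin T => (i : ℕ)) fun i => v (i, q)]
  congr 1
  refine Finset.sum_congr rfl fun i _ => ?_
  have : ∀ j : Fin T, ((i : ℕ) ≡ j [MOD M]) ↔ j = i := fun j => by
    constructor
    · intro h
      exact (Fin.ext (Nat.ModEq.eq_of_lt_of_lt h (by omega) (by omega))).symm
    · rintro rfl; exact Nat.ModEq.refl _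
  simp_rw [this]
  simp [sq]

theorem card_window_pair (J : Finset ℕ) {n B s s' : ℕ} (hs : s ∈ J) (hs' : s' ∈ J)
    (hB : s + n ≤ B) :
    ((Finset.range B).filter fun t => s ∈ window J n t ∧ s' ∈ window J n t).card =
      min s s' + n - max s s' := by
  have : ((Finset.range B).filter fun t => s ∈ window J n t ∧ s' ∈ window J n t) =
      Finset.Ico (max s s') (min s s' + n) := by
    ext t
    simp only [Finset.mem_filter, Finset.mem_range, mem_window, Finset.mem_Ico, hs, hs', true_and]
    omega
  rw [this, Nat.card_Ico]

/-- Choosing the direction at frequency `m` to be the transform of `v` makes each window sum the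
transform, in the variable `s + i`, of the convolution restricted to the window. Parseval leaves the
pairs with equal `s + i`, weighted by the number `(n - |s - s'|)₊` of windows that contain both: a
Fejér kernel. -/
theorem sum_modEnergy_dft {J : Finset ℕ} {n B M : ℕ} (hM : M ≠ 0) (hn : n + T ≤ M)
    (hB : ∀ s ∈ J, s + n ≤ B) (u : ℕ → Fin p → ℝ) (v : Fin T × Fin p → ℝ) :
    ∑ m ∈ Finset.range M, modEnergy J n B M m u (dft M m v) =
      M * ∑ α ∈ J ×ˢ (Finset.univ : Finset (Fin T)), ∑ β ∈ J ×ˢ (Finset.univ : Finset (Fin T)),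
        if α.1 + (α.2 : ℕ) = β.1 + β.2 then
          ((min α.1 β.1 + n - max α.1 β.1 : ℕ) : ℝ) *
          ((∑ q, v (α.2, q) * u α.1 q) * ∑ q, v (β.2, q) * u β.1 q) else 0 := by
  set D : ℕ × Fin T → ℝ := fun α => ∑ q, v (α.2, q) * u α.1 q with hD
  set f : ℕ × Fin T → ℕ := fun α => α.1 + α.2 with hf
  have h1 : ∀ m t, ∑ s ∈ window J n t, unitRoot M ^ (m * s) * ∑ q, dft M m v q * u s q =
      ∑ α ∈ window J n t ×ˢ (Finset.univ : Finset (Fin T)), unitRoot M ^ (m * f α) * D α := by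
    intro m t
    rw [Finset.sum_product]
    refine Finset.sum_congr rfl fun s _ => ?_
    simp only [dft, hD, hf, Finset.sum_mul, Finset.mul_sum, Complex.ofReal_sum]
    rw [Finset.sum_comm]
    refine Finset.sum_congr rfl fun i _ => Finset.sum_congr rfl fun q _ => ?_
    push_cast
    ring
  simp only [modEnergy, h1]
  rw [Finset.sum_comm]
  simp_rw [parseval_unitRoot hM]
  rw [← Finset.mul_sum]
  congr 1
  have h2 : ∀ t, ∑ α ∈ window J n t ×ˢ (Finset.univ : Finset (Fin T)),
      ∑ β ∈ window J n t ×ˢ (Finset.univ : Finset (Fin T)),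
        (if f α ≡ f β [MOD M] then D α * D β else 0) =
      ∑ α ∈ J ×ˢ (Finset.univ : Finset (Fin T)), ∑ β ∈ J ×ˢ (Finset.univ : Finset (Fin T)),
        if α.1 ∈ window J n t ∧ β.1 ∈ window J n t then
          if f α = f β then D α * D β else 0 else 0 := by
    intro t
    have hsub : window J n t ×ˢ (Finset.univ : Finset (Fin T)) =
        (J ×ˢ (Finset.univ : Finset (Fin T))).filter fun α => α.1 ∈ window J n t := by
      ext α
      simp only [Finset.mem_product, Finset.mem_univ, and_true, Finset.mem_filter]
      exact ⟨fun h => ⟨(mem_window.1 h).1, h⟩, fun h => h.2⟩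
    rw [hsub, Finset.sum_filter]
    refine Finset.sum_congr rfl fun α _ => ?_
    split_ifs with hα
    · rw [Finset.sum_filter]
      refine Finset.sum_congr rfl fun β _ => ?_
      by_cases hβ : β.1 ∈ window J n t
      · simp only [hα, hβ, and_self, if_true]
        -- Two elements of a window differ by less than `n` and two lags by less than `T`, so `n + T
        -- ≤ M` excludes wrap-around.
        have : f α ≡ f β [MOD M] ↔ f α = f β := by
          constructor
          · intro h
            have ha := mem_window.1 hα
            have hb := mem_window.1 hβ
            have h2 := α.2.2
            have h3 := β.2.2
            rcases le_total (f α) (f β) with hle | hle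
            · have := Nat.eq_zero_of_dvd_of_lt ((Nat.modEq_iff_dvd' hle).1 h)
                (by simp only [hf]; omega)
              omega
            · have := Nat.eq_zero_of_dvd_of_lt ((Nat.modEq_iff_dvd' hle).1 h.symm)
                (by simp only [hf]; omega)
              omega
          · intro h; rw [h]
        simp only [this]
      · simp [hβ]
    · simp [hα]
  simp_rw [h2]
  rw [Finset.sum_comm]
  refine Finset.sum_congr rfl fun α hα => ?_
  rw [Finset.sum_comm]
  refine Finset.sum_congr rfl fun β hβ => ?_
  have hα' := (Finset.mem_product.1 hα).1
  have hβ' := (Finset.mem_product.1 hβ).1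
  rw [← Finset.sum_filter, Finset.sum_const, card_window_pair J hα' hβ' (hB _ hα'), nsmul_eq_mul,
    mul_ite, mul_zero]

theorem sum_sq_conv (J : Finset ℕ) {B : ℕ} (hB : ∀ s ∈ J, s + T ≤ B) (u : ℕ → Fin p → ℝ)
    (v : Fin T × Fin p → ℝ) :
    ∑ x ∈ Finset.range B, conv J u v x ^ 2 =
      ∑ α ∈ J ×ˢ (Finset.univ : Finset (Fin T)), ∑ β ∈ J ×ˢ (Finset.univ : Finset (Fin T)),
        if α.1 + (α.2 : ℕ) = β.1 + β.2 then
          ((∑ q, v (α.2, q) * u α.1 q) * ∑ q, v (β.2, q) * u β.1 q) else 0 := by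
  set D : ℕ × Fin T → ℝ := fun α => ∑ q, v (α.2, q) * u α.1 q with hD
  have h1 : ∀ x, conv J u v x ^ 2 =
      ∑ α ∈ J ×ˢ (Finset.univ : Finset (Fin T)), ∑ β ∈ J ×ˢ (Finset.univ : Finset (Fin T)),
        if α.1 + (α.2 : ℕ) = x then
          if α.1 + (α.2 : ℕ) = β.1 + β.2 then D α * D β else 0 else 0 := by
    intro x
    have : conv J u v x = ∑ α ∈ J ×ˢ (Finset.univ : Finset (Fin T)),
        if α.1 + (α.2 : ℕ) = x then D α else 0 := by
      rw [Finset.sum_product]; rfl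
    rw [this, sq, Finset.sum_mul_sum]
    refine Finset.sum_congr rfl fun α _ => Finset.sum_congr rfl fun β _ => ?_
    by_cases h : α.1 + (α.2 : ℕ) = x
    · by_cases h' : β.1 + (β.2 : ℕ) = x
      · simp [h, h']
      · have : ¬ (x = β.1 + β.2) := fun h'' => h' h''.symm
        simp [h, h', this]
    · simp [h]
  simp_rw [h1]
  rw [Finset.sum_comm]
  refine Finset.sum_congr rfl fun α hα => ?_
  rw [Finset.sum_comm]
  refine Finset.sum_congr rfl fun β _ => ?_
  rw [Finset.sum_ite_eq, if_pos]
  have := hB _ (Finset.mem_product.1 hα).1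
  have := α.2.2
  rw [Finset.mem_range]
  omega

/-- The energy of a convolution is a de la Vallée-Poussin average of windowed energies. -/
theorem convolution_energy_eq (J : Finset ℕ) {B : ℕ} (hT : 1 ≤ T) (hB : ∀ s ∈ J, s + 2 * T ≤ B)
    (u : ℕ → Fin p → ℝ) (v : Fin T × Fin p → ℝ) :
    ((3 * T : ℕ) : ℝ) * T * ∑ x ∈ Finset.range B, conv J u v x ^ 2 =
      ∑ m ∈ Finset.range (3 * T), (modEnergy J (2 * T) B (3 * T) m u (dft (3 * T) m v) -
        modEnergy J T B (3 * T) m u (dft (3 * T) m v)) := by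
  have hM : 3 * T ≠ 0 := by omega
  rw [Finset.sum_sub_distrib, sum_modEnergy_dft hM (by omega) hB,
    sum_modEnergy_dft hM (by omega) (fun s hs => by have := hB s hs; omega),
    sum_sq_conv J (fun s hs => by have := hB s hs; omega), ← mul_sub, mul_assoc]
  congr 1
  rw [← Finset.sum_sub_distrib, Finset.mul_sum]
  refine Finset.sum_congr rfl fun α _ => ?_
  rw [← Finset.sum_sub_distrib, Finset.mul_sum]
  refine Finset.sum_congr rfl fun β _ => ?_
  split_ifs with h
  · rw [← sub_mul]
    congr 1
    have h1 := α.2.2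
    have h2 := β.2.2
    -- Equal sums `s + i = s' + i'` force `|s - s'| < T`, so neither triangular weight is truncated
    -- and the weights for `2T` and `T` differ by exactly `T`.
    have : min α.1 β.1 + 2 * T - max α.1 β.1 = T + (min α.1 β.1 + T - max α.1 β.1) := by omega
    rw [this]
    push_cast
    ring
  · simp

end Spectral

/-! ### Near-isometry of the input matrix -/

section Isometry

/-- The upper bound on the net first controls the operator norm up to the factor `100/99`; this norm
then limits how far `‖A x‖` can drop below its value at a neighbouring net point. -/
theorem norm_sq_bounds_of_net {E F : Type*} [NormedAddCommGroup E] [NormedSpace ℝ E]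
    [FiniteDimensional ℝ E] [SeminormedAddCommGroup F] [NormedSpace ℝ F] (A : E →ₗ[ℝ] F)
    {S : Finset E} (hS : ∀ x : E, ‖x‖ = 1 → ∃ y ∈ S, ‖x - y‖ ≤ 1 / 100) {X Y : ℝ}
    (hY : 0 ≤ Y) (hl : ∀ z ∈ S, X ≤ ‖A z‖ ^ 2) (hu : ∀ z ∈ S, ‖A z‖ ^ 2 ≤ Y) (x : E) :
    (X - (X + Y) / 99) * ‖x‖ ^ 2 ≤ ‖A x‖ ^ 2 ∧ ‖A x‖ ^ 2 ≤ (100 / 99) ^ 2 * Y * ‖x‖ ^ 2 := by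
  let A' := A.toContinuousLinearMap
  have hb : ∀ x, ‖A x‖ ≤ ‖A'‖ * ‖x‖ := fun x => A'.le_opNorm x
  have hsplit : ∀ x y : E, ‖x - y‖ ≤ 1 / 100 → ‖A (x - y)‖ ≤ ‖A'‖ * (1 / 100) := fun x y h =>
    (hb _).trans (by gcongr)
  have hop : ‖A'‖ ≤ √Y + ‖A'‖ * (1 / 100) := by
    refine A'.opNorm_le_of_unit_norm (by positivity) fun x hx => ?_
    obtain ⟨y, hy, hxy⟩ := hS x hx
    calc ‖A x‖ = ‖A y + A (x - y)‖ := by rw [← map_add]; congr 2; abel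
      _ ≤ ‖A y‖ + ‖A (x - y)‖ := norm_add_le _ _
      _ ≤ √Y + ‖A'‖ * (1 / 100) :=
        add_le_add (Real.le_sqrt_of_sq_le (hu y hy)) (hsplit x y hxy)
  have hop' : ‖A'‖ ≤ 100 / 99 * √Y := by linarith
  have hsq := Real.sq_sqrt hY
  have hsq0 := Real.sqrt_nonneg Y
  have hunit : ∀ x, ‖x‖ = 1 → X - (X + Y) / 99 ≤ ‖A x‖ ^ 2 := by
    intro x hx
    obtain ⟨y, hy, hxy⟩ := hS x hx
    have h1 : ‖A y‖ ≤ ‖A x‖ + √Y / 99 := by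
      calc ‖A y‖ = ‖A x - A (x - y)‖ := by rw [← map_sub]; congr 2; abel
        _ ≤ ‖A x‖ + ‖A (x - y)‖ := norm_sub_le _ _
        _ ≤ ‖A x‖ + √Y / 99 := by
          have := hsplit x y hxy
          linarith
    have h0 := norm_nonneg (A x)
    have h3 : X ≤ (‖A x‖ + √Y / 99) ^ 2 := (hl y hy).trans (by gcongr)
    have h4 : (‖A x‖ + √Y / 99) ^ 2 =
      ‖A x‖ ^ 2 + 2 / 99 * (‖A x‖ * √Y) + Y / 9801 := by
      linear_combination (1 / 9801) * hsq
    rw [h4] at h3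
    have h5 : 2 * (‖A x‖ * √Y) ≤ ‖A x‖ ^ 2 + Y := by nlinarith [sq_nonneg (‖A x‖ - √Y)]
    linarith [sq_nonneg (‖A x‖)]
  constructor
  · by_cases hx : x = 0
    · simp [hx]
    · have hx' : 0 < ‖x‖ := norm_pos_iff.2 hx
      have h := hunit (‖x‖⁻¹ • x) (by rw [norm_smul, norm_inv, norm_norm]; field_simp)
      rw [map_smul, norm_smul, norm_inv, norm_norm, mul_pow, inv_pow] at h
      have := mul_le_mul_of_nonneg_right h (sq_nonneg ‖x‖)
      refine this.trans (le_of_eq ?_)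
      field_simp
  · have h1 : ‖A x‖ ≤ 100 / 99 * √Y * ‖x‖ := (hb x).trans (by gcongr)
    calc ‖A x‖ ^ 2 ≤ (100 / 99 * √Y * ‖x‖) ^ 2 := by gcongr
      _ = _ := by rw [mul_pow, mul_pow, hsq]

variable {p T : ℕ}

theorem modEnergy_eq_norm_sq (J : Finset ℕ) (n B M m : ℕ) (u : ℕ → Fin p → ℝ) :
    ∃ A : EuclideanSpace ℂ (Fin p) →ₗ[ℝ] EuclideanSpace ℂ (Fin B),
      ∀ a, modEnergy J n B M m u a = ‖A a‖ ^ 2 := by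
  refine ⟨{ toFun := fun a => WithLp.toLp 2 fun t : Fin B =>
              ∑ s ∈ window J n t, unitRoot M ^ (m * s) * ∑ q, a q * u s q
            map_add' := ?_
            map_smul' := ?_ }, ?_⟩
  · intro a b
    ext t
    simp only [PiLp.add_apply, add_mul, Finset.sum_add_distrib, mul_add]
  · intro c a
    ext t
    simp only [PiLp.smul_apply, Complex.real_smul, RingHom.id_apply, Finset.mul_sum]
    refine Finset.sum_congr rfl fun s _ => Finset.sum_congr rfl fun q _ => ?_
    ring
  · intro a
    rw [EuclideanSpace.norm_sq_eq, modEnergy, Finset.sum_range]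
    rfl

theorem abs_modEnergy_sub_le_of_net {S : Finset (EuclideanSpace ℂ (Fin p))}
    (hS : ∀ x : EuclideanSpace ℂ (Fin p), ‖x‖ = 1 → ∃ y ∈ S, ‖x - y‖ ≤ 1 / 100)
    {J : Finset ℕ} {n B M m N : ℕ} {u : ℕ → Fin p → ℝ} (hJ : J.card ≤ N)
    (h : ∀ z ∈ S, |modEnergy J n B M m u z - n * J.card| ≤ 2 * (1 / 200) * n * N)
    (a : EuclideanSpace ℂ (Fin p)) :
    |modEnergy J n B M m u a - n * J.card * ‖a‖ ^ 2| ≤ n * N / 25 * ‖a‖ ^ 2 := by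
  obtain ⟨A, hA⟩ := modEnergy_eq_norm_sq J n B M m u
  have hJ' : (J.card : ℝ) ≤ N := by exact_mod_cast hJ
  have hnN : (n : ℝ) * J.card ≤ n * N := by gcongr
  have h0 : (0 : ℝ) ≤ n * N := by positivity
  obtain ⟨h1, h2⟩ := norm_sq_bounds_of_net A hS (X := n * J.card - n * N / 100)
    (Y := n * J.card + n * N / 100) (by positivity)
    (fun z hz => by have := (abs_le.1 (h z hz)).1; rw [hA] at this; linarith)
    (fun z hz => by have := (abs_le.1 (h z hz)).2; rw [hA] at this; linarith) a
  rw [hA, abs_le]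
  have ha := sq_nonneg ‖a‖
  have h3 := mul_le_mul_of_nonneg_right hnN ha
  have h4 := mul_nonneg h0 ha
  constructor <;> nlinarith

/-- The errors of the windows of lengths `2T` and `T` add up to `3TN/25` per unit of spectral mass,
and the spectral mass of `v` is `3T ‖v‖²`; dividing by `3T · T` gives `3N/25`. -/
theorem abs_convolution_energy_sub_le (hT : 1 ≤ T) {J : Finset ℕ} {B N : ℕ}
    (hB : ∀ s ∈ J, s + 2 * T ≤ B) {u : ℕ → Fin p → ℝ}
    (h : ∀ n ∈ ({2 * T, T} : Finset ℕ), ∀ m ∈ Finset.range (3 * T),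
      ∀ a : EuclideanSpace ℂ (Fin p), |modEnergy J n B (3 * T) m u a - n * J.card * ‖a‖ ^ 2| ≤
        n * N / 25 * ‖a‖ ^ 2) (v : Fin T × Fin p → ℝ) :
    |∑ x ∈ Finset.range B, conv J u v x ^ 2 - J.card * ∑ q, v q ^ 2| ≤
      3 / 25 * N * ∑ q, v q ^ 2 := by
  have hT' : (0 : ℝ) < T := by exact_mod_cast hT
  have h1 := convolution_energy_eq J hT hB u v
  have h2 := sum_norm_sq_dft (M := 3 * T) (by omega) (by omega) v
  set V := ∑ q, v q ^ 2
  set E := ∑ x ∈ Finset.range B, conv J u v x ^ 2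
  have h3 : ((3 * T : ℕ) : ℝ) * T * (E - J.card * V) = ∑ m ∈ Finset.range (3 * T),
      ((modEnergy J (2 * T) B (3 * T) m u (dft (3 * T) m v) -
          (2 * T : ℕ) * J.card * ‖dft (3 * T) m v‖ ^ 2) -
        (modEnergy J T B (3 * T) m u (dft (3 * T) m v) - T * J.card * ‖dft (3 * T) m v‖ ^ 2)) := by
    rw [mul_sub, h1]
    have : ((3 * T : ℕ) : ℝ) * T * (J.card * V) =
        ∑ m ∈ Finset.range (3 * T), T * J.card * ‖dft (3 * T) m v‖ ^ 2 := by
      rw [← Finset.mul_sum, h2]; ring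
    rw [this, ← Finset.sum_sub_distrib]
    refine Finset.sum_congr rfl fun m _ => ?_
    push_cast
    ring
  have h4 : ((3 * T : ℕ) : ℝ) * T * |E - J.card * V| ≤
      ((3 * T : ℕ) : ℝ) * T * (3 / 25 * N * V) := by
    rw [← abs_of_nonneg (a := ((3 * T : ℕ) : ℝ) * T) (by positivity), ← abs_mul, h3,
      abs_of_nonneg (a := ((3 * T : ℕ) : ℝ) * T) (by positivity)]
    refine (Finset.abs_sum_le_sum_abs _ _).trans ?_
    have : ((3 * T : ℕ) : ℝ) * T * (3 / 25 * N * V) =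
        ∑ m ∈ Finset.range (3 * T), (3 * T * N / 25) * ‖dft (3 * T) m v‖ ^ 2 := by
      rw [← Finset.mul_sum, h2]; ring
    rw [this]
    refine Finset.sum_le_sum fun m hm => ?_
    have h5 := h (2 * T) (by simp) m hm (dft (3 * T) m v)
    have h6 := h T (by simp) m hm (dft (3 * T) m v)
    refine (abs_sub _ _).trans ((add_le_add h5 h6).trans (le_of_eq ?_))
    push_cast
    ring
  exact le_of_mul_le_mul_left h4 (by positivity)

theorem conv_eq_dotProduct_concatInput {N₁ N t : ℕ} (hT : T ≤ N₁) (ht : t ∈ Finset.Icc N₁ N)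
    (u : ℕ → Fin p → ℝ) (v : Fin T × Fin p → ℝ) :
    conv (Finset.Icc (N₁ + 1 - T) N) u v t = concatInput T u t ⬝ᵥ v := by
  rw [Finset.mem_Icc] at ht
  rw [conv, Finset.sum_comm, dotProduct, Fintype.sum_prod_type]
  refine Finset.sum_congr rfl fun i _ => ?_
  have hi := i.2
  rw [Finset.sum_eq_single (t - i)]
  · rw [if_pos (by omega)]
    exact Finset.sum_congr rfl fun q _ => mul_comm _ _
  · intro s _ hs
    rw [if_neg (by omega)]
  · intro h
    exact absurd (Finset.mem_Icc.2 ⟨by omega, by omega⟩) h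

theorem conv_eq_of_subset {J J' : Finset ℕ} (hJ : J' ⊆ J) {x : ℕ} (u : ℕ → Fin p → ℝ)
    (v : Fin T × Fin p → ℝ) (h : ∀ s ∈ J, ∀ i : Fin T, s + (i : ℕ) = x → s ∈ J') :
    conv J u v x = conv J' u v x := by
  rw [conv, conv]
  symm
  refine Finset.sum_subset hJ fun s hs hs' => Finset.sum_eq_zero fun i _ => ?_
  rw [if_neg fun h' => hs' (h s hs i h')]

/-- At recorded times the convolution is `⟨ū_t, v⟩`. At other times it only sees the first or the
last `T - 1` inputs of the interval, so the unrecorded energy is at most that of two short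
convolutions. -/
theorem isometry_of_convolution_energy {N₁ N : ℕ} (hT1 : 1 ≤ T) (hT : T ≤ N₁) (hN₁ : 10 * N₁ ≤ N)
    (hTN : 50 * T ≤ N) {u : ℕ → Fin p → ℝ}
    (h : ∀ J ∈ ({Finset.Icc (N₁ + 1 - T) N, Finset.Icc (N₁ + 1 - T) (N₁ - 1),
      Finset.Icc (N + 2 - T) N} : Finset (Finset ℕ)), ∀ v : Fin T × Fin p → ℝ,
      |∑ x ∈ Finset.range (N + 2 * T), conv J u v x ^ 2 - J.card * ∑ q, v q ^ 2| ≤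
      3 / 25 * N * ∑ q, v q ^ 2) (v : Fin T × Fin p → ℝ) :
    N / 2 * ∑ q, v q ^ 2 ≤ ∑ t ∈ Finset.Icc N₁ N, (concatInput T u t ⬝ᵥ v) ^ 2 ∧
      ∑ t ∈ Finset.Icc N₁ N, (concatInput T u t ⬝ᵥ v) ^ 2 ≤ 3 * N * ∑ q, v q ^ 2 := by
  have hI := abs_le.1 (h (Finset.Icc (N₁ + 1 - T) N) (by simp) v)
  have hL := abs_le.1 (h (Finset.Icc (N₁ + 1 - T) (N₁ - 1)) (by simp) v)
  have hR := abs_le.1 (h (Finset.Icc (N + 2 - T) N) (by simp) v)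
  set V := ∑ q, v q ^ 2
  have hV : 0 ≤ V := Finset.sum_nonneg fun _ _ => sq_nonneg _
  simp only [Nat.card_Icc] at hI hL hR
  have e : ∑ t ∈ Finset.Icc N₁ N, (concatInput T u t ⬝ᵥ v) ^ 2 =
      ∑ x ∈ Finset.range (N + 2 * T), if x ∈ Finset.Icc N₁ N then
        conv (Finset.Icc (N₁ + 1 - T) N) u v x ^ 2 else 0 := by
    rw [← Finset.sum_filter]
    have : (Finset.range (N + 2 * T)).filter (fun x => x ∈ Finset.Icc N₁ N) = Finset.Icc N₁ N := by
      ext x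
      simp only [Finset.mem_filter, Finset.mem_range, Finset.mem_Icc]
      omega
    rw [this]
    exact Finset.sum_congr rfl fun t ht => by rw [conv_eq_dotProduct_concatInput hT ht]
  have hup : ∑ t ∈ Finset.Icc N₁ N, (concatInput T u t ⬝ᵥ v) ^ 2 ≤
      ∑ x ∈ Finset.range (N + 2 * T), conv (Finset.Icc (N₁ + 1 - T) N) u v x ^ 2 := by
    rw [e]
    refine Finset.sum_le_sum fun x _ => ?_
    split_ifs
    · exact le_rfl
    · positivity
  have hlo : ∑ x ∈ Finset.range (N + 2 * T), conv (Finset.Icc (N₁ + 1 - T) N) u v x ^ 2 ≤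
      ∑ t ∈ Finset.Icc N₁ N, (concatInput T u t ⬝ᵥ v) ^ 2 +
      (∑ x ∈ Finset.range (N + 2 * T), conv (Finset.Icc (N₁ + 1 - T) (N₁ - 1)) u v x ^ 2 +
      ∑ x ∈ Finset.range (N + 2 * T), conv (Finset.Icc (N + 2 - T) N) u v x ^ 2) := by
    rw [e, ← Finset.sum_add_distrib, ← Finset.sum_add_distrib]
    refine Finset.sum_le_sum fun x _ => ?_
    split_ifs with hx
    · nlinarith [sq_nonneg (conv (Finset.Icc (N₁ + 1 - T) (N₁ - 1)) u v x),
        sq_nonneg (conv (Finset.Icc (N + 2 - T) N) u v x)]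
    · rw [Finset.mem_Icc] at hx
      rcases lt_or_ge x N₁ with hx1 | hx1
      · rw [conv_eq_of_subset (J' := Finset.Icc (N₁ + 1 - T) (N₁ - 1))
          (Finset.Icc_subset_Icc le_rfl (by omega)) u v (fun s hs i hsi => by
            rw [Finset.mem_Icc] at hs ⊢; omega)]
        nlinarith [sq_nonneg (conv (Finset.Icc (N + 2 - T) N) u v x)]
      · rw [conv_eq_of_subset (J' := Finset.Icc (N + 2 - T) N)
          (Finset.Icc_subset_Icc (by omega) le_rfl) u v (fun s hs i hsi => by
            have := i.2
            rw [Finset.mem_Icc] at hs ⊢; omega)]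
        nlinarith [sq_nonneg (conv (Finset.Icc (N₁ + 1 - T) (N₁ - 1)) u v x)]
  have c1 : (9 / 10 * N : ℝ) ≤ ((N + 1 - (N₁ + 1 - T) : ℕ) : ℝ) := by
    have : 9 * N ≤ 10 * (N + 1 - (N₁ + 1 - T)) := by omega
    have : (9 * N : ℝ) ≤ 10 * ((N + 1 - (N₁ + 1 - T) : ℕ) : ℝ) := by exact_mod_cast this
    linarith
  have c2 : ((N + 1 - (N₁ + 1 - T) : ℕ) : ℝ) ≤ N := by
    have : N + 1 - (N₁ + 1 - T) ≤ N := by omega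
    exact_mod_cast this
  have c3 : ((N₁ - 1 + 1 - (N₁ + 1 - T) : ℕ) : ℝ) ≤ N / 50 := by
    have : 50 * (N₁ - 1 + 1 - (N₁ + 1 - T)) ≤ N := by omega
    have : (50 * (N₁ - 1 + 1 - (N₁ + 1 - T) : ℕ) : ℝ) ≤ N := by exact_mod_cast this
    linarith
  have c4 : ((N + 1 - (N + 2 - T) : ℕ) : ℝ) ≤ N / 50 := by
    have : 50 * (N + 1 - (N + 2 - T)) ≤ N := by omega
    have : (50 * (N + 1 - (N + 2 - T) : ℕ) : ℝ) ≤ N := by exact_mod_cast this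
    linarith
  have d1 := mul_le_mul_of_nonneg_right c1 hV
  have d2 := mul_le_mul_of_nonneg_right c2 hV
  have d3 := mul_le_mul_of_nonneg_right c3 hV
  have d4 := mul_le_mul_of_nonneg_right c4 hV
  have hNV : 0 ≤ (N : ℝ) * V := by positivity
  -- The lower constant is `9/10 - 3/25 - 2 (1/50 + 3/25) = 1/2`.
  constructor
  · linarith [hI.1, hI.2, hL.2, hR.2]
  · linarith [hI.2]

variable {Ω : Type*} [mΩ : MeasurableSpace Ω] {P : Measure Ω} [IsProbabilityMeasure P]

/-- With high probability the input matrix is a near-isometry. -/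
theorem measure_not_isometry_le {x : ℕ → Ω → Fin p → ℝ} (hi : iIndepFun x P)
    (hm : ∀ s, Measurable (x s)) {N₁ N : ℕ} (hl : ∀ s ∈ Finset.Icc 1 N, P.map (x s) = stdNormal p)
    (hT1 : 1 ≤ T) (hT : T ≤ N₁) (hN₁ : 10 * N₁ ≤ N) (hTN : 50 * T ≤ N) :
    P {ω | ¬ ∀ v : Fin T × Fin p → ℝ,
      N / 2 * ∑ q, v q ^ 2 ≤ ∑ t ∈ Finset.Icc N₁ N, (concatInput T (fun s => x s ω) t ⬝ᵥ v) ^ 2 ∧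
      ∑ t ∈ Finset.Icc N₁ N, (concatInput T (fun s => x s ω) t ⬝ᵥ v) ^ 2 ≤
        3 * N * ∑ q, v q ^ 2} ≤
      ENNReal.ofReal (144 * T ^ 2 * 201 ^ (2 * p) * Real.exp (-(N / (1280000 * T)))) := by
  classical
  have hT' : (0 : ℝ) < T := by exact_mod_cast hT1
  obtain ⟨S, hS1, hScard, hS⟩ := exists_net (E := EuclideanSpace ℂ (Fin p)) (R := 1)
    (r := 1 / 100) zero_le_one (by norm_num) {x | ‖x‖ = 1} (fun x hx => le_of_eq hx)
  have hrank : Module.finrank ℝ (EuclideanSpace ℂ (Fin p)) = 2 * p := by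
    rw [finrank_real_of_complex, finrank_euclideanSpace_fin]
  rw [hrank] at hScard
  norm_num at hScard
  set 𝓙 : Finset (Finset ℕ) := {Finset.Icc (N₁ + 1 - T) N, Finset.Icc (N₁ + 1 - T) (N₁ - 1),
      Finset.Icc (N + 2 - T) N} with h𝓙
  have h𝓙sub : ∀ J ∈ 𝓙, J ⊆ Finset.Icc 1 N := by
    intro J hJ
    simp only [h𝓙, Finset.mem_insert, Finset.mem_singleton] at hJ
    rcases hJ with rfl | rfl | rfl <;> intro s hs <;> rw [Finset.mem_Icc] at hs ⊢ <;> omega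
  have h𝓙card : ∀ J ∈ 𝓙, J.card ≤ N := fun J hJ => by
    simpa using Finset.card_le_card (h𝓙sub J hJ)
  have h𝓙B : ∀ J ∈ 𝓙, ∀ s ∈ J, s + 2 * T ≤ N + 2 * T := fun J hJ s hs => by
    have := Finset.mem_Icc.1 (h𝓙sub J hJ hs)
    omega
  set bad : Finset ℕ × ℕ × ℕ × EuclideanSpace ℂ (Fin p) → Set Ω := fun i =>
    {ω | ¬ |modEnergy i.1 i.2.1 (N + 2 * T) (3 * T) i.2.2.1 (fun s => x s ω) i.2.2.2 -
      i.2.1 * i.1.card| ≤ 2 * (1 / 200) * i.2.1 * N} with hbad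
  set idx := 𝓙 ×ˢ ({2 * T, T} : Finset ℕ) ×ˢ Finset.range (3 * T) ×ˢ S with hidx
  have hbound : ∀ i ∈ idx, P (bad i) ≤
      ENNReal.ofReal (8 * T * Real.exp (-(N / (1280000 * T)))) := by
    rintro ⟨J, n, m, z⟩ hi'
    simp only [hidx, Finset.mem_product, Finset.mem_insert, Finset.mem_singleton] at hi'
    obtain ⟨hJ, hn, -, hz⟩ := hi'
    have hn1 : 1 ≤ n := by omega
    have hn2 : (n : ℝ) ≤ 2 * T := by
      have : n ≤ 2 * T := by omega
      exact_mod_cast this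
    have hn0 : (0 : ℝ) < n := by exact_mod_cast hn1
    refine (measure_modulated_energy hi hm (fun s hs => hl s (h𝓙sub J hJ hs)) hn1
      (fun s hs => by have := h𝓙B J hJ s hs; omega) (M := N) (ε := 1 / 200)
      (by exact_mod_cast h𝓙card J hJ) (by norm_num) (by norm_num)
      (fun s => unitRoot (3 * T) ^ (m * s)) (fun s => norm_unitRoot_pow _ _) z (hS1 hz)).trans ?_
    apply ENNReal.ofReal_le_ofReal
    -- The worst window length is `n = 2T`, and `200² · 16 · 2 = 1280000`.
    have h1 : (N : ℝ) / (1280000 * T) ≤ (1 / 200) ^ 2 * N / (16 * n) := by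
      rw [div_le_div_iff₀ (by positivity) (by positivity)]
      have : (0 : ℝ) ≤ N := by positivity
      nlinarith [mul_le_mul_of_nonneg_left hn2 this]
    have h2 : (4 * n : ℝ) ≤ 8 * T := by linarith
    gcongr
  -- Three index intervals, two window lengths, `3T` frequencies, and a `1/100`-net of the unit
  -- sphere of `ℂᵖ`, of real dimension `2p`.
  have hcard : (idx.card : ℝ) ≤ 18 * T * 201 ^ (2 * p) := by
    have h1 : 𝓙.card ≤ 3 := Finset.card_le_three
    have h2 : ({2 * T, T} : Finset ℕ).card ≤ 2 := Finset.card_le_two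
    have h3 : idx.card ≤ 3 * (2 * ((3 * T) * S.card)) := by
      rw [hidx, Finset.card_product, Finset.card_product, Finset.card_product, Finset.card_range]
      gcongr
    have h4 : (idx.card : ℝ) ≤ 3 * (2 * ((3 * T) * S.card)) := by exact_mod_cast h3
    have h5 : (T : ℝ) * S.card ≤ T * 201 ^ (2 * p) := by gcongr
    linarith
  have hsub : {ω | ¬ ∀ v : Fin T × Fin p → ℝ,
      N / 2 * ∑ q, v q ^ 2 ≤ ∑ t ∈ Finset.Icc N₁ N, (concatInput T (fun s => x s ω) t ⬝ᵥ v) ^ 2 ∧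
      ∑ t ∈ Finset.Icc N₁ N, (concatInput T (fun s => x s ω) t ⬝ᵥ v) ^ 2 ≤
        3 * N * ∑ q, v q ^ 2} ⊆ ⋃ i ∈ idx, bad i := by
    intro ω hω
    by_contra hcon
    simp only [Set.mem_iUnion, not_exists, hbad, Set.mem_ofPred_eq, not_not] at hcon
    apply hω
    refine isometry_of_convolution_energy hT1 hT hN₁ hTN fun J hJ =>
      abs_convolution_energy_sub_le hT1 (h𝓙B J hJ) fun n hn m hm a =>
        abs_modEnergy_sub_le_of_net (fun x hx => hS x hx) (h𝓙card J hJ) (fun z hz => ?_) a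
    exact hcon (J, n, m, z) (by
      simp only [hidx, Finset.mem_product]
      exact ⟨hJ, hn, hm, hz⟩)
  refine (measure_mono hsub).trans ((measure_biUnion_finset_le _ _).trans
    ((Finset.sum_le_card_nsmul _ _ _ hbound).trans ?_))
  rw [nsmul_eq_mul, ← ENNReal.ofReal_natCast, ← ENNReal.ofReal_mul (by positivity)]
  apply ENNReal.ofReal_le_ofReal
  calc (idx.card : ℝ) * (8 * T * Real.exp (-(N / (1280000 * T))))
      ≤ (18 * T * 201 ^ (2 * p)) * (8 * T * Real.exp (-(N / (1280000 * T)))) := by gcongr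
    _ = _ := by ring

end Isometry

/-! ### The Gaussian transforms of the model -/

section Model

variable {Ω : Type*} [mΩ : MeasurableSpace Ω] {P : Measure Ω}
  {𝓕 : Filtration ℕ mΩ} {m p L T N₁ N : ℕ} {G : Matrix (Fin m) (Fin T × Fin p) ℝ}
  {x : ℕ → Ω → Fin p → ℝ} {e : ℕ → Ω → Fin m → ℝ} {k : ℕ → Ω → Fin L → ℝ}
  {y : ℕ → Ω → Fin m → ℝ}

instance (p : ℕ) : IsProbabilityMeasure (stdNormal p) := by unfold stdNormal; infer_instance

/-- The inputs on the time horizon, extended by zero. -/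
noncomputable def extInput (N : ℕ) (x : ℕ → Ω → Fin p → ℝ) (s : ℕ) : Ω → Fin p → ℝ :=
  if s ∈ Finset.Icc 1 N then x s else 0

theorem IsSemiParametricModel.measurable_extInput
    (h : IsSemiParametricModel P 𝓕 T N₁ N G x e k y) (s : ℕ) : Measurable (extInput N x s) := by
  rw [extInput]
  split_ifs with hs
  · exact (h.input_measurable s hs).mono (𝓕.le _) le_rfl
  · exact measurable_const

variable [IsProbabilityMeasure P]

theorem IsSemiParametricModel.map_input (h : IsSemiParametricModel P 𝓕 T N₁ N G x e k y) {s : ℕ}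
    (hs : s ∈ Finset.Icc 1 N) : P.map (x s) = stdNormal p :=
  (h.input_law s hs).map_eq (𝓕.le _) ((h.input_measurable s hs).mono (𝓕.le _) le_rfl)

theorem IsSemiParametricModel.indep_input (h : IsSemiParametricModel P 𝓕 T N₁ N G x e k y) {s : ℕ}
    (hs : s ∈ Finset.Icc 1 N) :
    Indep (𝓕 (s - 1)) (MeasurableSpace.comap (x s) inferInstance) P :=
  (h.input_law s hs).indep (𝓕.le _) ((h.input_measurable s hs).mono (𝓕.le _) le_rfl)

/-- Induction on the largest index: the event of the earlier inputs lies in `𝓕 (a - 1)`, from which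
the input at `a` is independent. Off the horizon the extended input is constant. -/
theorem IsSemiParametricModel.iIndepFun_extInput
    (h : IsSemiParametricModel P 𝓕 T N₁ N G x e k y) : iIndepFun (extInput N x) P := by
  rw [iIndepFun_iff_measure_inter_preimage_eq_mul]
  intro S
  induction S using Finset.induction_on_max with
  | empty => intro sets _; simp
  | insert a S ha ih =>
    intro sets hsets
    have haS : a ∉ S := fun h' => lt_irrefl _ (ha a h')
    have ih' := ih (sets := sets) fun i hi => hsets i (Finset.mem_insert_of_mem hi)
    rw [Finset.prod_insert haS, ← ih', Finset.set_biInter_insert]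
    by_cases has : a ∈ Finset.Icc 1 N
    · have h1 : MeasurableSet[𝓕 (a - 1)] (⋂ i ∈ S, extInput N x i ⁻¹' sets i) := by
        refine Finset.measurableSet_biInter _ fun i hi => ?_
        have hmi : Measurable[𝓕 (a - 1)] (extInput N x i) := by
          rw [extInput]
          split_ifs with hiN
          · exact (h.input_measurable i hiN).mono (𝓕.mono (by have := ha i hi; omega)) le_rfl
          · exact @measurable_const _ _ _ (𝓕 (a - 1)) _
        exact hmi (hsets i (Finset.mem_insert_of_mem hi))
      have h2 : MeasurableSet[MeasurableSpace.comap (x a) inferInstance]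
          (extInput N x a ⁻¹' sets a) := by
        rw [extInput, if_pos has]
        exact ⟨sets a, hsets a (Finset.mem_insert_self _ _), rfl⟩
      have := (Indep_iff _ _ P).1 (h.indep_input has) _ _ h1 h2
      rw [Set.inter_comm, this, mul_comm]
    · have : extInput N x a = 0 := by rw [extInput, if_neg has]
      rw [this]
      by_cases h0 : (0 : Fin p → ℝ) ∈ sets a
      · have e0 : (0 : Ω → Fin p → ℝ) ⁻¹' sets a = Set.univ := by
          ext ω; simp only [Set.mem_preimage, Pi.zero_apply, Set.mem_univ, iff_true]; exact h0
        simp [e0]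
      · have e0 : (0 : Ω → Fin p → ℝ) ⁻¹' sets a = ∅ := by
          ext ω; simp only [Set.mem_preimage, Pi.zero_apply, Set.mem_empty_iff_false, iff_false]
          exact h0
        simp [e0]

theorem IsSemiParametricModel.measure_not_isometry_le
    (h : IsSemiParametricModel P 𝓕 T N₁ N G x e k y)
    (hT1 : 1 ≤ T) (hT : T ≤ N₁) (hN₁ : 10 * N₁ ≤ N) (hTN : 50 * T ≤ N) :
    P {ω | ¬ ∀ v : Fin T × Fin p → ℝ,
      N / 2 * ∑ q, v q ^ 2 ≤ ∑ t ∈ Finset.Icc N₁ N, (concatInput T (fun s => x s ω) t ⬝ᵥ v) ^ 2 ∧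
      ∑ t ∈ Finset.Icc N₁ N, (concatInput T (fun s => x s ω) t ⬝ᵥ v) ^ 2 ≤
        3 * N * ∑ q, v q ^ 2} ≤
      ENNReal.ofReal (144 * T ^ 2 * 201 ^ (2 * p) * Real.exp (-(N / (1280000 * T)))) := by
  have h1 := PFLS.measure_not_isometry_le h.iIndepFun_extInput h.measurable_extInput (N := N)
    (fun s hs => by rw [extInput, if_pos hs, h.map_input hs]) hT1 hT hN₁ hTN
  have e1 : ∀ ω, ∀ t ∈ Finset.Icc N₁ N, concatInput T (fun s => extInput N x s ω) t =
      concatInput T (fun s => x s ω) t := by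
    intro ω t ht
    ext q
    have := q.1.2
    rw [Finset.mem_Icc] at ht
    rw [concatInput, concatInput, extInput, if_pos (Finset.mem_Icc.2 ⟨by omega, by omega⟩)]
  have e2 : ∀ ω (v : Fin T × Fin p → ℝ), ∑ t ∈ Finset.Icc N₁ N,
      (concatInput T (fun s => extInput N x s ω) t ⬝ᵥ v) ^ 2 = ∑ t ∈ Finset.Icc N₁ N,
      (concatInput T (fun s => x s ω) t ⬝ᵥ v) ^ 2 := fun ω v =>
    Finset.sum_congr rfl fun t ht => by rw [e1 ω t ht]
  simpa only [e2] using h1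

/-- At lag `j` the input `u_{t-j}` is independent of `𝓕 (t - j - 1)`, which contains `𝓕 (t - T)`
because `j < T`. Shifting the filtration by the lag thus makes the features predictable. The shift
depends on `j`, so the lags are treated one at a time. -/
theorem IsSemiParametricModel.isGaussianTransform
    (h : IsSemiParametricModel P 𝓕 T N₁ N G x e k y) (hT : T ≤ N₁) {d j : ℕ} (hj : j < T)
    {z : Fin p → ℝ} (hz : ∑ q, z q ^ 2 = 1) {f : ℕ → Ω → Fin d → ℝ}
    (hf : ∀ t ∈ Finset.Icc N₁ N, Measurable[𝓕 (t - T)] (f t)) :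
    IsGaussianTransform P (fun i => 𝓕 (N₁ + i - j - 1)) (N + 1 - N₁)
      (fun i ω => z ⬝ᵥ x (N₁ + i - j) ω) (fun i => f (N₁ + i)) where
  le _ := 𝓕.le _
  mono a b hab := 𝓕.mono (by omega)
  measurable i hi := by
    have h1 := h.input_measurable (N₁ + i - j) (Finset.mem_Icc.2 ⟨by omega, by omega⟩)
    have e1 : N₁ + (i + 1) - j - 1 = N₁ + i - j := by omega
    change Measurable[𝓕 (N₁ + (i + 1) - j - 1)] _
    rw [e1]
    exact Finset.measurable_sum _ fun q _ => ((measurable_pi_apply q).comp h1).const_mul _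
  indep i hi := by
    have hs : N₁ + i - j ∈ Finset.Icc 1 N := Finset.mem_Icc.2 ⟨by omega, by omega⟩
    refine indep_of_indep_of_le_right (h.indep_input hs) ?_
    have : (fun ω => z ⬝ᵥ x (N₁ + i - j) ω) = (fun u => z ⬝ᵥ u) ∘ x (N₁ + i - j) := rfl
    rw [this, ← MeasurableSpace.comap_comp]
    refine MeasurableSpace.comap_mono ?_
    have : Measurable fun u : Fin p → ℝ => z ⬝ᵥ u := by simp only [dotProduct]; fun_prop
    exact this.comap_le
  law i hi := by
    have hs : N₁ + i - j ∈ Finset.Icc 1 N := Finset.mem_Icc.2 ⟨by omega, by omega⟩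
    have : (fun ω => z ⬝ᵥ x (N₁ + i - j) ω) = (fun u => ∑ q, z q * u q) ∘ x (N₁ + i - j) := rfl
    rw [this, ← Measure.map_map (by fun_prop) ((h.input_measurable _ hs).mono (𝓕.le _) le_rfl),
      h.map_input hs, map_dotProduct_stdNormal]
    congr 1
    rw [← NNReal.coe_inj]
    simpa using hz
  predictable i hi := (hf _ (Finset.mem_Icc.2 ⟨by omega, by omega⟩)).mono (𝓕.mono (by omega)) le_rfl

theorem sum_Icc_eq_sum_range {R : Type*} [AddCommMonoid R] {N₁ N : ℕ} (f : ℕ → R) :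
    ∑ t ∈ Finset.Icc N₁ N, f t = ∑ i ∈ Finset.range (N + 1 - N₁), f (N₁ + i) := by
  have : Finset.Icc N₁ N = Finset.Ico N₁ (N + 1) := by ext; simp
  rw [this, Finset.sum_Ico_eq_sum_range]

theorem transpose_mul_rowsMatrix {d : ℕ} (a : ℕ → Fin d → ℝ) :
    (rowsMatrix N₁ N a)ᵀ * rowsMatrix N₁ N a =
      ∑ t ∈ Finset.Icc N₁ N, Matrix.vecMulVec (a t) (a t) := by
  ext i j
  rw [Matrix.mul_apply, Matrix.sum_apply, ← Finset.sum_coe_sort (Finset.Icc N₁ N)]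
  rfl

/-- Self-normalized bound for the correlation of lagged inputs with predictable features. -/
theorem IsSemiParametricModel.self_normalized
    (h : IsSemiParametricModel P 𝓕 T N₁ N G x e k y) (hT : T ≤ N₁) {d j : ℕ} (hj : j < T)
    {z : Fin p → ℝ} (hz : ∑ q, z q ^ 2 = 1) {f : ℕ → Ω → Fin d → ℝ}
    (hf : ∀ t ∈ Finset.Icc N₁ N, Measurable[𝓕 (t - T)] (f t)) {ρ δ : ℝ} (hρ : 0 < ρ) (hδ : 0 < δ) :
    P {ω | ¬ ∀ χ : Fin d → ℝ,
      (∑ t ∈ Finset.Icc N₁ N, (z ⬝ᵥ x (t - j) ω) * (f t ω ⬝ᵥ χ)) ^ 2 ≤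
      (2 * Real.log (1 / δ) + Real.log (Matrix.det (1 + ρ⁻¹ • ((rowsMatrix N₁ N fun t => f t ω)ᵀ *
          rowsMatrix N₁ N fun t => f t ω)))) *
        (∑ t ∈ Finset.Icc N₁ N, (f t ω ⬝ᵥ χ) ^ 2 + ρ * (χ ⬝ᵥ χ))} ≤ ENNReal.ofReal δ := by
  have h1 := (h.isGaussianTransform hT hj hz hf).self_normalized hρ hδ
  refine le_trans (measure_mono fun ω hω => ?_) h1
  simp only [Set.mem_ofPred_eq] at hω ⊢
  contrapose! hω
  intro χ
  have hχ := hω χ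
  have e1 : mtrans (fun i ω => z ⬝ᵥ x (N₁ + i - j) ω) (fun i => f (N₁ + i)) (N + 1 - N₁) ω ⬝ᵥ χ =
      ∑ t ∈ Finset.Icc N₁ N, (z ⬝ᵥ x (t - j) ω) * (f t ω ⬝ᵥ χ) := by
    rw [mtrans, sum_Icc_eq_sum_range, sum_dotProduct]
    simp [smul_dotProduct]
  have e2 : gram ρ (fun i => f (N₁ + i)) (N + 1 - N₁) ω =
      ρ • (1 + ρ⁻¹ • ((rowsMatrix N₁ N fun t => f t ω)ᵀ * rowsMatrix N₁ N fun t => f t ω)) := by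
    rw [gram, transpose_mul_rowsMatrix, sum_Icc_eq_sum_range, smul_add, smul_smul,
      mul_inv_cancel₀ hρ.ne', one_smul]
  have e3 : (gram ρ (fun i => f (N₁ + i)) (N + 1 - N₁) ω).det / ρ ^ d =
      (1 + ρ⁻¹ • ((rowsMatrix N₁ N fun t => f t ω)ᵀ * rowsMatrix N₁ N fun t => f t ω)).det := by
    rw [e2, Matrix.det_smul, Fintype.card_fin, mul_div_cancel_left₀ _ (by positivity)]
  have e4 : χ ⬝ᵥ (gram ρ (fun i => f (N₁ + i)) (N + 1 - N₁) ω *ᵥ χ) =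
      ∑ t ∈ Finset.Icc N₁ N, (f t ω ⬝ᵥ χ) ^ 2 + ρ * (χ ⬝ᵥ χ) := by
    rw [gram, sum_Icc_eq_sum_range, Matrix.add_mulVec, Matrix.smul_mulVec, Matrix.one_mulVec,
      dotProduct_add, dotProduct_smul, Matrix.sum_mulVec, dotProduct_sum, add_comm, smul_eq_mul]
    congr 1
    refine Finset.sum_congr rfl fun i _ => ?_
    rw [Matrix.vecMulVec_mulVec, op_smul_eq_smul, dotProduct_smul, smul_eq_mul, sq,
      dotProduct_comm χ]
  rw [e1, e3, e4] at hχ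
  exact hχ

/-- Scalar version of the self-normalized bound. -/
theorem IsSemiParametricModel.self_normalized_scalar
    (h : IsSemiParametricModel P 𝓕 T N₁ N G x e k y) (hT : T ≤ N₁) {j : ℕ} (hj : j < T)
    {z : Fin p → ℝ} (hz : ∑ q, z q ^ 2 = 1) {f : ℕ → Ω → ℝ}
    (hf : ∀ t ∈ Finset.Icc N₁ N, Measurable[𝓕 (t - T)] (f t)) {ρ δ : ℝ} (hρ : 0 < ρ) (hδ : 0 < δ) :
    P {ω | ¬ (∑ t ∈ Finset.Icc N₁ N, (z ⬝ᵥ x (t - j) ω) * f t ω) ^ 2 ≤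
      (2 * Real.log (1 / δ) + Real.log (1 + ρ⁻¹ * ∑ t ∈ Finset.Icc N₁ N, f t ω ^ 2)) *
        (∑ t ∈ Finset.Icc N₁ N, f t ω ^ 2 + ρ)} ≤ ENNReal.ofReal δ := by
  have h1 := h.self_normalized hT hj hz (d := 1) (f := fun t ω _ => f t ω)
    (fun t ht => @measurable_pi_lambda Ω (Fin 1) (fun _ => ℝ) (𝓕 (t - T)) _ _ fun _ => hf t ht) hρ hδ
  refine le_trans (measure_mono fun ω hω => ?_) h1
  simp only [Set.mem_ofPred_eq] at hω ⊢
  contrapose! hω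
  have := hω 1
  rw [transpose_mul_rowsMatrix, Matrix.det_fin_one] at this
  simpa [Matrix.sum_apply, Matrix.vecMulVec_apply, ← sq, dotProduct] using this

end Model

/-! ### Least squares for one realization -/

section Euclid

/-- The Euclidean norm of a vector. -/
noncomputable def eucl {ι : Type*} [Fintype ι] (v : ι → ℝ) : ℝ := ‖WithLp.toLp 2 v‖

/-- The Euclidean norm of a sequence over the recorded times. -/
noncomputable def seqNorm (N₁ N : ℕ) (f : ℕ → ℝ) : ℝ := √(∑ t ∈ Finset.Icc N₁ N, f t ^ 2)

variable {ι κ : Type*} [Fintype ι] [Fintype κ]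

theorem eucl_nonneg (v : ι → ℝ) : 0 ≤ eucl v := norm_nonneg _

theorem eucl_sq (v : ι → ℝ) : eucl v ^ 2 = v ⬝ᵥ v := by
  rw [eucl, EuclideanSpace.norm_sq_eq]
  simp [dotProduct, sq]

theorem eucl_sq_eq_sum (v : ι → ℝ) : eucl v ^ 2 = ∑ i, v i ^ 2 := by
  rw [eucl_sq]; simp [dotProduct, sq]

theorem abs_dotProduct_le (v w : ι → ℝ) : |v ⬝ᵥ w| ≤ eucl v * eucl w := by
  refine abs_le_of_sq_le_sq ?_ (mul_nonneg (eucl_nonneg v) (eucl_nonneg w))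
  rw [mul_pow, eucl_sq_eq_sum, eucl_sq_eq_sum]
  exact Finset.sum_mul_sq_le_sq_mul_sq _ _ _

theorem eucl_add_le (v w : ι → ℝ) : eucl (v + w) ≤ eucl v + eucl w := by
  rw [eucl, WithLp.toLp_add]; exact norm_add_le _ _

theorem eucl_mulVec_le [DecidableEq ι] (A : Matrix κ ι ℝ) (v : ι → ℝ) :
    eucl (A *ᵥ v) ≤ ‖A‖ * eucl v := Matrix.l2_opNorm_mulVec A (WithLp.toLp 2 v)

theorem norm_transpose [DecidableEq ι] [DecidableEq κ] (A : Matrix κ ι ℝ) : ‖Aᵀ‖ = ‖A‖ := by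
  have := Matrix.l2_opNorm_conjTranspose A
  rwa [Matrix.conjTranspose_eq_transpose_of_trivial] at this

theorem norm_matrix_le [DecidableEq ι] [DecidableEq κ] (A : Matrix κ ι ℝ) {c : ℝ} (hc : 0 ≤ c)
    (h : ∀ v, eucl (A *ᵥ v) ≤ c * eucl v) : ‖A‖ ≤ c := by
  rw [Matrix.l2_opNorm_def]
  refine ContinuousLinearMap.opNorm_le_bound _ hc fun v => ?_
  exact h v.ofLp

variable {N₁ N : ℕ}

theorem seqNorm_nonneg (f : ℕ → ℝ) : 0 ≤ seqNorm N₁ N f := Real.sqrt_nonneg _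

theorem seqNorm_sq (f : ℕ → ℝ) : seqNorm N₁ N f ^ 2 = ∑ t ∈ Finset.Icc N₁ N, f t ^ 2 :=
  Real.sq_sqrt (Finset.sum_nonneg fun _ _ => sq_nonneg _)

theorem seqNorm_eq_eucl (f : ℕ → ℝ) : seqNorm N₁ N f = eucl fun t : Finset.Icc N₁ N => f t := by
  rw [← Real.sqrt_sq (eucl_nonneg _), eucl_sq_eq_sum, seqNorm,
    Finset.sum_coe_sort (Finset.Icc N₁ N) fun t => f t ^ 2]

theorem seqNorm_add_le (f g : ℕ → ℝ) :
    seqNorm N₁ N (fun t => f t + g t) ≤ seqNorm N₁ N f + seqNorm N₁ N g := by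
  simp only [seqNorm_eq_eucl]
  exact eucl_add_le _ _

theorem abs_sum_mul_le (f g : ℕ → ℝ) :
    |∑ t ∈ Finset.Icc N₁ N, f t * g t| ≤ seqNorm N₁ N f * seqNorm N₁ N g := by
  refine abs_le_of_sq_le_sq ?_ (mul_nonneg (seqNorm_nonneg f) (seqNorm_nonneg g))
  rw [mul_pow, seqNorm_sq, seqNorm_sq]
  exact Finset.sum_mul_sq_le_sq_mul_sq _ _ _

end Euclid

/-- Normal equations for regularized least squares. -/
theorem normal_equations {ι : Type*} [Fintype ι] {m N₁ N : ℕ} (X : ℕ → ι → ℝ) (Y : ℕ → Fin m → ℝ)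
    (c : ℝ) (φ : Matrix (Fin m) ι ℝ)
    (h : IsMinOn (fun ψ : Matrix (Fin m) ι ℝ =>
      (∑ t ∈ Finset.Icc N₁ N, ∑ i, (Y t i - (ψ *ᵥ X t) i) ^ 2) + c * ∑ i, ∑ j, ψ i j ^ 2)
      Set.univ φ) (w : Fin m → ℝ) (χ : ι → ℝ) :
    ∑ t ∈ Finset.Icc N₁ N, (w ⬝ᵥ (Y t - φ *ᵥ X t)) * (χ ⬝ᵥ X t) = c * ((φᵀ *ᵥ w) ⬝ᵥ χ) := by
  set D : Matrix (Fin m) ι ℝ := Matrix.vecMulVec w χ with hD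
  set a := ∑ t ∈ Finset.Icc N₁ N, ∑ i, ((D *ᵥ X t) i) ^ 2 + c * ∑ i, ∑ j, D i j ^ 2
  set b := ∑ t ∈ Finset.Icc N₁ N, ∑ i, (Y t i - (φ *ᵥ X t) i) * (D *ᵥ X t) i -
    c * ∑ i, ∑ j, φ i j * D i j with hb
  -- The objective along the rank-one line `φ + s w χᵀ` exceeds its minimum by `a s² - 2 b s`;
  -- nonpositive discriminant forces `b = 0`, which is the claim.
  have hquad : ∀ s : ℝ, 0 ≤ a * (s * s) + (-2 * b) * s + 0 := by
    intro s
    have h1 := h (Set.mem_univ (φ + s • D))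
    simp only [Set.mem_ofPred_eq] at h1
    have e1 : ∀ t i, (Y t i - ((φ + s • D) *ᵥ X t) i) ^ 2 = (Y t i - (φ *ᵥ X t) i) ^ 2 -
        2 * s * ((Y t i - (φ *ᵥ X t) i) * (D *ᵥ X t) i) + s ^ 2 * ((D *ᵥ X t) i) ^ 2 := by
      intro t i
      rw [Matrix.add_mulVec, Matrix.smul_mulVec, Pi.add_apply, Pi.smul_apply, smul_eq_mul]
      ring
    have e2 : ∀ i j, ((φ + s • D) i j) ^ 2 = φ i j ^ 2 + 2 * s * (φ i j * D i j) +
        s ^ 2 * D i j ^ 2 := by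
      intro i j
      rw [Matrix.add_apply, Matrix.smul_apply, smul_eq_mul]
      ring
    simp only [e1, e2, Finset.sum_add_distrib, Finset.sum_sub_distrib, ← Finset.mul_sum] at h1
    simp only [a, b]
    linarith
  have hdisc := discrim_le_zero hquad
  rw [discrim] at hdisc
  have hb0 : b = 0 := by nlinarith [sq_nonneg b]
  have e3 : ∀ t, ∑ i, (Y t i - (φ *ᵥ X t) i) * (D *ᵥ X t) i =
      (w ⬝ᵥ (Y t - φ *ᵥ X t)) * (χ ⬝ᵥ X t) := by
    intro t
    rw [hD, Matrix.vecMulVec_mulVec, op_smul_eq_smul, dotProduct.eq_def w, Finset.sum_mul]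
    refine Finset.sum_congr rfl fun i _ => ?_
    simp only [Pi.smul_apply, Pi.sub_apply, smul_eq_mul]
    ring
  have e4 : ∑ i, ∑ j, φ i j * D i j = (φᵀ *ᵥ w) ⬝ᵥ χ := by
    rw [Matrix.mulVec_transpose, ← Matrix.dotProduct_mulVec]
    simp only [dotProduct, Matrix.mulVec, Finset.mul_sum, hD, Matrix.vecMulVec_apply]
    exact Finset.sum_congr rfl fun i _ => Finset.sum_congr rfl fun j _ => by ring
  simp_rw [e3, e4] at hb
  linarith

section Realization

variable {m p L T N₁ N : ℕ} {G : Matrix (Fin m) (Fin T × Fin p) ℝ}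
  {u : ℕ → Fin p → ℝ} {e : ℕ → Fin m → ℝ} {k : ℕ → Fin L → ℝ} {y : ℕ → Fin m → ℝ}

theorem dotProduct_mulVec_eq {ι : Type*} [Fintype ι] (w : Fin m → ℝ) (A : Matrix (Fin m) ι ℝ)
    (v : ι → ℝ) : w ⬝ᵥ (A *ᵥ v) = (Aᵀ *ᵥ w) ⬝ᵥ v := by
  rw [Matrix.dotProduct_mulVec, ← Matrix.mulVec_transpose]

/-- Deviation of filtered least squares along `w`, given the correlation of the inputs with the
filtered errors. -/
theorem eucl_transpose_mulVec_le (hy : ∀ t ∈ Finset.Icc N₁ N, y t = G *ᵥ concatInput T u t + e t)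
    {φ : Matrix (Fin m) (Fin L) ℝ} {H : Matrix (Fin m) (Fin T × Fin p) ℝ}
    (hH : IsFilteredOLS T N₁ N φ u k y H) (hN : 0 < N)
    (hiso : ∀ v : Fin T × Fin p → ℝ,
      N / 2 * ∑ q, v q ^ 2 ≤ ∑ t ∈ Finset.Icc N₁ N, (concatInput T u t ⬝ᵥ v) ^ 2)
    (w : Fin m → ℝ) {c : ℝ} (hc0 : 0 ≤ c) (hc : ∀ v : Fin T × Fin p → ℝ,
      |∑ t ∈ Finset.Icc N₁ N, (v ⬝ᵥ concatInput T u t) * (w ⬝ᵥ e t - (φᵀ *ᵥ w) ⬝ᵥ k t)| ≤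
        c * eucl v) :
    eucl ((H - G)ᵀ *ᵥ w) ≤ 2 / N * c := by
  have hN' : (0 : ℝ) < N := by exact_mod_cast hN
  have h1 : IsMinOn (fun ψ : Matrix (Fin m) (Fin T × Fin p) ℝ =>
      (∑ t ∈ Finset.Icc N₁ N, ∑ i, ((y t - φ *ᵥ k t) i - (ψ *ᵥ concatInput T u t) i) ^ 2) +
        0 * ∑ i, ∑ j, ψ i j ^ 2) Set.univ H := by
    rw [IsFilteredOLS] at hH
    simpa only [zero_mul, add_zero, Pi.sub_apply] using hH
  set h := (H - G)ᵀ *ᵥ w with hh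
  -- Ordinary least squares is the case of penalty zero, tested in the error direction itself.
  have h2 := normal_equations _ _ _ _ h1 w h
  rw [zero_mul] at h2
  have h3 : ∀ t ∈ Finset.Icc N₁ N,
      (w ⬝ᵥ (y t - φ *ᵥ k t - H *ᵥ concatInput T u t)) * (h ⬝ᵥ concatInput T u t) =
      (h ⬝ᵥ concatInput T u t) * (w ⬝ᵥ e t - (φᵀ *ᵥ w) ⬝ᵥ k t) -
        (concatInput T u t ⬝ᵥ h) ^ 2 := by
    intro t ht
    have : (h ⬝ᵥ concatInput T u t) = w ⬝ᵥ (H *ᵥ concatInput T u t) -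
        w ⬝ᵥ (G *ᵥ concatInput T u t) := by
      rw [hh, ← dotProduct_mulVec_eq, Matrix.sub_mulVec, dotProduct_sub]
    rw [dotProduct_comm _ h, hy t ht, dotProduct_sub, dotProduct_sub, dotProduct_add,
      ← dotProduct_mulVec_eq w φ, this]
    ring
  rw [Finset.sum_congr rfl h3, Finset.sum_sub_distrib, sub_eq_zero] at h2
  have h4 := hiso h
  rw [← h2, ← eucl_sq_eq_sum] at h4
  have h5 := (abs_le.1 (hc h)).2
  rcases (eucl_nonneg h).eq_or_lt with h0 | h0
  · rw [← h0]; positivity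
  · have h6 : N / 2 * eucl h ≤ c := by nlinarith
    calc eucl h = 2 / N * (N / 2 * eucl h) := by field_simp
      _ ≤ 2 / N * c := by gcongr

/-- A linear functional of the concatenated inputs is controlled by its values on a net of
directions for each lag. -/
theorem abs_sum_concatInput_mul_le {S : Finset (EuclideanSpace ℝ (Fin p))}
    (hS : ∀ (F : Type) [SeminormedAddCommGroup F] [NormedSpace ℝ F]
      (A : EuclideanSpace ℝ (Fin p) →ₗ[ℝ] F) (c : ℝ), 0 ≤ c → (∀ z ∈ S, ‖A z‖ ≤ c) →
      ∀ x, ‖A x‖ ≤ 2 * c * ‖x‖) (f : ℕ → ℝ) {c : ℝ} (hc0 : 0 ≤ c)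
    (hc : ∀ j < T, ∀ z ∈ S, |∑ t ∈ Finset.Icc N₁ N, (z.ofLp ⬝ᵥ u (t - j)) * f t| ≤ c)
    (v : Fin T × Fin p → ℝ) :
    |∑ t ∈ Finset.Icc N₁ N, (v ⬝ᵥ concatInput T u t) * f t| ≤ 2 * c * √T * eucl v := by
  have h1 : ∀ j : Fin T, |∑ t ∈ Finset.Icc N₁ N, ((fun q => v (j, q)) ⬝ᵥ u (t - j)) * f t| ≤
      2 * c * eucl fun q => v (j, q) := by
    intro j
    let A : EuclideanSpace ℝ (Fin p) →ₗ[ℝ] ℝ :=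
      { toFun := fun z => ∑ t ∈ Finset.Icc N₁ N, (z.ofLp ⬝ᵥ u (t - j)) * f t
        map_add' := fun a b => by
          simp only [WithLp.ofLp_add, add_dotProduct, add_mul, Finset.sum_add_distrib]
        map_smul' := fun a b => by
          simp only [WithLp.ofLp_smul, smul_dotProduct, smul_eq_mul, mul_assoc, Finset.mul_sum,
            RingHom.id_apply] }
    exact hS ℝ A c hc0 (fun z hz => hc j j.2 z hz) (WithLp.toLp 2 fun q => v (j, q))
  have h2 : ∑ t ∈ Finset.Icc N₁ N, (v ⬝ᵥ concatInput T u t) * f t =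
      ∑ j : Fin T, ∑ t ∈ Finset.Icc N₁ N, ((fun q => v (j, q)) ⬝ᵥ u (t - j)) * f t := by
    rw [Finset.sum_comm]
    refine Finset.sum_congr rfl fun t _ => ?_
    rw [← Finset.sum_mul, dotProduct, Fintype.sum_prod_type]
    rfl
  rw [h2]
  -- Cauchy–Schwarz over the `T` lags replaces the sum of block norms by `√T` times the norm of `v`.
  refine (Finset.abs_sum_le_sum_abs _ _).trans ((Finset.sum_le_sum fun j _ => h1 j).trans ?_)
  rw [← Finset.mul_sum, mul_assoc (2 * c)]
  refine mul_le_mul_of_nonneg_left ?_ (by positivity)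
  refine le_trans (le_abs_self _) (abs_le_of_sq_le_sq ?_ (mul_nonneg (Real.sqrt_nonneg _)
    (eucl_nonneg v)))
  rw [mul_pow, Real.sq_sqrt (by positivity)]
  refine sq_sum_le_card_mul_sum_sq.trans (le_of_eq ?_)
  simp only [Finset.card_univ, Fintype.card_fin, eucl_sq_eq_sum, Fintype.sum_prod_type]

theorem rowsMatrix_mulVec {d : ℕ} (a : ℕ → Fin d → ℝ) (v : Fin d → ℝ) (t : Finset.Icc N₁ N) :
    (rowsMatrix N₁ N a *ᵥ v) t = a t ⬝ᵥ v := rfl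

theorem seqNorm_dotProduct_le {d : ℕ} (a : ℕ → Fin d → ℝ) (v : Fin d → ℝ) :
    seqNorm N₁ N (fun t => v ⬝ᵥ a t) ≤ ‖rowsMatrix N₁ N a‖ * eucl v := by
  rw [seqNorm_eq_eucl]
  refine le_trans (le_of_eq ?_) (eucl_mulVec_le _ _)
  congr 1
  ext t
  rw [rowsMatrix_mulVec, dotProduct_comm]

theorem seqNorm_residual_le (φ : Matrix (Fin m) (Fin L) ℝ) (w : Fin m → ℝ) :
    seqNorm N₁ N (fun t => w ⬝ᵥ e t - (φᵀ *ᵥ w) ⬝ᵥ k t) ≤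
      ‖rowsMatrix N₁ N e - rowsMatrix N₁ N k * φᵀ‖ * eucl w := by
  rw [seqNorm_eq_eucl]
  refine le_trans (le_of_eq ?_) (eucl_mulVec_le _ _)
  congr 1
  ext t
  rw [Matrix.sub_mulVec, ← Matrix.mulVec_mulVec, Pi.sub_apply, rowsMatrix_mulVec, rowsMatrix_mulVec,
    dotProduct_comm w, dotProduct_comm (k t)]

/-- The ridge filter compared with an arbitrary filter. Here `s` bounds the correlation of the
inputs with the features in the self-normalized sense. -/
theorem ridge_comparison (hy : ∀ t ∈ Finset.Icc N₁ N, y t = G *ᵥ concatInput T u t + e t)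
    {μ : ℝ} (hμ : 0 < μ) {φ' : Matrix (Fin m) (Fin L) ℝ} (hφ' : IsRidgeFilter N₁ N μ k y φ')
    {s : ℝ} (hs : ∀ (g : Fin T × Fin p → ℝ) (χ : Fin L → ℝ),
      |∑ t ∈ Finset.Icc N₁ N, (g ⬝ᵥ concatInput T u t) * (χ ⬝ᵥ k t)| ≤
        s * eucl g * √(seqNorm N₁ N (fun t => χ ⬝ᵥ k t) ^ 2 + μ ^ 2 * eucl χ ^ 2))
    (hs0 : 0 ≤ s) (φ : Matrix (Fin m) (Fin L) ℝ) {w : Fin m → ℝ} (hw : eucl w = 1) :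
    √(seqNorm N₁ N (fun t => (φ'ᵀ *ᵥ w - φᵀ *ᵥ w) ⬝ᵥ k t) ^ 2 +
      μ ^ 2 * eucl (φ'ᵀ *ᵥ w - φᵀ *ᵥ w) ^ 2) ≤
      s * ‖G‖ + (‖rowsMatrix N₁ N e - rowsMatrix N₁ N k * φᵀ‖ + μ * ‖φ‖) := by
  set χ := φ'ᵀ *ᵥ w - φᵀ *ᵥ w with hχ
  set X := √(seqNorm N₁ N (fun t => χ ⬝ᵥ k t) ^ 2 + μ ^ 2 * eucl χ ^ 2) with hX
  set r : ℕ → ℝ := fun t => w ⬝ᵥ e t - (φᵀ *ᵥ w) ⬝ᵥ k t with hr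
  have hXsq : X ^ 2 = seqNorm N₁ N (fun t => χ ⬝ᵥ k t) ^ 2 + μ ^ 2 * eucl χ ^ 2 :=
    Real.sq_sqrt (by positivity)
  have hX0 : 0 ≤ X := Real.sqrt_nonneg _
  have hX1 : seqNorm N₁ N (fun t => χ ⬝ᵥ k t) ≤ X := by
    refine Real.le_sqrt_of_sq_le ?_
    nlinarith [mul_nonneg (sq_nonneg μ) (sq_nonneg (eucl χ))]
  have hX2 : μ * eucl χ ≤ X := by
    refine Real.le_sqrt_of_sq_le ?_
    nlinarith [sq_nonneg (seqNorm N₁ N (fun t => χ ⬝ᵥ k t))]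
  -- Tested at the difference `χ` of the two filters, the normal equations express `X²` as the sum
  -- of an input correlation, a residual correlation and a penalty term, each at most a constant
  -- times `X`.
  have h1 := normal_equations k y (μ ^ 2) φ' hφ' w χ
  have h2 : ∀ t ∈ Finset.Icc N₁ N, (w ⬝ᵥ (y t - φ' *ᵥ k t)) * (χ ⬝ᵥ k t) =
      ((Gᵀ *ᵥ w) ⬝ᵥ concatInput T u t) * (χ ⬝ᵥ k t) + r t * (χ ⬝ᵥ k t) - (χ ⬝ᵥ k t) ^ 2 := by
    intro t ht
    have : χ ⬝ᵥ k t = w ⬝ᵥ (φ' *ᵥ k t) - (φᵀ *ᵥ w) ⬝ᵥ k t := by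
      rw [hχ, sub_dotProduct, dotProduct_mulVec_eq w φ']
    rw [hy t ht, dotProduct_sub, dotProduct_add, dotProduct_mulVec_eq w G, hr, this]
    ring
  rw [Finset.sum_congr rfl h2, Finset.sum_sub_distrib, Finset.sum_add_distrib,
    ← seqNorm_sq (fun t => χ ⬝ᵥ k t)] at h1
  have h3 : (φ'ᵀ *ᵥ w) ⬝ᵥ χ = (φᵀ *ᵥ w) ⬝ᵥ χ + eucl χ ^ 2 := by
    rw [eucl_sq, ← add_dotProduct, hχ, add_sub_cancel]
  have hG : eucl (Gᵀ *ᵥ w) ≤ ‖G‖ := by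
    have := eucl_mulVec_le Gᵀ w
    rwa [hw, mul_one, norm_transpose] at this
  have hφ : eucl (φᵀ *ᵥ w) ≤ ‖φ‖ := by
    have := eucl_mulVec_le φᵀ w
    rwa [hw, mul_one, norm_transpose] at this
  have h4 := (abs_le.1 (hs (Gᵀ *ᵥ w) χ)).2
  have h5 := (abs_le.1 (abs_sum_mul_le (N₁ := N₁) (N := N) r fun t => χ ⬝ᵥ k t)).2
  have h6 := (abs_le.1 (abs_dotProduct_le (φᵀ *ᵥ w) χ)).1
  have h7 : seqNorm N₁ N r ≤ ‖rowsMatrix N₁ N e - rowsMatrix N₁ N k * φᵀ‖ := by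
    have := seqNorm_residual_le (N₁ := N₁) (N := N) (e := e) (k := k) φ w
    rwa [hw, mul_one] at this
  have h8 : X ^ 2 ≤ (s * ‖G‖ + (‖rowsMatrix N₁ N e - rowsMatrix N₁ N k * φᵀ‖ + μ * ‖φ‖)) * X := by
    have a1 : s * eucl (Gᵀ *ᵥ w) * X ≤ s * ‖G‖ * X := by gcongr
    have a2 : seqNorm N₁ N r * seqNorm N₁ N (fun t => χ ⬝ᵥ k t) ≤
        ‖rowsMatrix N₁ N e - rowsMatrix N₁ N k * φᵀ‖ * X :=
      mul_le_mul h7 hX1 (seqNorm_nonneg _) (norm_nonneg _)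
    have a3 : μ ^ 2 * (eucl (φᵀ *ᵥ w) * eucl χ) ≤ μ * ‖φ‖ * X := by
      calc μ ^ 2 * (eucl (φᵀ *ᵥ w) * eucl χ) = μ * eucl (φᵀ *ᵥ w) * (μ * eucl χ) := by ring
        _ ≤ μ * ‖φ‖ * X := by
          have := eucl_nonneg χ
          gcongr
    have a4 : -(μ ^ 2 * ((φᵀ *ᵥ w) ⬝ᵥ χ)) ≤ μ ^ 2 * (eucl (φᵀ *ᵥ w) * eucl χ) := by
      nlinarith [sq_nonneg μ]
    rw [h3] at h1
    rw [hXsq]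
    linarith
  rcases hX0.eq_or_lt with h0 | h0
  · rw [← h0]; positivity
  · rw [sq] at h8
    exact le_of_mul_le_mul_right h8 h0

end Realization

/-! ### Determinants and logarithms -/

section Determinant

variable {d : ℕ}

theorem eigenvalues_one_add {A : Matrix (Fin d) (Fin d) ℝ} (hA : A.PosSemidef) :
    ∃ b : Fin d → ℝ, (∀ i, 0 ≤ b i) ∧ ∑ i, b i = A.trace ∧ (1 + A).det = ∏ i, (1 + b i) := by
  have hB : (1 + A).IsHermitian := Matrix.isHermitian_one.add hA.isHermitian
  refine ⟨fun i => hB.eigenvalues i - 1, fun i => ?_, ?_, ?_⟩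
  · have hv := hB.mulVec_eigenvectorBasis i
    set v : Fin d → ℝ := (hB.eigenvectorBasis i).ofLp with hvdef
    have hv1 : v ⬝ᵥ v = 1 := by
      have h1 : ‖hB.eigenvectorBasis i‖ = 1 := hB.eigenvectorBasis.orthonormal.1 i
      have : eucl v = 1 := h1
      rw [← eucl_sq, this, one_pow]
    have h2 := hA.dotProduct_mulVec_nonneg v
    simp only [star_trivial] at h2
    have h3 : v ⬝ᵥ ((1 + A) *ᵥ v) = hB.eigenvalues i * (v ⬝ᵥ v) := by
      rw [hv, dotProduct_smul, smul_eq_mul]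
    rw [Matrix.add_mulVec, Matrix.one_mulVec, dotProduct_add, hv1] at h3
    linarith
  · have := hB.trace_eq_sum_eigenvalues
    rw [Matrix.trace_add, Matrix.trace_one] at this
    simp only [Finset.sum_sub_distrib]
    simp at this ⊢
    linarith
  · have := hB.det_eq_prod_eigenvalues
    simp only [add_sub_cancel]
    simpa using this

/-- For nonnegative eigenvalues `bᵢ` of `A`, `1 + ∑ bᵢ ≤ ∏ (1 + bᵢ)`. -/
theorem one_add_trace_le_det {A : Matrix (Fin d) (Fin d) ℝ} (hA : A.PosSemidef) :
    1 + A.trace ≤ (1 + A).det := by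
  obtain ⟨b, hb, h1, h2⟩ := eigenvalues_one_add hA
  rw [← h1, h2]
  induction (Finset.univ : Finset (Fin d)) using Finset.induction_on with
  | empty => simp
  | insert i s hi ih =>
    rw [Finset.sum_insert hi, Finset.prod_insert hi]
    have := Finset.sum_nonneg fun j (_ : j ∈ s) => hb j
    nlinarith [hb i, mul_le_mul_of_nonneg_left ih (hb i)]

theorem det_le_exp_trace {A : Matrix (Fin d) (Fin d) ℝ} (hA : A.PosSemidef) :
    (1 + A).det ≤ Real.exp A.trace := by
  obtain ⟨b, hb, h1, h2⟩ := eigenvalues_one_add hA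
  rw [← h1, h2, Real.exp_sum]
  refine Finset.prod_le_prod (fun i _ => by linarith [hb i]) fun i _ => ?_
  rw [add_comm]
  exact Real.add_one_le_exp _

variable {N₁ N : ℕ}

theorem posSemidef_smul_gram {c : ℝ} (hc : 0 ≤ c) (a : ℕ → Fin d → ℝ) :
    (c • ((rowsMatrix N₁ N a)ᵀ * rowsMatrix N₁ N a)).PosSemidef := by
  refine Matrix.PosSemidef.smul ?_ hc
  have := Matrix.posSemidef_conjTranspose_mul_self (rowsMatrix N₁ N a)
  rwa [Matrix.conjTranspose_eq_transpose_of_trivial] at this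

theorem trace_gram (a : ℕ → Fin d → ℝ) :
    ((rowsMatrix N₁ N a)ᵀ * rowsMatrix N₁ N a).trace = ∑ t ∈ Finset.Icc N₁ N, a t ⬝ᵥ a t := by
  rw [transpose_mul_rowsMatrix, Matrix.trace_sum]
  refine Finset.sum_congr rfl fun t _ => ?_
  rw [Matrix.trace_vecMulVec]

theorem det_one_add_gram_comm (c : ℝ) (a : ℕ → Fin d → ℝ) :
    (1 + c • (rowsMatrix N₁ N a * (rowsMatrix N₁ N a)ᵀ)).det =
      (1 + c • ((rowsMatrix N₁ N a)ᵀ * rowsMatrix N₁ N a)).det := by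
  rw [← Matrix.smul_mul, Matrix.det_one_add_mul_comm, Matrix.mul_smul]

theorem one_le_det_gram {c : ℝ} (hc : 0 ≤ c) (a : ℕ → Fin d → ℝ) :
    1 ≤ (1 + c • ((rowsMatrix N₁ N a)ᵀ * rowsMatrix N₁ N a)).det := by
  have hA := posSemidef_smul_gram (N₁ := N₁) (N := N) hc a
  have := one_add_trace_le_det hA
  have := hA.trace_nonneg
  linarith

end Determinant

/-! ### Iterated logarithms, dyadic scales and the dimension `p̃`. -/

section Logarithms

theorem one_le_logPlus (x : ℝ) : 1 ≤ logPlus x := le_max_left _ _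

theorem log_le_logPlus (x : ℝ) : Real.log x ≤ logPlus x := le_max_right _ _

theorem one_le_lil (x : ℝ) : 1 ≤ lil x := le_max_left _ _

theorem log_mul_logPlus_le {x c b : ℝ} (hc : 0 < c) (hb : Real.log c ≤ b) (hb0 : 0 ≤ b) :
    Real.log (c * logPlus x) ≤ (b + 1) * lil x := by
  have h1 := one_le_logPlus x
  rw [Real.log_mul hc.ne' (by positivity)]
  have h2 : Real.log (logPlus x) ≤ lil x := log_le_logPlus _
  nlinarith [one_le_lil x]

theorem logPlus_affine_le {y : ℝ} (hy : 0 ≤ y) : logPlus (11 * y + 12) ≤ 5 * logPlus y := by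
  have h1 := one_le_logPlus y
  have h23 : Real.log 23 ≤ 4 := by
    rw [Real.log_le_iff_le_exp (by norm_num)]
    have : (2.7 : ℝ) ^ 4 ≤ Real.exp 1 ^ 4 := by
      have := Real.exp_one_gt_d9
      gcongr
      linarith
    rw [← Real.exp_nat_mul] at this
    norm_num at this ⊢
    linarith
  refine max_le (by linarith) ?_
  rcases le_total y 1 with h | h
  · calc Real.log (11 * y + 12) ≤ Real.log 23 := Real.log_le_log (by positivity) (by linarith)
      _ ≤ 5 * logPlus y := by linarith
  · calc Real.log (11 * y + 12) ≤ Real.log (23 * y) := Real.log_le_log (by positivity) (by linarith)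
      _ = Real.log 23 + Real.log y := Real.log_mul (by norm_num) (by positivity)
      _ ≤ 5 * logPlus y := by linarith [log_le_logPlus y]

theorem exists_two_pow_near {x : ℝ} (hx : 1 ≤ x) :
    ∃ a : ℕ, x ≤ 2 ^ a ∧ (2 : ℝ) ^ a ≤ 2 * x ∧ (a : ℝ) ≤ 5 / 2 * logPlus x := by
  obtain ⟨n, h1, h2⟩ := exists_nat_pow_near hx (one_lt_two (α := ℝ))
  refine ⟨n + 1, h2.le, by rw [pow_succ]; linarith, ?_⟩
  have h3 : n * Real.log 2 ≤ Real.log x := by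
    rw [← Real.log_pow]
    exact Real.log_le_log (by positivity) h1
  have := Real.log_two_gt_d9
  have h4 := log_le_logPlus x
  have h5 := one_le_logPlus x
  push_cast
  nlinarith [(Nat.cast_nonneg n : (0 : ℝ) ≤ n)]

theorem one_le_pTilde_aux {T p : ℕ} (hT : 1 ≤ T) (hp : 1 ≤ p) (h : 2 ≤ T * p) :
    1 ≤ min (T : ℝ) (Real.log (Real.exp 1 * T * p) ^ 2 * Real.log (T * p) ^ 2) ∧
    Real.log T ≤ min (T : ℝ) (Real.log (Real.exp 1 * T * p) ^ 2 * Real.log (T * p) ^ 2) := by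
  have hT' : (1 : ℝ) ≤ T := by exact_mod_cast hT
  have hp' : (1 : ℝ) ≤ p := by exact_mod_cast hp
  have h' : (2 : ℝ) ≤ T * p := by exact_mod_cast h
  have e : Real.log (Real.exp 1 * T * p) = 1 + Real.log (T * p) := by
    rw [mul_assoc, Real.log_mul (Real.exp_pos 1).ne' (by positivity), Real.log_exp]
  rw [e]
  set l := Real.log (T * p) with hl
  have hl2 : 0.69 ≤ l := by
    have h1 : Real.log 2 ≤ l := Real.log_le_log (by norm_num) h'
    have := Real.log_two_gt_d9
    linarith
  have hlT : Real.log T ≤ l := Real.log_le_log (by positivity) (by nlinarith)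
  have h3 : 1 ≤ (1 + l) ^ 2 * l := by nlinarith [sq_nonneg l]
  have h4 : l ≤ (1 + l) ^ 2 * l ^ 2 := by nlinarith
  have h5 : 1 ≤ (1 + l) ^ 2 * l ^ 2 := by
    have : (1.69 : ℝ) * 0.69 ≤ (1 + l) * l := by nlinarith
    nlinarith [mul_self_nonneg ((1 + l) * l)]
  exact ⟨le_min hT' h5, le_min ((Real.log_le_sub_one_of_pos (by positivity)).trans (by linarith))
    (hlT.trans h4)⟩

theorem pTilde_nonneg (T p : ℕ) : 0 ≤ pTilde T p := by unfold pTilde; positivity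

theorem one_le_pTilde {T p : ℕ} (hT : 1 ≤ T) (hp : 1 ≤ p) (h : 2 ≤ T * p) : 1 ≤ pTilde T p := by
  have hp' : (1 : ℝ) ≤ p := by exact_mod_cast hp
  have := (one_le_pTilde_aux hT hp h).1
  unfold pTilde
  nlinarith

/-- If `Tp ≥ 2`, the minimum in `p̃` is at least `1` and at least `log T`. The additive `1` is
needed for `T = p = 1`, where `p̃ = 0`. -/
theorem log_add_le_pTilde {T p : ℕ} (hT : 1 ≤ T) (hp : 1 ≤ p) :
    Real.log T + p ≤ 2 * pTilde T p + 1 := by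
  have hp' : (1 : ℝ) ≤ p := by exact_mod_cast hp
  by_cases h : 2 ≤ T * p
  · obtain ⟨h1, h2⟩ := one_le_pTilde_aux hT hp h
    unfold pTilde
    nlinarith
  · have h1 : T * p = 1 := by
      have := Nat.mul_pos hT hp
      omega
    have hT1 : T = 1 := Nat.eq_one_of_mul_eq_one_right h1
    have hp1 : p = 1 := Nat.eq_one_of_mul_eq_one_left h1
    have := pTilde_nonneg T p
    rw [hT1, hp1] at *
    simp
    linarith

end Logarithms

/-! ### The oracle inequality on the good event -/

section Good

variable {m p L T N₁ N : ℕ} {G : Matrix (Fin m) (Fin T × Fin p) ℝ}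
  {u : ℕ → Fin p → ℝ} {e : ℕ → Fin m → ℝ} {k : ℕ → Fin L → ℝ} {y : ℕ → Fin m → ℝ}

/-- A family `S` of unit vectors that controls every linear map up to a factor `2`. -/
structure IsNormingSet {d : ℕ} (S : Finset (EuclideanSpace ℝ (Fin d))) : Prop where
  norm_eq : ∀ z ∈ S, ‖z‖ = 1
  bound : ∀ (F : Type) [SeminormedAddCommGroup F] [NormedSpace ℝ F]
      (A : EuclideanSpace ℝ (Fin d) →ₗ[ℝ] F) (c : ℝ), 0 ≤ c → (∀ z ∈ S, ‖A z‖ ≤ c) →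
      ∀ x, ‖A x‖ ≤ 2 * c * ‖x‖

/-- Realizations on which the inputs are nearly isometric, and on which the correlations of the
inputs with the features and with the residuals of all filters in a net are controlled.
Here `a₀` stands for `log (1/δ)`. -/
structure IsGood (T N₁ N : ℕ) (μ a₀ : ℝ) (u : ℕ → Fin p → ℝ) (e : ℕ → Fin m → ℝ)
    (k : ℕ → Fin L → ℝ) (S : Finset (EuclideanSpace ℝ (Fin p)))
    (R : Finset (EuclideanSpace ℝ (Fin m))) (Λ : ℕ → Finset (EuclideanSpace ℝ (Fin L))) : Prop where
  iso : ∀ v : Fin T × Fin p → ℝ,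
    N / 2 * ∑ q, v q ^ 2 ≤ ∑ t ∈ Finset.Icc N₁ N, (concatInput T u t ⬝ᵥ v) ^ 2 ∧
      ∑ t ∈ Finset.Icc N₁ N, (concatInput T u t ⬝ᵥ v) ^ 2 ≤ 3 * N * ∑ q, v q ^ 2
  feature : ∀ j < T, ∀ z ∈ S, ∀ (i : ℕ) (χ : Fin L → ℝ),
    (∑ t ∈ Finset.Icc N₁ N, (z.ofLp ⬝ᵥ u (t - j)) * (k t ⬝ᵥ χ)) ^ 2 ≤
      (2 * (a₀ + Real.log T + 2 * p + i + 3) + Real.log (Matrix.det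
        (1 + (μ ^ 2 / 4 ^ i)⁻¹ • ((rowsMatrix N₁ N k)ᵀ * rowsMatrix N₁ N k)))) *
      (∑ t ∈ Finset.Icc N₁ N, (k t ⬝ᵥ χ) ^ 2 + μ ^ 2 / 4 ^ i * (χ ⬝ᵥ χ))
  residual : ∀ j < T, ∀ z ∈ S, ∀ w ∈ R, ∀ a : ℕ, ∀ ψ ∈ Λ a, ∀ i : ℕ,
    (∑ t ∈ Finset.Icc N₁ N, (z.ofLp ⬝ᵥ u (t - j)) * (w.ofLp ⬝ᵥ e t - ψ.ofLp ⬝ᵥ k t)) ^ 2 ≤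
      (2 * (a₀ + Real.log T + 2 * p + 2 * m + (L * (4 + 2 * a) + a) + 2 * Real.log (i + 1) + 4) +
        Real.log (1 + (μ ^ 2 * 4 ^ i)⁻¹ * ∑ t ∈ Finset.Icc N₁ N,
          (w.ofLp ⬝ᵥ e t - ψ.ofLp ⬝ᵥ k t) ^ 2)) *
      (∑ t ∈ Finset.Icc N₁ N, (w.ofLp ⬝ᵥ e t - ψ.ofLp ⬝ᵥ k t) ^ 2 + μ ^ 2 * 4 ^ i)

/-- The resolution `2ᵃ` exceeds both `o` and `√N ‖K‖ / μ²`: then `ψ` lies in the ball covered by the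
net at level `a`, and rounding `ψ` to it perturbs the correlation by a multiple of `μ`. For `L = 0`
the right-hand side of the last bound vanishes, so `a = 0` is forced. -/
theorem exists_resolution {μ o : ℝ} (hμ : 0 < μ) (ho : 0 ≤ o) {ψ : Fin L → ℝ}
    (hψ : μ * eucl ψ ≤ 11 * (o + 1)) :
    ∃ a : ℕ, eucl ψ ≤ 22 * 2 ^ a / μ ∧ √(N : ℝ) * ‖rowsMatrix N₁ N k‖ ≤ μ ^ 2 * 2 ^ a ∧
      (L : ℝ) * (4 + 2 * a) + a ≤
        12 * (L * logPlus (o + √(N : ℝ) * ‖rowsMatrix N₁ N k‖ / μ ^ 2)) := by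
  rcases Nat.eq_zero_or_pos L with hL | hL
  · subst hL
    refine ⟨0, ?_, ?_, by simp⟩
    · have h0 : eucl ψ = 0 := by
        rw [Subsingleton.elim ψ 0, eucl, WithLp.toLp_zero, norm_zero]
      rw [h0]
      positivity
    · have : rowsMatrix N₁ N k = 0 := by ext i j; exact j.elim0
      rw [this, norm_zero, mul_zero]
      positivity
  · set A := o + √(N : ℝ) * ‖rowsMatrix N₁ N k‖ / μ ^ 2 with hA
    have hκ : 0 ≤ √(N : ℝ) * ‖rowsMatrix N₁ N k‖ / μ ^ 2 := by positivity
    obtain ⟨a, h1, -, h2⟩ := exists_two_pow_near (le_max_left 1 A)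
    have h3 : logPlus (max 1 A) ≤ logPlus A := by
      refine max_le (one_le_logPlus _) ?_
      rcases le_total 1 A with h | h
      · rw [max_eq_right h]; exact log_le_logPlus _
      · rw [max_eq_left h, Real.log_one]; linarith [one_le_logPlus A]
    have h4 : 1 ≤ (2 : ℝ) ^ a := (le_max_left _ _).trans h1
    have h5 : A ≤ 2 ^ a := (le_max_right _ _).trans h1
    have hL' : (1 : ℝ) ≤ L := by exact_mod_cast hL
    refine ⟨a, ?_, ?_, ?_⟩
    · rw [le_div_iff₀ hμ]; linarith
    · have h6 : √(N : ℝ) * ‖rowsMatrix N₁ N k‖ / μ ^ 2 ≤ 2 ^ a := by linarith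
      rw [div_le_iff₀ (by positivity)] at h6
      linarith
    · have h7 : (a : ℝ) ≤ 5 / 2 * logPlus A := h2.trans (by linarith)
      have h8 := one_le_logPlus A
      have ha : (0 : ℝ) ≤ a := Nat.cast_nonneg a
      nlinarith

/-- The index of the dyadic scale of the residual is of order `log (o/μ)`, so a weight polynomial in
the index costs only its logarithm. -/
theorem log_scale_le {μ o : ℝ} (hμ : 0 < μ) (ho : 0 ≤ o) {i : ℕ}
    (hi : (i : ℝ) ≤ 5 / 2 * logPlus (11 * (o / μ) + 12)) :
    Real.log (i + 1) ≤ 4 * lil (o / μ) := by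
  have h1 := logPlus_affine_le (y := o / μ) (by positivity)
  have h2 := one_le_logPlus (o / μ)
  have h14 : Real.log 14 ≤ 3 := by
    rw [Real.log_le_iff_le_exp (by norm_num)]
    have : (2.7 : ℝ) ^ 3 ≤ Real.exp 1 ^ 3 := by
      have := Real.exp_one_gt_d9
      gcongr
      linarith
    rw [← Real.exp_nat_mul] at this
    norm_num at this ⊢
    linarith
  calc Real.log (i + 1) ≤ Real.log (14 * logPlus (o / μ)) :=
        Real.log_le_log (by positivity) (by linarith)
    _ ≤ (3 + 1) * lil (o / μ) := log_mul_logPlus_le (by norm_num) h14 (by norm_num)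
    _ = _ := by ring

theorem dEff_ge_one {μ o : ℝ} : 1 ≤ dEff m p T N₁ N μ k o := by
  have h1 := pTilde_nonneg T p
  have h2 := one_le_lil (o / μ)
  have h3 := one_le_logPlus (o + √(N : ℝ) * ‖rowsMatrix N₁ N k‖ / μ ^ 2)
  unfold dEff
  have : (0 : ℝ) ≤ L * logPlus (o + √(N : ℝ) * ‖rowsMatrix N₁ N k‖ / μ ^ 2) := by positivity
  have : (0 : ℝ) ≤ m := Nat.cast_nonneg m
  linarith

theorem seqNorm_concatInput_le {S : Finset (EuclideanSpace ℝ (Fin p))}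
    {R : Finset (EuclideanSpace ℝ (Fin m))} {Λ : ℕ → Finset (EuclideanSpace ℝ (Fin L))} {μ a₀ : ℝ}
    (hg : IsGood T N₁ N μ a₀ u e k S R Λ) (v : Fin T × Fin p → ℝ) :
    seqNorm N₁ N (fun t => v ⬝ᵥ concatInput T u t) ≤ 2 * √(N : ℝ) * eucl v := by
  have h := (hg.iso v).2
  refine le_trans (le_abs_self _) (abs_le_of_sq_le_sq ?_
    (mul_nonneg (by positivity) (eucl_nonneg v)))
  rw [seqNorm_sq, mul_pow, mul_pow, Real.sq_sqrt (by positivity), eucl_sq_eq_sum]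
  simp only [dotProduct_comm v]
  have : (0 : ℝ) ≤ N * ∑ q, v q ^ 2 :=
    mul_nonneg (by positivity) (Finset.sum_nonneg fun _ _ => sq_nonneg _)
  linarith

set_option maxHeartbeats 1000000 in
/-- Uniform control of the correlation of the inputs with the residual of a bounded filter. -/
theorem IsGood.abs_sum_residual_le {S : Finset (EuclideanSpace ℝ (Fin p))}
    {R : Finset (EuclideanSpace ℝ (Fin m))} {Λ : ℕ → Finset (EuclideanSpace ℝ (Fin L))} {μ a₀ : ℝ}
    (hg : IsGood T N₁ N μ a₀ u e k S R Λ) (hS : IsNormingSet S)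
    (hΛ : ∀ a : ℕ, ∀ ψ : EuclideanSpace ℝ (Fin L), ‖ψ‖ ≤ 22 * 2 ^ a / μ →
      ∃ ψ' ∈ Λ a, ‖ψ - ψ'‖ ≤ 1 / (μ * 2 ^ a))
    (hT : 1 ≤ T) (hp : 1 ≤ p) (hN : 1 ≤ N) (hμ : 0 < μ) (ha₀ : 0 ≤ a₀) {o : ℝ} (ho : 0 ≤ o)
    {w : EuclideanSpace ℝ (Fin m)} (hw : w ∈ R) {ψ : Fin L → ℝ}
    (hf : seqNorm N₁ N (fun t => w.ofLp ⬝ᵥ e t - ψ ⬝ᵥ k t) ≤ 11 * (o + μ))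
    (hψ : μ * eucl ψ ≤ 11 * (o + 1)) (v : Fin T × Fin p → ℝ) :
    |∑ t ∈ Finset.Icc N₁ N, (v ⬝ᵥ concatInput T u t) * (w.ofLp ⬝ᵥ e t - ψ ⬝ᵥ k t)| ≤
      386 * (o + μ) * √(T * (a₀ + dEff m p T N₁ N μ k o)) * eucl v := by
  have hT' : (1 : ℝ) ≤ T := by exact_mod_cast hT
  have hN' : (1 : ℝ) ≤ N := by exact_mod_cast hN
  have hsN : 1 ≤ √(N : ℝ) := Real.one_le_sqrt.2 hN'
  set κ := ‖rowsMatrix N₁ N k‖ with hκ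
  have hκ0 : 0 ≤ κ := norm_nonneg _
  set D := a₀ + dEff m p T N₁ N μ k o with hD
  have hD1 : 1 ≤ D := by
    have := dEff_ge_one (m := m) (p := p) (T := T) (N₁ := N₁) (N := N) (k := k) (μ := μ) (o := o)
    linarith
  obtain ⟨a, ha1, ha2, ha3⟩ := exists_resolution (N₁ := N₁) (N := N) (k := k) hμ ho hψ
  obtain ⟨ψ', hψ', hr⟩ := hΛ a (WithLp.toLp 2 ψ) ha1
  set ζ : Fin L → ℝ := ψ - ψ'.ofLp with hζ
  have hr' : eucl ζ ≤ 1 / (μ * 2 ^ a) := hr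
  have hζ0 := eucl_nonneg ζ
  have hκr : √(N : ℝ) * (κ * eucl ζ) ≤ μ := by
    calc √(N : ℝ) * (κ * eucl ζ) = (√(N : ℝ) * κ) * eucl ζ := by ring
      _ ≤ (μ ^ 2 * 2 ^ a) * (1 / (μ * 2 ^ a)) := by gcongr
      _ = μ := by field_simp
  set f' : ℕ → ℝ := fun t => w.ofLp ⬝ᵥ e t - ψ'.ofLp ⬝ᵥ k t with hf'
  have hsplit : ∀ t, f' t = (w.ofLp ⬝ᵥ e t - ψ ⬝ᵥ k t) + ζ ⬝ᵥ k t := by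
    intro t
    rw [hf', hζ, sub_dotProduct]
    ring
  have hζk : seqNorm N₁ N (fun t => ζ ⬝ᵥ k t) ≤ κ * eucl ζ := seqNorm_dotProduct_le k ζ
  have hκμ : κ * eucl ζ ≤ μ := by
    have : 0 ≤ κ * eucl ζ := by positivity
    nlinarith
  set B := 11 * (o / μ) + 12 with hB
  have hoμ : 0 ≤ o / μ := by positivity
  have hμB : μ * B = 11 * (o + μ) + μ := by rw [hB]; field_simp; ring
  have hf'norm : seqNorm N₁ N f' ≤ μ * B := by
    have : seqNorm N₁ N f' = seqNorm N₁ N (fun t => (w.ofLp ⬝ᵥ e t - ψ ⬝ᵥ k t) + ζ ⬝ᵥ k t) := by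
      congr 1; ext t; exact hsplit t
    rw [this, hμB]
    exact (seqNorm_add_le _ _).trans (add_le_add hf (hζk.trans hκμ))
  -- The ridge parameter `ρ = μ² 4ⁱ` is matched to the residual: it dominates the squared norm, so
  -- the logarithmic term is at most `1`, and it exceeds the bound `(μ B)²` by at most a factor `4`.
  obtain ⟨i, hi1, hi2, hi3⟩ := exists_two_pow_near (x := B) (by rw [hB]; linarith)
  have hlogi := log_scale_le hμ ho hi3
  set ρ := μ ^ 2 * 4 ^ i with hρ
  have h4i : (4 : ℝ) ^ i = (2 ^ i) ^ 2 := by rw [← pow_mul, mul_comm, pow_mul]; norm_num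
  have hρ' : ρ = (μ * 2 ^ i) ^ 2 := by rw [hρ, h4i, mul_pow]
  have hρ0 : 0 < ρ := by positivity
  have hsum : ∑ t ∈ Finset.Icc N₁ N, f' t ^ 2 ≤ ρ := by
    rw [← seqNorm_sq, hρ']
    have : μ * B ≤ μ * 2 ^ i := by gcongr
    exact pow_le_pow_left₀ (seqNorm_nonneg _) (hf'norm.trans this) 2
  have hsum0 : 0 ≤ ∑ t ∈ Finset.Icc N₁ N, f' t ^ 2 := Finset.sum_nonneg fun _ _ => sq_nonneg _
  have hlog1 : Real.log (1 + ρ⁻¹ * ∑ t ∈ Finset.Icc N₁ N, f' t ^ 2) ≤ 1 := by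
    have h1 : ρ⁻¹ * ∑ t ∈ Finset.Icc N₁ N, f' t ^ 2 ≤ 1 := by
      rw [inv_mul_le_iff₀ hρ0]; linarith
    refine (Real.log_le_sub_one_of_pos (by positivity)).trans ?_
    linarith
  -- The constant is `√(31 · 2 · 24²) ≤ 192`.
  have hc : ∀ j < T, ∀ z ∈ S,
      |∑ t ∈ Finset.Icc N₁ N, (z.ofLp ⬝ᵥ u (t - j)) * f' t| ≤ 192 * (o + μ) * √D := by
    intro j hj z hz
    refine abs_le_of_sq_le_sq ?_ (by positivity)
    refine (hg.residual j hj z hz w hw a ψ' hψ' i).trans ?_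
    rw [mul_pow, Real.sq_sqrt (by linarith)]
    have h1 : 2 * (a₀ + Real.log T + 2 * p + 2 * m + (L * (4 + 2 * a) + a) +
        2 * Real.log (i + 1) + 4) + Real.log (1 + (μ ^ 2 * 4 ^ i)⁻¹ * ∑ t ∈ Finset.Icc N₁ N,
          f' t ^ 2) ≤ 31 * D := by
      have h2 := log_add_le_pTilde hT hp
      have hp0 : (p : ℝ) ≤ 2 * pTilde T p + 1 := by
        have : 0 ≤ Real.log T := Real.log_nonneg hT'
        linarith
      have h3 := one_le_lil (o / μ)
      have h4 := pTilde_nonneg T p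
      have h5 : (0 : ℝ) ≤ m := Nat.cast_nonneg m
      have h6 := one_le_logPlus (o + √(N : ℝ) * κ / μ ^ 2)
      have h7 : (0 : ℝ) ≤ L * logPlus (o + √(N : ℝ) * κ / μ ^ 2) := by positivity
      rw [hD, dEff]
      linarith
    have h8 : ∑ t ∈ Finset.Icc N₁ N, f' t ^ 2 + μ ^ 2 * 4 ^ i ≤ 2 * (24 * (o + μ)) ^ 2 := by
      have h9 : μ * 2 ^ i ≤ 24 * (o + μ) := by
        calc μ * 2 ^ i ≤ μ * (2 * B) := by gcongr
          _ = 2 * (μ * B) := by ring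
          _ ≤ 24 * (o + μ) := by rw [hμB]; linarith
      have h10 : ρ ≤ (24 * (o + μ)) ^ 2 := by rw [hρ']; gcongr
      linarith
    refine (mul_le_mul h1 h8 (by positivity) (by positivity)).trans ?_
    have : 0 ≤ (o + μ) ^ 2 * D := by positivity
    nlinarith
  have hmain := abs_sum_concatInput_mul_le (T := T) (N₁ := N₁) (N := N) (u := u) hS.bound f'
    (by positivity) hc v
  have hrest := (abs_sum_mul_le (N₁ := N₁) (N := N) (fun t => v ⬝ᵥ concatInput T u t)
    fun t => ζ ⬝ᵥ k t).trans
    (mul_le_mul (seqNorm_concatInput_le hg v) hζk (seqNorm_nonneg _)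
      (mul_nonneg (by positivity) (eucl_nonneg v)))
  have e1 : ∑ t ∈ Finset.Icc N₁ N, (v ⬝ᵥ concatInput T u t) * (w.ofLp ⬝ᵥ e t - ψ ⬝ᵥ k t) =
      ∑ t ∈ Finset.Icc N₁ N, (v ⬝ᵥ concatInput T u t) * f' t -
      ∑ t ∈ Finset.Icc N₁ N, (v ⬝ᵥ concatInput T u t) * (ζ ⬝ᵥ k t) := by
    rw [← Finset.sum_sub_distrib]
    refine Finset.sum_congr rfl fun t _ => ?_
    rw [hsplit]
    ring
  rw [e1]
  refine (abs_sub _ _).trans ((add_le_add hmain hrest).trans ?_)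
  have hv := eucl_nonneg v
  rw [Real.sqrt_mul (by positivity)]
  -- The rounding error is at most `2 μ ‖v‖`, and `TD ≥ 1` lets the main term absorb it.
  have hTD : 1 ≤ √(T : ℝ) * √D := by
    have h1 := Real.one_le_sqrt.2 hT'
    have h2 := Real.one_le_sqrt.2 hD1
    nlinarith
  have h1 : 2 * √(N : ℝ) * eucl v * (κ * eucl ζ) ≤ 2 * (o + μ) * (√T * √D) * eucl v := by
    have h3 : √(N : ℝ) * (κ * eucl ζ) ≤ (o + μ) * (√T * √D) :=
      (hκr.trans (by linarith)).trans (le_mul_of_one_le_right (by positivity) hTD)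
    have h4 := mul_le_mul_of_nonneg_right h3 (mul_nonneg zero_le_two hv)
    linarith
  linarith

end Good

/-! ### From correlations to the ridge filter and the final estimate. -/

section Conclusion

variable {m p L T N₁ N : ℕ} {G : Matrix (Fin m) (Fin T × Fin p) ℝ}
  {u : ℕ → Fin p → ℝ} {e : ℕ → Fin m → ℝ} {k : ℕ → Fin L → ℝ} {y : ℕ → Fin m → ℝ}
  {S : Finset (EuclideanSpace ℝ (Fin p))} {R : Finset (EuclideanSpace ℝ (Fin m))}
  {Λ : ℕ → Finset (EuclideanSpace ℝ (Fin L))} {μ a₀ : ℝ}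

theorem Opt_nonneg (hμ : 0 < μ) : 0 ≤ Opt N₁ N μ e k :=
  le_ciInf fun _ => by positivity

theorem exists_filter_near_Opt {ε : ℝ} (hε : 0 < ε) :
    ∃ φ : Matrix (Fin m) (Fin L) ℝ,
      ‖rowsMatrix N₁ N e - rowsMatrix N₁ N k * φᵀ‖ + μ * ‖φ‖ < Opt N₁ N μ e k + ε :=
  exists_lt_of_ciInf_lt (lt_add_of_pos_right _ hε)

/-- Passing to the infimum in an inequality valid for every filter dispenses with a minimizer of
`Opt`. -/
theorem le_two_mul_Opt_add {b c : ℝ} (h : ∀ φ : Matrix (Fin m) (Fin L) ℝ,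
    c ≤ 2 * (‖rowsMatrix N₁ N e - rowsMatrix N₁ N k * φᵀ‖ + μ * ‖φ‖) + b) :
    c ≤ 2 * Opt N₁ N μ e k + b := by
  have : (c - b) / 2 ≤ Opt N₁ N μ e k := le_ciInf fun φ => by linarith [h φ]
  linarith

/-- Residual and size of the ridge filter in terms of the optimal filter. -/
theorem ridge_bounds (hy : ∀ t ∈ Finset.Icc N₁ N, y t = G *ᵥ concatInput T u t + e t)
    (hμ : 0 < μ) {φ' : Matrix (Fin m) (Fin L) ℝ} (hφ' : IsRidgeFilter N₁ N μ k y φ')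
    {s : ℝ} (hs : ∀ (g : Fin T × Fin p → ℝ) (χ : Fin L → ℝ),
      |∑ t ∈ Finset.Icc N₁ N, (g ⬝ᵥ concatInput T u t) * (χ ⬝ᵥ k t)| ≤
        s * eucl g * √(seqNorm N₁ N (fun t => χ ⬝ᵥ k t) ^ 2 + μ ^ 2 * eucl χ ^ 2))
    (hs0 : 0 ≤ s) {w : Fin m → ℝ} (hw : eucl w = 1) :
    seqNorm N₁ N (fun t => w ⬝ᵥ e t - (φ'ᵀ *ᵥ w) ⬝ᵥ k t) ≤ 2 * Opt N₁ N μ e k + s * ‖G‖ ∧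
      μ * eucl (φ'ᵀ *ᵥ w) ≤ 2 * Opt N₁ N μ e k + s * ‖G‖ := by
  have key : ∀ φ : Matrix (Fin m) (Fin L) ℝ,
      seqNorm N₁ N (fun t => w ⬝ᵥ e t - (φ'ᵀ *ᵥ w) ⬝ᵥ k t) ≤
        2 * (‖rowsMatrix N₁ N e - rowsMatrix N₁ N k * φᵀ‖ + μ * ‖φ‖) + s * ‖G‖ ∧
      μ * eucl (φ'ᵀ *ᵥ w) ≤
        2 * (‖rowsMatrix N₁ N e - rowsMatrix N₁ N k * φᵀ‖ + μ * ‖φ‖) + s * ‖G‖ := by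
    intro φ
    have hX := ridge_comparison hy hμ hφ' hs hs0 φ hw
    set χ := φ'ᵀ *ᵥ w - φᵀ *ᵥ w with hχ
    set X := √(seqNorm N₁ N (fun t => χ ⬝ᵥ k t) ^ 2 + μ ^ 2 * eucl χ ^ 2)
    have hX1 : seqNorm N₁ N (fun t => χ ⬝ᵥ k t) ≤ X := by
      refine Real.le_sqrt_of_sq_le ?_
      nlinarith [mul_nonneg (sq_nonneg μ) (sq_nonneg (eucl χ))]
    have hX2 : μ * eucl χ ≤ X := by
      refine Real.le_sqrt_of_sq_le ?_
      nlinarith [sq_nonneg (seqNorm N₁ N (fun t => χ ⬝ᵥ k t))]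
    have hr := seqNorm_residual_le (N₁ := N₁) (N := N) (e := e) (k := k) φ w
    have hφ := eucl_mulVec_le φᵀ w
    rw [hw, mul_one] at hr hφ
    rw [norm_transpose] at hφ
    have hn : 0 ≤ ‖rowsMatrix N₁ N e - rowsMatrix N₁ N k * φᵀ‖ := norm_nonneg _
    have hn' : 0 ≤ μ * ‖φ‖ := by positivity
    constructor
    · have h1 := seqNorm_add_le (N₁ := N₁) (N := N) (fun t => w ⬝ᵥ e t - (φᵀ *ᵥ w) ⬝ᵥ k t)
        (fun t => -(χ ⬝ᵥ k t))
      have h2 : (fun t => w ⬝ᵥ e t - (φᵀ *ᵥ w) ⬝ᵥ k t + -(χ ⬝ᵥ k t)) =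
          fun t => w ⬝ᵥ e t - (φ'ᵀ *ᵥ w) ⬝ᵥ k t := by
        funext t
        rw [hχ, sub_dotProduct]
        ring
      have h3 : seqNorm N₁ N (fun t => -(χ ⬝ᵥ k t)) = seqNorm N₁ N (fun t => χ ⬝ᵥ k t) := by
        simp only [seqNorm, neg_sq]
      rw [h2, h3] at h1
      linarith
    · have h1 := eucl_add_le (φᵀ *ᵥ w) χ
      rw [hχ, add_sub_cancel, ← hχ] at h1
      have h2 := mul_le_mul_of_nonneg_left (h1.trans (add_le_add_left hφ _)) hμ.le
      linarith
  exact ⟨le_two_mul_Opt_add fun φ => (key φ).1, le_two_mul_Opt_add fun φ => (key φ).2⟩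

/-- The self-normalized bound produces the determinant of `KᵀK`, while `Ovfit` is stated with that
of `K Kᵀ`; Sylvester's identity equates them. -/
theorem log_det_gram_eq (μ : ℝ) (k : ℕ → Fin L → ℝ) :
    Real.log (1 + (μ ^ 2)⁻¹ • ((rowsMatrix N₁ N k)ᵀ * rowsMatrix N₁ N k)).det =
      2 * Real.log (√(1 + (μ ^ 2)⁻¹ • (rowsMatrix N₁ N k * (rowsMatrix N₁ N k)ᵀ)).det) := by
  have h := one_le_det_gram (N₁ := N₁) (N := N) (inv_nonneg.2 (sq_nonneg μ)) k
  rw [det_one_add_gram_comm, Real.log_sqrt (by linarith)]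
  ring

theorem log_sqrt_det_nonneg (μ : ℝ) (k : ℕ → Fin L → ℝ) :
    0 ≤ Real.log (√(1 + (μ ^ 2)⁻¹ • (rowsMatrix N₁ N k * (rowsMatrix N₁ N k)ᵀ)).det) := by
  have h1 := log_det_gram_eq (N₁ := N₁) (N := N) μ k
  have h2 := Real.log_nonneg (one_le_det_gram (N₁ := N₁) (N := N) (inv_nonneg.2 (sq_nonneg μ)) k)
  linarith

/-- The correlation of the inputs with the features, at one scale. -/
theorem IsGood.abs_sum_feature_le (hg : IsGood T N₁ N μ a₀ u e k S R Λ) (hS : IsNormingSet S)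
    (i : ℕ) {q : ℝ} (hq0 : 0 ≤ q)
    (hq : 2 * (a₀ + Real.log T + 2 * p + i + 3) + Real.log (Matrix.det
        (1 + (μ ^ 2 / 4 ^ i)⁻¹ • ((rowsMatrix N₁ N k)ᵀ * rowsMatrix N₁ N k))) ≤ q)
    (g : Fin T × Fin p → ℝ) (χ : Fin L → ℝ) :
    |∑ t ∈ Finset.Icc N₁ N, (g ⬝ᵥ concatInput T u t) * (χ ⬝ᵥ k t)| ≤
      2 * (√q * √(seqNorm N₁ N (fun t => χ ⬝ᵥ k t) ^ 2 + μ ^ 2 / 4 ^ i * eucl χ ^ 2)) *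
        √T * eucl g := by
  refine abs_sum_concatInput_mul_le hS.bound _ (by positivity) (fun j hj z hz => ?_) g
  have h := hg.feature j hj z hz i χ
  rw [← Real.sqrt_mul hq0]
  refine Real.abs_le_sqrt ?_
  rw [seqNorm_sq, eucl_sq]
  simp only [dotProduct_comm χ] at h ⊢
  refine h.trans (mul_le_mul_of_nonneg_right hq ?_)
  have h1 : 0 ≤ ∑ t ∈ Finset.Icc N₁ N, (k t ⬝ᵥ χ) ^ 2 := Finset.sum_nonneg fun _ _ => sq_nonneg _
  have h2 : 0 ≤ χ ⬝ᵥ χ := by rw [← eucl_sq]; positivity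
  positivity

theorem IsGood.abs_sum_le_of_half_le (hg : IsGood T N₁ N μ a₀ u e k S R Λ) (hS : IsNormingSet S)
    (hT : 1 ≤ T) (hp : 1 ≤ p) (ha₀ : 0 ≤ a₀) {D : ℝ}
    (hD : D = a₀ + pTilde T p +
      Real.log (√(1 + (μ ^ 2)⁻¹ • (rowsMatrix N₁ N k * (rowsMatrix N₁ N k)ᵀ)).det))
    (hD2 : 1 / 2 ≤ D) (g : Fin T × Fin p → ℝ) (χ : Fin L → ℝ) :
    |∑ t ∈ Finset.Icc N₁ N, (g ⬝ᵥ concatInput T u t) * (χ ⬝ᵥ k t)| ≤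
      11 * min √N (√T * √D) * eucl g *
        √(seqNorm N₁ N (fun t => χ ⬝ᵥ k t) ^ 2 + μ ^ 2 * eucl χ ^ 2) := by
  set X := √(seqNorm N₁ N (fun t => χ ⬝ᵥ k t) ^ 2 + μ ^ 2 * eucl χ ^ 2) with hX
  have hX0 : 0 ≤ X := Real.sqrt_nonneg _
  have hg0 := eucl_nonneg g
  -- The `√N` branch is Cauchy–Schwarz with the upper isometry bound; the other is the
  -- self-normalized bound at scale `0`, where `D ≥ 1/2` absorbs the additive constants into `28 D`.
  rcases min_choice √(N : ℝ) (√T * √D) with h | h <;> rw [h]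
  · have hX1 : seqNorm N₁ N (fun t => χ ⬝ᵥ k t) ≤ X := by
      refine Real.le_sqrt_of_sq_le ?_
      nlinarith [mul_nonneg (sq_nonneg μ) (sq_nonneg (eucl χ))]
    refine (abs_sum_mul_le _ _).trans ((mul_le_mul (seqNorm_concatInput_le hg g) hX1
      (seqNorm_nonneg _) (by positivity)).trans ?_)
    have : 0 ≤ √(N : ℝ) * eucl g * X := by positivity
    linarith
  · have hW := log_sqrt_det_nonneg (N₁ := N₁) (N := N) μ k
    have h1 := log_add_le_pTilde hT hp
    have hlT : 0 ≤ Real.log T := Real.log_nonneg (by exact_mod_cast hT)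
    have hpt := pTilde_nonneg T p
    have h2 := hg.abs_sum_feature_le hS 0 (q := 28 * D) (by positivity) (by
      rw [pow_zero, div_one, log_det_gram_eq, Nat.cast_zero]
      linarith) g χ
    rw [pow_zero, div_one, ← hX, Real.sqrt_mul (by norm_num)] at h2
    refine h2.trans ?_
    have h3 : √28 ≤ 11 / 2 := by
      rw [Real.sqrt_le_left (by norm_num)]; norm_num
    have h4 : 0 ≤ √D * X * √T * eucl g := by positivity
    nlinarith [mul_le_mul_of_nonneg_right h3 h4]

/-- In dimension one with a small determinant, the correlation of the inputs with the features is
of lower order. -/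
theorem IsGood.abs_sum_le_of_lt_half {u : ℕ → Fin 1 → ℝ} {S : Finset (EuclideanSpace ℝ (Fin 1))}
    (hg : IsGood 1 N₁ N μ a₀ u e k S R Λ) (hS : IsNormingSet S)
    (hμ : 0 < μ) (ha₀' : a₀ < 1 / 2) {W : ℝ}
    (hW : W = Real.log (√(1 + (μ ^ 2)⁻¹ • (rowsMatrix N₁ N k * (rowsMatrix N₁ N k)ᵀ)).det))
    (hW2 : W < 1 / 2) (g : Fin 1 × Fin 1 → ℝ) (χ : Fin L → ℝ) :
    |∑ t ∈ Finset.Icc N₁ N, (g ⬝ᵥ concatInput 1 u t) * (χ ⬝ᵥ k t)| ≤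
      30 * √√W * eucl g *
        √(seqNorm N₁ N (fun t => χ ⬝ᵥ k t) ^ 2 + μ ^ 2 * eucl χ ^ 2) := by
  have hW0 : 0 ≤ W := hW ▸ log_sqrt_det_nonneg μ k
  set X := √(seqNorm N₁ N (fun t => χ ⬝ᵥ k t) ^ 2 + μ ^ 2 * eucl χ ^ 2) with hX
  have hX0 : 0 ≤ X := Real.sqrt_nonneg _
  have hXsq : X ^ 2 = seqNorm N₁ N (fun t => χ ⬝ᵥ k t) ^ 2 + μ ^ 2 * eucl χ ^ 2 :=
    Real.sq_sqrt (by positivity)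
  have hg0 := eucl_nonneg g
  set E := ∑ t ∈ Finset.Icc N₁ N, k t ⬝ᵥ k t with hE
  have hkk : ∀ t, 0 ≤ k t ⬝ᵥ k t := fun t => by rw [← eucl_sq]; positivity
  have hE0 : 0 ≤ E := Finset.sum_nonneg fun t _ => hkk t
  set v := (μ ^ 2)⁻¹ * E with hv
  have hv0 : 0 ≤ v := by positivity
  have hEv : E = v * μ ^ 2 := by rw [hv]; field_simp
  have htr : ∀ c : ℝ, (c • ((rowsMatrix N₁ N k)ᵀ * rowsMatrix N₁ N k)).trace = c * E := by
    intro c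
    rw [Matrix.trace_smul, trace_gram, smul_eq_mul]
  -- Indeed `1 + v ≤ det = e^{2W} ≤ 1 + 4W`, as `2W ≤ 1`.
  have hvW : v ≤ 4 * W := by
    have h1 := one_add_trace_le_det (posSemidef_smul_gram (N₁ := N₁) (N := N)
      (inv_nonneg.2 (sq_nonneg μ)) k)
    rw [htr] at h1
    have h2 := log_det_gram_eq (N₁ := N₁) (N := N) μ k
    rw [← hW] at h2
    rw [← Real.exp_log (lt_of_lt_of_le one_pos (one_le_det_gram (N₁ := N₁) (N := N)
      (inv_nonneg.2 (sq_nonneg μ)) k)), h2] at h1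
    have h3 := Real.abs_exp_sub_one_le (x := 2 * W) (by rw [abs_of_nonneg (by linarith)]; linarith)
    rw [abs_of_nonneg (show 0 ≤ 2 * W by linarith)] at h3
    have h4 := (abs_le.1 h3).2
    linarith
  rcases hv0.eq_or_lt with h0 | h0
  · have hk : ∀ t ∈ Finset.Icc N₁ N, k t = 0 := by
      intro t ht
      have h1 : E = 0 := by rw [hEv, ← h0, zero_mul]
      exact dotProduct_self_eq_zero.1 ((Finset.sum_eq_zero_iff_of_nonneg fun t _ => hkk t).1 h1 t ht)
    rw [Finset.sum_eq_zero fun t ht => by rw [hk t ht, dotProduct_zero, mul_zero], abs_zero]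
    positivity
  -- The finer ridge parameter `μ² r²` with `r² < v ≤ 4 r²` is comparable to the trace of the Gram
  -- matrix: the log-determinant stays below `4`, while the quadratic form drops to `5 r² X²`.
  · obtain ⟨i, hi1, hi2⟩ := exists_nat_pow_near_of_lt_one (x := v / 4) (y := 1 / 4) (by positivity)
      (by linarith) (by norm_num) (by norm_num)
    set r : ℝ := (1 / 2) ^ i with hr
    have hr0 : 0 < r := by positivity
    have hr4 : (1 / 4 : ℝ) ^ i = r ^ 2 := by rw [hr, ← pow_mul, mul_comm, pow_mul]; norm_num
    have h4i : (4 : ℝ) ^ i = (r ^ 2)⁻¹ := by rw [← hr4, one_div, inv_pow, inv_inv]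
    have h2i : (2 : ℝ) ^ i = r⁻¹ := by rw [hr, one_div, inv_pow, inv_inv]
    rw [pow_succ, hr4] at hi1
    rw [hr4] at hi2
    have hrW : r ≤ 2 * √W := by
      rw [← Real.sqrt_sq hr0.le, ← Real.sqrt_sq (show (0 : ℝ) ≤ 2 by norm_num),
        ← Real.sqrt_mul (by norm_num)]
      exact Real.sqrt_le_sqrt (by linarith)
    have hρ : μ ^ 2 / 4 ^ i = μ ^ 2 * r ^ 2 := by rw [h4i, div_inv_eq_mul]
    have hdet : Real.log (1 + (μ ^ 2 * r ^ 2)⁻¹ •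
        ((rowsMatrix N₁ N k)ᵀ * rowsMatrix N₁ N k)).det ≤ 4 := by
      have hc : 0 ≤ (μ ^ 2 * r ^ 2)⁻¹ := by positivity
      have h1 := det_le_exp_trace (posSemidef_smul_gram (N₁ := N₁) (N := N) hc k)
      rw [← Real.log_le_iff_le_exp (lt_of_lt_of_le one_pos (one_le_det_gram hc k)), htr, hEv] at h1
      refine h1.trans ?_
      rw [inv_mul_le_iff₀ (by positivity)]
      nlinarith [sq_nonneg μ]
    -- Bounding the price `i` of the scale by `2ⁱ = 1/r` leaves a squared correlation of order `r
    -- X²`, hence of order `√W X²`.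
    have hi : (i : ℝ) + 1 ≤ 2 ^ i := by exact_mod_cast Nat.lt_two_pow_self (n := i)
    have h1 := hg.abs_sum_feature_le hS i (q := 17 * r⁻¹) (by positivity) (by
      rw [hρ, ← h2i, Nat.cast_one, Real.log_one]
      linarith [Nat.cast_nonneg (α := ℝ) i]) g χ
    refine h1.trans ?_
    have hχ : seqNorm N₁ N (fun t => χ ⬝ᵥ k t) ^ 2 ≤ E * eucl χ ^ 2 := by
      rw [seqNorm_sq, hE, Finset.sum_mul]
      refine Finset.sum_le_sum fun t _ => ?_
      rw [← eucl_sq, ← mul_pow, ← sq_abs]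
      exact pow_le_pow_left₀ (abs_nonneg _) ((abs_dotProduct_le _ _).trans (mul_comm _ _).le) 2
    have hχX : μ ^ 2 * eucl χ ^ 2 ≤ X ^ 2 := by
      rw [hXsq]
      linarith [sq_nonneg (seqNorm N₁ N (fun t => χ ⬝ᵥ k t))]
    have h2 : seqNorm N₁ N (fun t => χ ⬝ᵥ k t) ^ 2 + μ ^ 2 / 4 ^ i * eucl χ ^ 2 ≤
        5 * r ^ 2 * X ^ 2 := by
      rw [hρ]
      have h3 : E * eucl χ ^ 2 ≤ 4 * r ^ 2 * (μ ^ 2 * eucl χ ^ 2) := by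
        rw [hEv, mul_assoc]
        exact mul_le_mul_of_nonneg_right (by linarith) (by positivity)
      have h4 := mul_le_mul_of_nonneg_left hχX (sq_nonneg r)
      linarith
    have h5 : 2 * (√(17 * r⁻¹) *
        √(seqNorm N₁ N (fun t => χ ⬝ᵥ k t) ^ 2 + μ ^ 2 / 4 ^ i * eucl χ ^ 2)) ≤
        30 * √√W * X := by
      rw [← Real.sqrt_mul (by positivity)]
      have h6 : √(17 * r⁻¹ *
          (seqNorm N₁ N (fun t => χ ⬝ᵥ k t) ^ 2 + μ ^ 2 / 4 ^ i * eucl χ ^ 2)) ≤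
          15 * √√W * X := by
        rw [Real.sqrt_le_left (by positivity), mul_pow, mul_pow, Real.sq_sqrt (Real.sqrt_nonneg W)]
        calc _ ≤ 17 * r⁻¹ * (5 * r ^ 2 * X ^ 2) := by gcongr
          _ = 85 * r * X ^ 2 := by field_simp; ring
          _ ≤ 85 * (2 * √W) * X ^ 2 := by gcongr
          _ ≤ 15 ^ 2 * √W * X ^ 2 := by
            have : 0 ≤ √W * X ^ 2 := by positivity
            linarith
      linarith
    rw [Nat.cast_one, Real.sqrt_one, mul_one]
    refine (mul_le_mul_of_nonneg_right h5 hg0).trans (le_of_eq ?_)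
    ring

/-- The deviation along one direction of the net, away from the one-dimensional regime with a small
determinant. -/
theorem IsGood.abs_sum_error_le_of_half_le (hg : IsGood T N₁ N μ a₀ u e k S R Λ)
    (hS : IsNormingSet S) (hR : IsNormingSet R)
    (hΛ : ∀ a : ℕ, ∀ ψ : EuclideanSpace ℝ (Fin L), ‖ψ‖ ≤ 22 * 2 ^ a / μ →
      ∃ ψ' ∈ Λ a, ‖ψ - ψ'‖ ≤ 1 / (μ * 2 ^ a))
    (hT : 1 ≤ T) (hp : 1 ≤ p) (hN : 1 ≤ N) (hμ : 0 < μ) (ha₀ : 0 ≤ a₀)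
    (hy : ∀ t ∈ Finset.Icc N₁ N, y t = G *ᵥ concatInput T u t + e t)
    {φ' : Matrix (Fin m) (Fin L) ℝ} (hφ' : IsRidgeFilter N₁ N μ k y φ') {D V o : ℝ}
    (hD : D = a₀ + pTilde T p +
      Real.log (√(1 + (μ ^ 2)⁻¹ • (rowsMatrix N₁ N k * (rowsMatrix N₁ N k)ᵀ)).det))
    (hD2 : 1 / 2 ≤ D) (hV : V = ‖G‖ * min √N (√T * √D)) (ho : o = Opt N₁ N μ e k + V)
    {w : EuclideanSpace ℝ (Fin m)} (hw : w ∈ R) (v : Fin T × Fin p → ℝ) :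
    |∑ t ∈ Finset.Icc N₁ N, (v ⬝ᵥ concatInput T u t) *
        (w.ofLp ⬝ᵥ e t - (φ'ᵀ *ᵥ w.ofLp) ⬝ᵥ k t)| ≤
      1400 * (o + μ) * √(T * (a₀ + dEff m p T N₁ N μ k o)) * eucl v := by
  have hO := Opt_nonneg (N₁ := N₁) (N := N) (e := e) (k := k) hμ
  have hV0 : 0 ≤ V := by rw [hV]; positivity
  have ho0 : 0 ≤ o := by rw [ho]; positivity
  obtain ⟨h1, h2⟩ := ridge_bounds hy hμ hφ' (hg.abs_sum_le_of_half_le hS hT hp ha₀ hD hD2)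
    (by positivity) (w := w.ofLp) (hR.norm_eq w hw)
  have h3 : 11 * min √(N : ℝ) (√T * √D) * ‖G‖ = 11 * V := by rw [hV]; ring
  rw [h3] at h1 h2
  refine (hg.abs_sum_residual_le hS hΛ hT hp hN hμ ha₀ ho0 hw (by linarith) (by linarith) v).trans ?_
  have hv := eucl_nonneg v
  gcongr
  norm_num

theorem IsGood.abs_sum_error_le_of_lt_half {u : ℕ → Fin 1 → ℝ}
    {S : Finset (EuclideanSpace ℝ (Fin 1))} {G : Matrix (Fin m) (Fin 1 × Fin 1) ℝ}
    (hg : IsGood 1 N₁ N μ a₀ u e k S R Λ)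
    (hS : IsNormingSet S) (hR : IsNormingSet R)
    (hΛ : ∀ a : ℕ, ∀ ψ : EuclideanSpace ℝ (Fin L), ‖ψ‖ ≤ 22 * 2 ^ a / μ →
      ∃ ψ' ∈ Λ a, ‖ψ - ψ'‖ ≤ 1 / (μ * 2 ^ a))
    (hN : 1 ≤ N) (hμ : 0 < μ) (ha₀ : 0 ≤ a₀)
    (hy : ∀ t ∈ Finset.Icc N₁ N, y t = G *ᵥ concatInput 1 u t + e t)
    {φ' : Matrix (Fin m) (Fin L) ℝ} (hφ' : IsRidgeFilter N₁ N μ k y φ') {D V o : ℝ}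
    (hD : D = a₀ + pTilde 1 1 +
      Real.log (√(1 + (μ ^ 2)⁻¹ • (rowsMatrix N₁ N k * (rowsMatrix N₁ N k)ᵀ)).det))
    (hD2 : D < 1 / 2) (hV : V = ‖G‖ * min √N (√(1 : ℕ) * √D)) (ho : o = Opt N₁ N μ e k + V)
    {w : EuclideanSpace ℝ (Fin m)} (hw : w ∈ R) (v : Fin 1 × Fin 1 → ℝ) :
    |∑ t ∈ Finset.Icc N₁ N, (v ⬝ᵥ concatInput 1 u t) *
        (w.ofLp ⬝ᵥ e t - (φ'ᵀ *ᵥ w.ofLp) ⬝ᵥ k t)| ≤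
      1400 * (o + μ) * √((1 : ℕ) * (a₀ + dEff m 1 1 N₁ N μ k o)) * eucl v := by
  have hO := Opt_nonneg (N₁ := N₁) (N := N) (e := e) (k := k) hμ
  have hV0 : 0 ≤ V := by rw [hV]; positivity
  have ho0 : 0 ≤ o := by rw [ho]; positivity
  set W := Real.log (√(1 + (μ ^ 2)⁻¹ • (rowsMatrix N₁ N k * (rowsMatrix N₁ N k)ᵀ)).det) with hW
  have hW0 : 0 ≤ W := log_sqrt_det_nonneg μ k
  have hpt := pTilde_nonneg 1 1
  have hs := hg.abs_sum_le_of_lt_half hS hμ (by linarith) hW (by linarith)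
  have hw1 : eucl w.ofLp = 1 := hR.norm_eq w hw
  set s := 30 * √√W with hsdef
  have hs0 : 0 ≤ s := by positivity
  have hsW : s ^ 2 = 900 * √W := by
    rw [hsdef, mul_pow, Real.sq_sqrt (Real.sqrt_nonneg W)]; norm_num
  have hW1 : √W ≤ 1 := Real.sqrt_le_one.2 (by linarith)
  have hs30 : s ≤ 30 := by
    have : √√W ≤ 1 := Real.sqrt_le_one.2 hW1
    linarith
  have hVW : ‖G‖ * √W ≤ V := by
    rw [hV, Nat.cast_one, Real.sqrt_one, one_mul]
    refine mul_le_mul_of_nonneg_left (le_min (hW1.trans ?_) (Real.sqrt_le_sqrt (by linarith)))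
      (norm_nonneg G)
    exact Real.one_le_sqrt.2 (by exact_mod_cast hN)
  -- The slack `min μ 1` serves both requirements of the residual bound, `11 (o + μ)` for the
  -- residual and `11 (o + 1)` for the filter.
  obtain ⟨φ, hφ⟩ := exists_filter_near_Opt (N₁ := N₁) (N := N) (e := e) (k := k) (μ := μ)
    (lt_min hμ one_pos)
  have hφμ := hφ.trans_le (add_le_add_right (min_le_left μ 1) _)
  have hφ1 := hφ.trans_le (add_le_add_right (min_le_right μ 1) _)
  have hn : 0 ≤ ‖rowsMatrix N₁ N e - rowsMatrix N₁ N k * φᵀ‖ := norm_nonneg _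
  have hn' : 0 ≤ μ * ‖φ‖ := by positivity
  have hX := ridge_comparison hy hμ hφ' hs hs0 φ hw1
  have hr := seqNorm_residual_le (N₁ := N₁) (N := N) (e := e) (k := k) φ w.ofLp
  have hφw := eucl_mulVec_le φᵀ w.ofLp
  rw [hw1, mul_one] at hr hφw
  rw [norm_transpose] at hφw
  have hφw' := mul_le_mul_of_nonneg_left hφw hμ.le
  have h1 := hg.abs_sum_residual_le hS hΛ le_rfl le_rfl hN hμ ha₀ ho0 hw
    (ψ := φᵀ *ᵥ w.ofLp) (by linarith) (by linarith) v
  have h2 := hs v (φ'ᵀ *ᵥ w.ofLp - φᵀ *ᵥ w.ofLp)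
  set χ := φ'ᵀ *ᵥ w.ofLp - φᵀ *ᵥ w.ofLp with hχ
  have hv := eucl_nonneg v
  -- The small factor `s` appears twice, in `X ≤ s ‖G‖ + …` and in front of `X`; thus `s² ‖G‖ = 900
  -- √W ‖G‖ ≤ 900 V`, whereas a single factor `W^{1/4}` would not be controlled by `V`.
  have h3 : s * √(seqNorm N₁ N (fun t => χ ⬝ᵥ k t) ^ 2 + μ ^ 2 * eucl χ ^ 2) ≤ 930 * (o + μ) := by
    have h4 := mul_le_mul_of_nonneg_left hX hs0
    have h5 := mul_le_mul hs30 hφμ.le (by positivity) (by norm_num)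
    have h6 : s * (s * ‖G‖) = 900 * (‖G‖ * √W) := by
      rw [← mul_assoc, ← sq, hsW]; ring
    rw [mul_add, h6] at h4
    linarith
  have h7 : |∑ t ∈ Finset.Icc N₁ N, (v ⬝ᵥ concatInput 1 u t) * (χ ⬝ᵥ k t)| ≤
      930 * (o + μ) * eucl v := by
    refine h2.trans ?_
    have := mul_le_mul_of_nonneg_right h3 hv
    linarith
  have h8 : ∑ t ∈ Finset.Icc N₁ N, (v ⬝ᵥ concatInput 1 u t) *
        (w.ofLp ⬝ᵥ e t - (φ'ᵀ *ᵥ w.ofLp) ⬝ᵥ k t) =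
      ∑ t ∈ Finset.Icc N₁ N, (v ⬝ᵥ concatInput 1 u t) *
        (w.ofLp ⬝ᵥ e t - (φᵀ *ᵥ w.ofLp) ⬝ᵥ k t) -
      ∑ t ∈ Finset.Icc N₁ N, (v ⬝ᵥ concatInput 1 u t) * (χ ⬝ᵥ k t) := by
    rw [← Finset.sum_sub_distrib]
    refine Finset.sum_congr rfl fun t _ => ?_
    rw [hχ, sub_dotProduct]
    ring
  rw [h8]
  refine (abs_sub _ _).trans ((add_le_add h1 h7).trans ?_)
  have hd := dEff_ge_one (m := m) (p := 1) (T := 1) (N₁ := N₁) (N := N) (k := k) (μ := μ) (o := o)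
  have h9 : 1 ≤ √((1 : ℕ) * (a₀ + dEff m 1 1 N₁ N μ k o)) := by
    rw [Nat.cast_one, one_mul]
    exact Real.one_le_sqrt.2 (by linarith)
  have h10 : 0 ≤ (o + μ) * eucl v := by positivity
  nlinarith [mul_le_mul_of_nonneg_left h9 h10]

/-- The oracle inequality on the good event. -/
theorem IsGood.norm_sub_le {δ : ℝ} (hδ : 0 < δ) (hδ1 : δ < 1)
    (hg : IsGood T N₁ N μ (Real.log (1 / δ)) u e k S R Λ)
    (hS : IsNormingSet S) (hR : IsNormingSet R)
    (hΛ : ∀ a : ℕ, ∀ ψ : EuclideanSpace ℝ (Fin L), ‖ψ‖ ≤ 22 * 2 ^ a / μ →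
      ∃ ψ' ∈ Λ a, ‖ψ - ψ'‖ ≤ 1 / (μ * 2 ^ a))
    (hT : 1 ≤ T) (hp : 1 ≤ p) (hN : 1 ≤ N) (hμ : 0 < μ)
    (hy : ∀ t ∈ Finset.Icc N₁ N, y t = G *ᵥ concatInput T u t + e t)
    {H : Matrix (Fin m) (Fin T × Fin p) ℝ} (hH : IsPFLS T N₁ N μ u k y H) :
    ‖H - G‖ ≤ 5600 * oracleBound T N₁ N μ δ G e k := by
  obtain ⟨φ', hφ', hH⟩ := hH
  have ha₀ : 0 ≤ Real.log (1 / δ) := Real.log_nonneg (by rw [le_div_iff₀ hδ]; linarith)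
  set o := Opt N₁ N μ e k + Ovfit T N₁ N μ δ G k with ho
  have ho0 : 0 ≤ o := add_nonneg (Opt_nonneg hμ) (by unfold Ovfit; positivity)
  have hN' : (0 : ℝ) < N := by exact_mod_cast hN
  set B := 1400 * (o + μ) * √(T * (Real.log (1 / δ) + dEff m p T N₁ N μ k o)) with hB
  have hB0 : 0 ≤ B := by positivity
  have key : ∀ w ∈ R, ∀ v : Fin T × Fin p → ℝ,
      |∑ t ∈ Finset.Icc N₁ N, (v ⬝ᵥ concatInput T u t) *
        (w.ofLp ⬝ᵥ e t - (φ'ᵀ *ᵥ w.ofLp) ⬝ᵥ k t)| ≤ B * eucl v := by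
    intro w hw v
    -- All three terms are nonnegative, so a sum below `1/2` gives `p̃ < 1` and hence `T = p = 1`.
    rcases le_or_gt (1 / 2) (Real.log (1 / δ) + pTilde T p +
      Real.log (√(1 + (μ ^ 2)⁻¹ • (rowsMatrix N₁ N k * (rowsMatrix N₁ N k)ᵀ)).det)) with h | h
    · exact hg.abs_sum_error_le_of_half_le hS hR hΛ hT hp hN hμ ha₀ hy hφ' rfl h rfl ho hw v
    · have hW := log_sqrt_det_nonneg (N₁ := N₁) (N := N) μ k
      have h1 : T * p = 1 := by
        by_contra hne
        have h2 := one_le_pTilde hT hp (by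
          have := Nat.mul_pos hT hp
          omega)
        linarith
      obtain rfl : T = 1 := Nat.eq_one_of_mul_eq_one_right h1
      obtain rfl : p = 1 := Nat.eq_one_of_mul_eq_one_left h1
      exact hg.abs_sum_error_le_of_lt_half hS hR hΛ hN hμ ha₀ hy hφ' rfl h rfl ho hw v
  have h1 : ∀ w ∈ R, ‖Matrix.toEuclideanLin (H - G)ᵀ w‖ ≤ 2 / N * B := fun w hw =>
    eucl_transpose_mulVec_le hy hH hN (fun v => (hg.iso v).1) w.ofLp hB0 (key w hw)
  have h2 : ‖H - G‖ ≤ 2 * (2 / N * B) := by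
    rw [← norm_transpose]
    exact norm_matrix_le _ (by positivity) fun v =>
      hR.bound _ (Matrix.toEuclideanLin (H - G)ᵀ) _ (by positivity) h1 (WithLp.toLp 2 v)
  -- Here `5600 = 2 · 2 · 1400`: the net of directions `w`, the inverse of the isometry constant,
  -- and the correlation bound.
  refine h2.trans (le_of_eq ?_)
  rw [oracleBound, ← ho, hB]
  have hsq : (√(N : ℝ))⁻¹ * (o + μ) / √(N : ℝ) = (o + μ) / N := by
    rw [← div_eq_inv_mul, div_div, Real.mul_self_sqrt hN'.le]
  rw [hsq]
  field_simp
  ring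

end Conclusion

/-! ### Probability of the good event -/

section UnionBound

variable {Ω : Type*} [MeasurableSpace Ω] {P : Measure Ω} {c : ℝ}

theorem measure_not_forall_mem_le {ι : Type*} {s : Finset ι} {Q : ι → Ω → Prop} {n : ℝ}
    (hc : 0 ≤ c) (hn : 0 < n) (hs : (s.card : ℝ) ≤ n)
    (h : ∀ b ∈ s, P {ω | ¬ Q b ω} ≤ ENNReal.ofReal (c / n)) :
    P {ω | ¬ ∀ b ∈ s, Q b ω} ≤ ENNReal.ofReal c := by
  have h1 : {ω | ¬ ∀ b ∈ s, Q b ω} = ⋃ b ∈ s, {ω | ¬ Q b ω} := by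
    ext ω
    simp
  rw [h1]
  refine (measure_biUnion_finset_le _ _).trans ((Finset.sum_le_sum h).trans ?_)
  rw [← ENNReal.ofReal_sum_of_nonneg fun _ _ => by positivity]
  refine ENNReal.ofReal_le_ofReal ?_
  rw [Finset.sum_const, nsmul_eq_mul, mul_div_assoc', div_le_iff₀ hn, mul_comm]
  exact mul_le_mul_of_nonneg_left hs hc

theorem measure_not_forall_lt_le {T : ℕ} {Q : ℕ → Ω → Prop} (hc : 0 ≤ c) (hT : 1 ≤ T)
    (h : ∀ j < T, P {ω | ¬ Q j ω} ≤ ENNReal.ofReal (c / T)) :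
    P {ω | ¬ ∀ j < T, Q j ω} ≤ ENNReal.ofReal c := by
  have := measure_not_forall_mem_le (s := Finset.range T) (Q := Q) hc (n := T)
    (by exact_mod_cast hT) (by simp) fun j hj => h j (Finset.mem_range.1 hj)
  simpa only [Finset.mem_range] using this

/-- Weighted union bound over infinitely many scales; it allows the scale to be chosen afterwards
from the data. -/
theorem measure_not_forall_nat_le {Q : ℕ → Ω → Prop} {q : ℕ → ℝ} (hc : 0 ≤ c)
    (hq : ∀ i, 0 ≤ q i) (hsum : ∀ n, ∑ i ∈ Finset.range n, q i ≤ 1)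
    (h : ∀ i, P {ω | ¬ Q i ω} ≤ ENNReal.ofReal (c * q i)) :
    P {ω | ¬ ∀ i, Q i ω} ≤ ENNReal.ofReal c := by
  have h1 : {ω | ¬ ∀ i, Q i ω} = ⋃ i, {ω | ¬ Q i ω} := by
    ext ω
    simp
  rw [h1]
  refine (measure_iUnion_le _).trans (ENNReal.tsum_le_of_sum_range_le fun n => ?_)
  refine (Finset.sum_le_sum fun i _ => h i).trans ?_
  rw [← ENNReal.ofReal_sum_of_nonneg fun i _ => mul_nonneg hc (hq i), ← Finset.mul_sum]
  exact ENNReal.ofReal_le_ofReal (mul_le_of_le_one_right hc (hsum n))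

theorem sum_half_pow_le_one (n : ℕ) : ∑ i ∈ Finset.range n, (1 / 2 : ℝ) ^ (i + 1) ≤ 1 := by
  have h : ∑ i ∈ Finset.range n, (1 / 2 : ℝ) ^ (i + 1) = 1 - (1 / 2) ^ n := by
    induction n with
    | zero => simp
    | succ n ih => rw [Finset.sum_range_succ, ih]; ring
  rw [h]
  linarith [show (0 : ℝ) ≤ (1 / 2) ^ n by positivity]

theorem sum_inv_mul_succ_le_one (n : ℕ) :
    ∑ i ∈ Finset.range n, (1 / ((i + 1) * (i + 2)) : ℝ) ≤ 1 := by
  have h : ∑ i ∈ Finset.range n, (1 / ((i + 1) * (i + 2)) : ℝ) = 1 - 1 / (n + 1) := by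
    induction n with
    | zero => simp
    | succ n ih => rw [Finset.sum_range_succ, ih]; push_cast; field_simp; ring
  rw [h]
  linarith [show (0 : ℝ) ≤ 1 / (n + 1) by positivity]

end UnionBound

/-! ### Logarithmic cost of the confidence level given to each event. -/

section Levels

theorem log_five_le : Real.log 5 ≤ 2 := by
  rw [Real.log_le_iff_le_exp (by norm_num)]
  have : (2.7 : ℝ) ^ 2 ≤ Real.exp 1 ^ 2 := by
    have := Real.exp_one_gt_d9
    gcongr
    linarith
  rw [← Real.exp_nat_mul] at this
  norm_num at this ⊢
  linarith

theorem log_forty_five_le : Real.log 45 ≤ 4 := by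
  rw [Real.log_le_iff_le_exp (by norm_num)]
  have : (2.7 : ℝ) ^ 4 ≤ Real.exp 1 ^ 4 := by
    have := Real.exp_one_gt_d9
    gcongr
    linarith
  rw [← Real.exp_nat_mul] at this
  norm_num at this ⊢
  linarith

theorem log_inv_feature_level_le {δ : ℝ} (hδ : 0 < δ) {T : ℕ} (hT : 1 ≤ T) (p i : ℕ) :
    Real.log (1 / (δ / 2 / T / 5 ^ p * (1 / 2) ^ (i + 1))) ≤
      Real.log (1 / δ) + Real.log T + 2 * p + i + 3 := by
  have hT' : (0 : ℝ) < T := by exact_mod_cast hT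
  have e : 1 / (δ / 2 / T / 5 ^ p * (1 / 2) ^ (i + 1)) = 1 / δ * T * 5 ^ p * 2 ^ (i + 2) := by
    rw [pow_succ 2 (i + 1), one_div_pow]
    field_simp
  rw [e, Real.log_mul (by positivity) (by positivity), Real.log_mul (by positivity) (by positivity),
    Real.log_mul (by positivity) (by positivity), Real.log_pow, Real.log_pow]
  have h2 := Real.log_two_lt_d9
  have h5 := log_five_le
  have hp : (0 : ℝ) ≤ p := Nat.cast_nonneg p
  have hi : (0 : ℝ) ≤ i := Nat.cast_nonneg i
  push_cast
  nlinarith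

theorem log_inv_residual_level_le {δ : ℝ} (hδ : 0 < δ) {T : ℕ} (hT : 1 ≤ T) (p m L a i : ℕ) :
    Real.log (1 / (δ / 2 / T / 5 ^ p / 5 ^ m * (1 / 2) ^ (a + 1) / (1 + 44 * 4 ^ a) ^ L *
      (1 / ((i + 1) * (i + 2))))) ≤
      Real.log (1 / δ) + Real.log T + 2 * p + 2 * m + (L * (4 + 2 * a) + a) +
        2 * Real.log (i + 1) + 4 := by
  have hT' : (0 : ℝ) < T := by exact_mod_cast hT
  have e : 1 / (δ / 2 / T / 5 ^ p / 5 ^ m * (1 / 2) ^ (a + 1) / (1 + 44 * 4 ^ a) ^ L *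
      (1 / ((i + 1) * (i + 2)))) = 1 / δ * T * 5 ^ p * 5 ^ m * 2 ^ (a + 2) *
      (1 + 44 * 4 ^ a) ^ L * (i + 1 : ℝ) * (i + 2 : ℝ) := by
    rw [pow_succ 2 (a + 1), one_div_pow]
    field_simp
  rw [e, Real.log_mul (by positivity) (by positivity), Real.log_mul (by positivity) (by positivity),
    Real.log_mul (by positivity) (by positivity), Real.log_mul (by positivity) (by positivity),
    Real.log_mul (by positivity) (by positivity), Real.log_mul (by positivity) (by positivity),
    Real.log_mul (by positivity) (by positivity), Real.log_pow, Real.log_pow, Real.log_pow,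
    Real.log_pow]
  have h2 := Real.log_two_lt_d9
  have h5 := log_five_le
  have hp : (0 : ℝ) ≤ p := Nat.cast_nonneg p
  have hm : (0 : ℝ) ≤ m := Nat.cast_nonneg m
  have hi : (0 : ℝ) ≤ i := Nat.cast_nonneg i
  have ha : (0 : ℝ) ≤ a := Nat.cast_nonneg a
  have hL : (0 : ℝ) ≤ L := Nat.cast_nonneg L
  have h1 : Real.log (1 + 44 * 4 ^ a) ≤ 4 + 2 * a := by
    calc Real.log (1 + 44 * 4 ^ a) ≤ Real.log (45 * 2 ^ (2 * a)) := by
          refine Real.log_le_log (by positivity) ?_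
          rw [pow_mul]
          have : (1 : ℝ) ≤ 4 ^ a := one_le_pow₀ (by norm_num)
          norm_num
          linarith
      _ = Real.log 45 + 2 * a * Real.log 2 := by
          rw [Real.log_mul (by norm_num) (by positivity), Real.log_pow]
          push_cast
          ring
      _ ≤ 4 + 2 * a := by nlinarith [log_forty_five_le]
  have h3 : Real.log (i + 2) ≤ Real.log (i + 1) + Real.log 2 := by
    rw [← Real.log_mul (by positivity) (by norm_num)]
    exact Real.log_le_log (by positivity) (by linarith)
  have h4 := mul_le_mul_of_nonneg_left h1 hL
  push_cast
  nlinarith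

end Levels

theorem exists_isNormingSet (d : ℕ) :
    ∃ S : Finset (EuclideanSpace ℝ (Fin d)), IsNormingSet S ∧ (S.card : ℝ) ≤ 5 ^ d := by
  obtain ⟨S, h1, h2, h3⟩ := exists_sphere_net d
  exact ⟨S, ⟨h2, h3⟩, h1⟩

/-- Level `a` has radius `22 · 2ᵃ / μ` and mesh `1 / (μ 2ᵃ)`; their ratio does not involve `μ`, so
the cardinality depends only on `a` and `L`. -/
theorem exists_multiscale_net (L : ℕ) {μ : ℝ} (hμ : 0 < μ) :
    ∃ Λ : ℕ → Finset (EuclideanSpace ℝ (Fin L)),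
      (∀ a, ((Λ a).card : ℝ) ≤ (1 + 44 * 4 ^ a) ^ L) ∧
      ∀ a : ℕ, ∀ ψ : EuclideanSpace ℝ (Fin L), ‖ψ‖ ≤ 22 * 2 ^ a / μ →
        ∃ ψ' ∈ Λ a, ‖ψ - ψ'‖ ≤ 1 / (μ * 2 ^ a) := by
  have h : ∀ a : ℕ, ∃ s : Finset (EuclideanSpace ℝ (Fin L)),
      (s.card : ℝ) ≤ (1 + 44 * 4 ^ a) ^ L ∧
      ∀ ψ : EuclideanSpace ℝ (Fin L), ‖ψ‖ ≤ 22 * 2 ^ a / μ →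
        ∃ ψ' ∈ s, ‖ψ - ψ'‖ ≤ 1 / (μ * 2 ^ a) := by
    intro a
    obtain ⟨s, -, h2, h3⟩ := exists_net (E := EuclideanSpace ℝ (Fin L)) (R := 22 * 2 ^ a / μ)
      (r := 1 / (μ * 2 ^ a)) (by positivity) (by positivity) {x | ‖x‖ ≤ 22 * 2 ^ a / μ}
      fun x hx => hx
    refine ⟨s, ?_, h3⟩
    have e : 1 + 2 * (22 * 2 ^ a / μ) / (1 / (μ * 2 ^ a)) = 1 + 44 * (4 : ℝ) ^ a := by
      rw [show (4 : ℝ) = 2 ^ 2 by norm_num, ← pow_mul, mul_comm 2 a, pow_mul]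
      field_simp
      ring
    rwa [e, finrank_euclideanSpace_fin] at h2
  choose Λ h1 h2 using h
  exact ⟨Λ, h1, h2⟩

/-! ### Union bounds over lags, nets and scales. -/

section Probability

variable {Ω : Type*} [mΩ : MeasurableSpace Ω] {P : Measure Ω} [IsProbabilityMeasure P]
  {𝓕 : Filtration ℕ mΩ} {m p L T N₁ N : ℕ} {G : Matrix (Fin m) (Fin T × Fin p) ℝ}
  {x : ℕ → Ω → Fin p → ℝ} {e : ℕ → Ω → Fin m → ℝ} {k : ℕ → Ω → Fin L → ℝ}
  {y : ℕ → Ω → Fin m → ℝ} {S : Finset (EuclideanSpace ℝ (Fin p))}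
  {R : Finset (EuclideanSpace ℝ (Fin m))} {Λ : ℕ → Finset (EuclideanSpace ℝ (Fin L))} {μ δ : ℝ}

theorem IsNormingSet.sum_sq_eq (hS : IsNormingSet S) {z : EuclideanSpace ℝ (Fin p)} (hz : z ∈ S) :
    ∑ q, z.ofLp q ^ 2 = 1 := by
  have h : eucl z.ofLp = 1 := hS.norm_eq z hz
  rw [← eucl_sq_eq_sum, h, one_pow]

theorem IsSemiParametricModel.measure_not_feature_le
    (h : IsSemiParametricModel P 𝓕 T N₁ N G x e k y) (hT1 : 1 ≤ T) (hT : T ≤ N₁) (hμ : 0 < μ)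
    (hδ : 0 < δ) (hS : IsNormingSet S) (hSc : (S.card : ℝ) ≤ 5 ^ p) :
    P {ω | ¬ ∀ j < T, ∀ z ∈ S, ∀ (i : ℕ) (χ : Fin L → ℝ),
      (∑ t ∈ Finset.Icc N₁ N, (z.ofLp ⬝ᵥ x (t - j) ω) * (k t ω ⬝ᵥ χ)) ^ 2 ≤
      (2 * (Real.log (1 / δ) + Real.log T + 2 * p + i + 3) + Real.log (Matrix.det
        (1 + (μ ^ 2 / 4 ^ i)⁻¹ • ((rowsMatrix N₁ N fun t => k t ω)ᵀ *
          rowsMatrix N₁ N fun t => k t ω)))) *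
      (∑ t ∈ Finset.Icc N₁ N, (k t ω ⬝ᵥ χ) ^ 2 + μ ^ 2 / 4 ^ i * (χ ⬝ᵥ χ))} ≤
      ENNReal.ofReal (δ / 2) := by
  refine measure_not_forall_lt_le (by positivity) hT1 fun j hj =>
    measure_not_forall_mem_le (n := 5 ^ p) (by positivity) (by positivity) hSc fun z hz =>
    measure_not_forall_nat_le (q := fun i => (1 / 2) ^ (i + 1)) (by positivity)
      (fun i => by positivity) sum_half_pow_le_one fun i => ?_
  refine (measure_mono fun ω hω => ?_).trans (h.self_normalized hT hj (hS.sum_sq_eq hz)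
    h.feature_measurable (ρ := μ ^ 2 / 4 ^ i) (by positivity)
    (δ := δ / 2 / T / 5 ^ p * (1 / 2) ^ (i + 1)) (by positivity))
  simp only [Set.mem_ofPred_eq] at hω ⊢
  contrapose! hω
  intro χ
  refine (hω χ).trans (mul_le_mul_of_nonneg_right ?_ ?_)
  · linarith [log_inv_feature_level_le hδ hT1 p i]
  · have h1 : 0 ≤ χ ⬝ᵥ χ := by rw [← eucl_sq]; positivity
    have h2 : 0 ≤ ∑ t ∈ Finset.Icc N₁ N, (k t ω ⬝ᵥ χ) ^ 2 :=
      Finset.sum_nonneg fun _ _ => sq_nonneg _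
    positivity

/-- For deterministic `w` and `ψ` the residual is predictable, so the scalar bound applies to each.
Geometric weights suffice for the resolution `a`, whose cost is linear in `a` anyway through the
net; the scale `i` gets the weights `1/((i+1)(i+2))`, which cost only `log i`. -/
theorem IsSemiParametricModel.measure_not_residual_le
    (h : IsSemiParametricModel P 𝓕 T N₁ N G x e k y) (hT1 : 1 ≤ T) (hT : T ≤ N₁) (hμ : 0 < μ)
    (hδ : 0 < δ) (hS : IsNormingSet S) (hSc : (S.card : ℝ) ≤ 5 ^ p) (hRc : (R.card : ℝ) ≤ 5 ^ m)
    (hΛ : ∀ a, ((Λ a).card : ℝ) ≤ (1 + 44 * 4 ^ a) ^ L) :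
    P {ω | ¬ ∀ j < T, ∀ z ∈ S, ∀ w ∈ R, ∀ a : ℕ, ∀ ψ ∈ Λ a, ∀ i : ℕ,
      (∑ t ∈ Finset.Icc N₁ N, (z.ofLp ⬝ᵥ x (t - j) ω) *
        (w.ofLp ⬝ᵥ e t ω - ψ.ofLp ⬝ᵥ k t ω)) ^ 2 ≤
      (2 * (Real.log (1 / δ) + Real.log T + 2 * p + 2 * m + (L * (4 + 2 * a) + a) +
          2 * Real.log (i + 1) + 4) +
        Real.log (1 + (μ ^ 2 * 4 ^ i)⁻¹ * ∑ t ∈ Finset.Icc N₁ N,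
          (w.ofLp ⬝ᵥ e t ω - ψ.ofLp ⬝ᵥ k t ω) ^ 2)) *
      (∑ t ∈ Finset.Icc N₁ N, (w.ofLp ⬝ᵥ e t ω - ψ.ofLp ⬝ᵥ k t ω) ^ 2 + μ ^ 2 * 4 ^ i)} ≤
      ENNReal.ofReal (δ / 2) := by
  refine measure_not_forall_lt_le (by positivity) hT1 fun j hj =>
    measure_not_forall_mem_le (n := 5 ^ p) (by positivity) (by positivity) hSc fun z hz =>
    measure_not_forall_mem_le (n := 5 ^ m) (by positivity) (by positivity) hRc fun w _ =>
    measure_not_forall_nat_le (q := fun a => (1 / 2) ^ (a + 1)) (by positivity)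
      (fun a => by positivity) sum_half_pow_le_one fun a =>
    measure_not_forall_mem_le (n := (1 + 44 * 4 ^ a) ^ L) (by positivity) (by positivity) (hΛ a)
      fun ψ _ => measure_not_forall_nat_le (q := fun i : ℕ => 1 / ((i + 1) * (i + 2)))
      (by positivity) (fun i => by positivity) sum_inv_mul_succ_le_one fun i => ?_
  have hmeas : ∀ t ∈ Finset.Icc N₁ N,
      Measurable[𝓕 (t - T)] fun ω => w.ofLp ⬝ᵥ e t ω - ψ.ofLp ⬝ᵥ k t ω := fun t ht =>
    (Finset.measurable_sum _ fun q _ =>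
      ((measurable_pi_apply q).comp (h.error_measurable t ht)).const_mul _).sub
    (Finset.measurable_sum _ fun q _ =>
      ((measurable_pi_apply q).comp (h.feature_measurable t ht)).const_mul _)
  refine (measure_mono fun ω hω => ?_).trans (h.self_normalized_scalar hT hj (hS.sum_sq_eq hz)
    hmeas (ρ := μ ^ 2 * 4 ^ i) (by positivity)
    (δ := δ / 2 / T / 5 ^ p / 5 ^ m * (1 / 2) ^ (a + 1) / (1 + 44 * 4 ^ a) ^ L *
      (1 / ((i + 1) * (i + 2)))) (by positivity))
  simp only [Set.mem_ofPred_eq] at hω ⊢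
  contrapose! hω
  refine hω.trans (mul_le_mul_of_nonneg_right ?_ ?_)
  · linarith [log_inv_residual_level_le hδ hT1 p m L a i]
  · have h2 : 0 ≤ ∑ t ∈ Finset.Icc N₁ N, (w.ofLp ⬝ᵥ e t ω - ψ.ofLp ⬝ᵥ k t ω) ^ 2 :=
      Finset.sum_nonneg fun _ _ => sq_nonneg _
    positivity

theorem IsSemiParametricModel.measure_not_isGood_le
    (h : IsSemiParametricModel P 𝓕 T N₁ N G x e k y) (hT1 : 1 ≤ T) (hT : T ≤ N₁)
    (hN₁ : 10 * N₁ ≤ N) (hTN : 50 * T ≤ N) (hμ : 0 < μ)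
    (hδ : 0 < δ) (hS : IsNormingSet S) (hSc : (S.card : ℝ) ≤ 5 ^ p) (hRc : (R.card : ℝ) ≤ 5 ^ m)
    (hΛ : ∀ a, ((Λ a).card : ℝ) ≤ (1 + 44 * 4 ^ a) ^ L) :
    P {ω | ¬ IsGood T N₁ N μ (Real.log (1 / δ)) (fun t => x t ω) (fun t => e t ω)
      (fun t => k t ω) S R Λ} ≤
      ENNReal.ofReal (δ + 144 * T ^ 2 * 201 ^ (2 * p) * Real.exp (-(N / (1280000 * T)))) := by
  have h1 := h.measure_not_isometry_le hT1 hT hN₁ hTN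
  have h2 := h.measure_not_feature_le hT1 hT hμ hδ hS hSc
  have h3 := h.measure_not_residual_le (R := R) hT1 hT hμ hδ hS hSc hRc hΛ
  have h4 := add_le_add (add_le_add h2 h3) h1
  rw [← ENNReal.ofReal_add (by positivity) (by positivity), add_halves,
    ← ENNReal.ofReal_add hδ.le (by positivity)] at h4
  refine le_trans ?_ h4
  refine (measure_mono ?_).trans ((measure_union_le _ _).trans
    (add_le_add_left (measure_union_le _ _) _))
  intro ω hω
  by_contra hc
  simp only [Set.mem_union, Set.mem_ofPred_eq, not_or, not_not] at hc
  exact hω ⟨hc.2, hc.1.1, hc.1.2⟩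

end Probability

/-- `deltaU` equals `e^{-q}` with `q = A² B² ≥ 1`, and `32000000 = 25 · 1280000` makes the exponent
of the isometry failure at least `25 p q`. The prefactors and `q` itself consume at most `(6 + 2 +
12 + 1) p q`. -/
theorem failure_le_deltaU {T p N : ℕ} (hT : 1 ≤ T) (hp : 1 ≤ p) (hN : 10 ≤ N)
    (h : 32000000 * (T * p : ℝ) * Real.log (2 * T * p) ^ 2 * Real.log (2 * N * p) ^ 2 ≤ N) :
    144 * T ^ 2 * 201 ^ (2 * p) * Real.exp (-(N / (1280000 * T))) ≤ deltaU T N p ∧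
      50 * T ≤ N := by
  have hT' : (1 : ℝ) ≤ T := by exact_mod_cast hT
  have hp' : (1 : ℝ) ≤ p := by exact_mod_cast hp
  have hN' : (10 : ℝ) ≤ N := by exact_mod_cast hN
  set A := Real.log (2 * T * p) with hA
  set B := Real.log (2 * N * p) with hB
  have hTp : (1 : ℝ) ≤ T * p := by nlinarith
  have hNp : (10 : ℝ) ≤ N * p := by nlinarith
  have hA1 : 0.69 ≤ A := by
    have h1 : Real.log 2 ≤ A := Real.log_le_log (by norm_num) (by linarith)
    linarith [Real.log_two_gt_d9]
  have hB1 : 2 ≤ B := by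
    rw [hB, Real.le_log_iff_exp_le (by positivity)]
    have h1 : Real.exp 1 ^ 2 ≤ (2.8 : ℝ) ^ 2 := by
      have := Real.exp_one_lt_d9
      gcongr
      linarith
    rw [← Real.exp_nat_mul] at h1
    norm_num at h1
    linarith
  have hlogT : Real.log T ≤ A := Real.log_le_log (by positivity) (by nlinarith)
  have hAB : A ≤ A * B := le_mul_of_one_le_right (by linarith) (by linarith)
  have hAB1 : 1 ≤ A * B := by nlinarith
  set q := A ^ 2 * B ^ 2 with hq
  have hqAB : A * B ≤ q := by
    have : q = (A * B) * (A * B) := by rw [hq]; ring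
    rw [this]
    exact le_mul_of_one_le_right (by linarith) hAB1
  have hq1 : 1 ≤ q := hAB1.trans hqAB
  have h0 : 32000000 * (T * p : ℝ) * q ≤ N := by
    rw [hq]
    linarith
  have hpq : 1 ≤ p * q := by nlinarith
  constructor
  · have e1 : deltaU T N p = Real.exp (-q) := by
      rw [deltaU, Real.rpow_def_of_pos (by positivity), ← hA, ← hB, hq]
      congr 1
      ring
    have e2 : (144 : ℝ) * T ^ 2 * 201 ^ (2 * p) =
        Real.exp (Real.log 144 + 2 * Real.log T + 2 * p * Real.log 201) := by
      have a1 : (T : ℝ) ^ 2 = Real.exp (2 * Real.log T) := by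
        rw [← Real.exp_log (show (0 : ℝ) < T ^ 2 by positivity), Real.log_pow]
        norm_num
      have a2 : (201 : ℝ) ^ (2 * p) = Real.exp (2 * p * Real.log 201) := by
        rw [← Real.exp_log (show (0 : ℝ) < 201 ^ (2 * p) by positivity), Real.log_pow]
        push_cast
        rfl
      rw [Real.exp_add, Real.exp_add, Real.exp_log (by norm_num), a1, a2]
    rw [e1, e2, ← Real.exp_add]
    refine Real.exp_le_exp.2 ?_
    have h1 : 25 * (p * q) ≤ N / (1280000 * T) := by
      rw [le_div_iff₀ (by positivity)]
      linarith
    have h6 : ((2.7 : ℝ) ^ 6) ≤ Real.exp 1 ^ 6 := by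
      have := Real.exp_one_gt_d9
      gcongr
      linarith
    rw [← Real.exp_nat_mul] at h6
    norm_num at h6
    have h201 : Real.log 201 ≤ 6 := by
      rw [Real.log_le_iff_le_exp (by norm_num)]
      linarith
    have h144 : Real.log 144 ≤ 6 := by
      rw [Real.log_le_iff_le_exp (by norm_num)]
      linarith
    have h2 : q ≤ p * q := le_mul_of_one_le_left (by linarith) hp'
    have h3 : (p : ℝ) ≤ p * q := le_mul_of_one_le_right (by linarith) hq1
    have h4 : p * Real.log 201 ≤ p * 6 := by gcongr
    linarith
  · have h1 : (50 * T : ℝ) ≤ N := by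
      refine le_trans ?_ h0
      have : (T : ℝ) * 1 ≤ T * (p * q) := by gcongr
      linarith
    exact_mod_cast h1

end PFLS

theorem mainTheorem1 :
    ∃ C : ℝ, 0 < C ∧ ∃ c : ℝ, 0 < c ∧
      ∀ (Ω : Type u) (mΩ : MeasurableSpace Ω) (P : Measure Ω) (_ : IsProbabilityMeasure P)
        (𝓕 : Filtration ℕ mΩ) (m p L T N₁ N : ℕ)
        (G : Matrix (Fin m) (Fin T × Fin p) ℝ)
        (x : ℕ → Ω → Fin p → ℝ) (e : ℕ → Ω → Fin m → ℝ) (k : ℕ → Ω → Fin L → ℝ)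
        (y : ℕ → Ω → Fin m → ℝ) (μ δ : ℝ),
        1 ≤ T → 1 ≤ p → 0 < μ → 0 < δ → δ < 1 →
        T ≤ N₁ → (N₁ : ℝ) ≤ N / 10 →
        c * (T * p) * Real.log (2 * T * p) ^ 2 * Real.log (2 * N * p) ^ 2 ≤ N →
        PFLS.IsSemiParametricModel P 𝓕 T N₁ N G x e k y →
        P {ω | ¬ ∀ H : Matrix (Fin m) (Fin T × Fin p) ℝ,
            PFLS.IsPFLS T N₁ N μ (fun t => x t ω) (fun t => k t ω) (fun t => y t ω) H →
            ‖H - G‖ ≤ C * PFLS.oracleBound T N₁ N μ δ G (fun t => e t ω) (fun t => k t ω)}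
          ≤ ENNReal.ofReal (δ + PFLS.deltaU T N p) := by
  refine ⟨5600, by norm_num, 32000000, by norm_num, ?_⟩
  intro Ω mΩ P _ 𝓕 m p L T N₁ N G x e k y μ δ hT1 hp hμ hδ hδ1 hT hN₁ hN h
  have hN₁' : 10 * N₁ ≤ N := by
    have : (10 * N₁ : ℝ) ≤ N := by linarith
    exact_mod_cast this
  obtain ⟨h1, h2⟩ := PFLS.failure_le_deltaU hT1 hp (by omega) hN
  obtain ⟨S, hS, hSc⟩ := PFLS.exists_isNormingSet p
  obtain ⟨R, hR, hRc⟩ := PFLS.exists_isNormingSet m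
  obtain ⟨Λ, hΛc, hΛ⟩ := PFLS.exists_multiscale_net L hμ
  -- Monotonicity of outer measure suffices, so measurability of the failure set is not required.
  refine le_trans (measure_mono fun ω hω => ?_) ((h.measure_not_isGood_le (R := R) hT1 hT hN₁' h2 hμ
    hδ hS hSc hRc hΛc).trans (ENNReal.ofReal_le_ofReal (by linarith)))
  simp only [Set.mem_ofPred_eq] at hω ⊢
  contrapose! hω
  exact fun H hH => hω.norm_sub_le hδ hδ1 hS hR hΛ hT1 hp (by omega) hμ
    (fun t ht => h.observation_eq t ht ω) hH
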